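/- Let $D\ge 3$. A \emph{stranded graph} of the two-symmetric-tensor $K_{D+1}$ model is built from finitely many vertices of two types $T$ and $P$ and finitely many rings, as follows. Each vertex has $D+1$ half-edges labelled $0,\dots,D$; the half-edge $i$ carries $D$ strand ends, one for each $j\ne i$, and inside the vertex the strand end $j$ of half-edge $i$ is joined to the strand end $i$ of half-edge $j$ (a \emph{corner}; there are $\binom{D+1}{2}$ corners per vertex). Every half-edge belongs to exactly one edge; each edge joins a half-edge of a $T$-vertex to a half-edge of a $P$-vertex and carries an arbitrary bijection between the $D$ strand ends on its two sides. A \emph{ring} is a component without vertices: one edge closed onto itself, carrying an arbitrary permutation of its $D$ strands. Graphs are considered up to change of embedding, i.e. up to permuting the half-edges around each vertex (the corners being carried along) and relabelling the strands of rings. The \emph{faces} are the closed lines formed by the strands and corners. If $G$ is connected with $V(G)$ vertices and $F(G)$ faces, its \emph{degree} is $$\omega(G)=D+\frac{D(D-1)}{4}\,V(G)-F(G).$$ The \emph{melonic ring graph} is the single ring with the identity permutation of its $D$ strands. To \emph{insert a pair of vertices} on an edge $e$ means to cut $e$ and place on it a new $T$-vertex $T'$ and a new $P$-vertex $P'$ whose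 half-edges are labelled so that one half-edge of each, say $a$, is attached to the two cut ends of $e$ (that of $P'$ to the $T$-side, that of $T'$ to the $P$-side), while for each of the $D$ labels $c\neq a$ the half-edges $c$ of $T'$ and $P'$ are joined by an edge with parallel strands (for each $j\ne c$, the strand end $j$ at $T'$ is joined to the strand end $j$ at $P'$); the bijection of the strands of $e$ is retained as the composition of those of the two outer edges. On a ring, the same insertion turns the ring into a graph with two vertices and $D+1$ edges. A graph is \emph{melonic} if it admits an embedding such that it is either the melonic ring graph, or is obtained from a melonic graph $G'$ with strictly fewer vertices by inserting, on one of the edges of $G'$, two vertices connected by $D$ parallel edges with parallel strands. \textbf{Theorem.} Let $D\ge3$ and let $G$ be a connected stranded graph. Then $\omega(G)=0$ if and only if $G$ is melonic (equivalently, $G$ has an embedding obtained from the melonic ring graph by finitely many successive insertions of pairs of vertices joined by $D$ parallel edges with parallel strands). -/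

import Mathlib

/-- A finite, possibly disconnected, Feynman graph of the model with two symmetric tensors `T`, `P`
of rank `D` and interaction `K_{D+1}`.

* Every vertex has half-edges labelled `0, …, D`; its half-edge `i` carries `D` strand ends, one for
  each label `j ≠ i`, and inside the vertex the strand end `j` of the half-edge `i` is joined to the
  strand end `i` of the half-edge `j` (a *corner*).
* Every edge joins a half-edge of a `T`-vertex to a half-edge of a `P`-vertex and carries an arbitrary
  bijection between the `D` strand ends on both sides.
* There may be vertexless components: a stranded edge closed onto itself, with an arbitrary
  permutation of its `D` strands. -/
structure StrandedGraph (D : ℕ) where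
  /-- the vertices of type `T` -/
  VT : Type
  /-- the vertices of type `P` -/
  VP : Type
  /-- the rings (components without vertices) -/
  R : Type
  finVT : Finite VT
  finVP : Finite VP
  finR : Finite R
  /-- the edges, as a pairing of the half-edges of `T`-vertices with those of `P`-vertices -/
  pairing : VT × Fin (D + 1) ≃ VP × Fin (D + 1)
  /-- For the edge leaving the half-edge `(t, i)` and ending at the half-edge `(p, k)`, the bijection
  `{j // j ≠ i} ≃ {l // l ≠ k}` of strand ends, encoded as the permutation of `{0, …, D}` which
  extends it by `i ↦ k`. -/
  strands : VT × Fin (D + 1) → Equiv.Perm (Fin (D + 1))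
  strands_self : ∀ t i, strands (t, i) i = (pairing (t, i)).2
  /-- the permutation of the `D` strands of a ring -/
  ringPerm : R → Equiv.Perm (Fin D)

namespace StrandedGraph

variable {D : ℕ}

/-- The number of vertices. -/
noncomputable def numVertices (G : StrandedGraph D) : ℕ := Nat.card G.VT + Nat.card G.VP

/-- The strands of the edges and of the rings. A strand of an edge is named by its end `(t, i, j)`
at the `T`-vertex `t`: the strand end `j ≠ i` of the half-edge `i`. -/
abbrev Strand (G : StrandedGraph D) : Type :=
  {x : G.VT × Fin (D + 1) × Fin (D + 1) // x.2.1 ≠ x.2.2} ⊕ (G.R × Fin D)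

/-- The end at a `P`-vertex of the edge strand which leaves its `T`-vertex at `(t, i, j)`. -/
def endP (G : StrandedGraph D) (x : G.VT × Fin (D + 1) × Fin (D + 1)) :
    G.VP × Fin (D + 1) × Fin (D + 1) :=
  ((G.pairing (x.1, x.2.1)).1, (G.pairing (x.1, x.2.1)).2, G.strands (x.1, x.2.1) x.2.2)

/-- Two strands follow each other along a face: they are joined by a corner of a `T`-vertex, or by a
corner of a `P`-vertex, or by the closure of a ring. -/
inductive Consecutive (G : StrandedGraph D) : G.Strand → G.Strand → Prop
  | cornerT (t : G.VT) (i j : Fin (D + 1)) (h : i ≠ j) :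
      Consecutive G (Sum.inl ⟨(t, i, j), h⟩) (Sum.inl ⟨(t, j, i), h.symm⟩)
  | cornerP (x y : {x : G.VT × Fin (D + 1) × Fin (D + 1) // x.2.1 ≠ x.2.2})
      (h : G.endP y = ((G.endP x).1, (G.endP x).2.2, (G.endP x).2.1)) :
      Consecutive G (Sum.inl x) (Sum.inl y)
  | ring (r : G.R) (k : Fin D) : Consecutive G (Sum.inr (r, k)) (Sum.inr (r, G.ringPerm r k))

/-- The faces: the closed lines formed by the strands, that is, the classes of strands under the
equivalence relation generated by `Consecutive`. -/
def Face (G : StrandedGraph D) : Type := Quot G.Consecutive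

/-- The number of faces. -/
noncomputable def numFaces (G : StrandedGraph D) : ℕ := Nat.card G.Face

/-- The adjacency graph on the vertices; every ring is a separate point. -/
def skeleton (G : StrandedGraph D) : SimpleGraph ((G.VT ⊕ G.VP) ⊕ G.R) :=
  SimpleGraph.fromRel fun x y =>
    ∃ t i, x = Sum.inl (Sum.inl t) ∧ y = Sum.inl (Sum.inr (G.pairing (t, i)).1)

/-- A graph is connected if it has exactly one connected component; this is either a single ring or
a connected graph with vertices. -/
def IsConnected (G : StrandedGraph D) : Prop := G.skeleton.Connected

/-- The degree `ω(G) = D + D(D-1)/4 · V(G) - F(G)` of a connected graph. -/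
noncomputable def degree (G : StrandedGraph D) : ℚ :=
  D + (D : ℚ) * ((D : ℚ) - 1) / 4 * G.numVertices - G.numFaces

/-- `G` and `H` are the same graph up to the names of vertices and rings and up to a change of
embedding: a permutation of the half-edges around each vertex (which carries the strand ends, hence
the corners, along) and a relabelling of the strands of each ring. -/
def SameGraph (G H : StrandedGraph D) : Prop :=
  ∃ (eT : G.VT ≃ H.VT) (eP : G.VP ≃ H.VP) (eR : G.R ≃ H.R)
    (ρT : G.VT → Equiv.Perm (Fin (D + 1))) (ρP : G.VP → Equiv.Perm (Fin (D + 1)))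
    (τ : G.R → Equiv.Perm (Fin D)),
    (∀ t i, H.pairing (eT t, ρT t i) =
      (eP (G.pairing (t, i)).1, ρP (G.pairing (t, i)).1 (G.pairing (t, i)).2)) ∧
    (∀ t i j, H.strands (eT t, ρT t i) (ρT t j) =
      ρP (G.pairing (t, i)).1 (G.strands (t, i) j)) ∧
    (∀ r k, H.ringPerm (eR r) (τ r k) = τ r (G.ringPerm r k))

/-- The melonic ring graph: one ring, with the identity permutation of its strands. -/
def melonicRing (D : ℕ) : StrandedGraph D where
  VT := Empty
  VP := Empty
  R := Unit
  finVT := inferInstance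
  finVP := inferInstance
  finR := inferInstance
  pairing := (Equiv.prodCongr (Equiv.refl Empty) (Equiv.refl _))
  strands := fun x => x.1.elim
  strands_self := fun t => t.elim
  ringPerm := fun _ => 1

/-- Add one `T`-vertex and one `P`-vertex (both `Sum.inr ()`) to a pairing of half-edges, joined by
the `D + 1` edges which join equally labelled half-edges. -/
def addPair {VT VP : Type} (e : VT × Fin (D + 1) ≃ VP × Fin (D + 1)) :
    (VT ⊕ Unit) × Fin (D + 1) ≃ (VP ⊕ Unit) × Fin (D + 1) :=
  (Equiv.sumProdDistrib VT Unit (Fin (D + 1))).trans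
    ((Equiv.sumCongr e (Equiv.refl (Unit × Fin (D + 1)))).trans
      (Equiv.sumProdDistrib VP Unit (Fin (D + 1))).symm)

/-- Strand permutations after adding one vertex whose edges have strand permutations `π`. -/
def addStrands {VT : Type} (s : VT × Fin (D + 1) → Equiv.Perm (Fin (D + 1)))
    (π : Fin (D + 1) → Equiv.Perm (Fin (D + 1))) :
    (VT ⊕ Unit) × Fin (D + 1) → Equiv.Perm (Fin (D + 1)) :=
  fun x => Sum.elim (fun t => s (t, x.2)) (fun _ => π x.2) x.1

open Classical in
/-- Insertion of two vertices `T'`, `P'` joined by `D` parallel edges with parallel strands on the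
edge which leaves the half-edge `(t, a)`. If this edge ends at the half-edge `h` and has strand
permutation `π`, the result has: for each `c ≠ a`, an edge from the half-edge `c` of `T'` to the
half-edge `c` of `P'` with parallel strands; an edge with parallel strands from `(t, a)` to the
half-edge `a` of `P'`; and an edge from the half-edge `a` of `T'` to `h` with strand permutation `π`.
(The strands of the old edge thus run unchanged through the inserted pair. Distributing `π` in another
way over the two outer edges, or using other labels on `T'` and `P'`, amounts to a simultaneous
permutation of the half-edges of `T'` and `P'`, hence gives the same graph.) -/
noncomputable def insertOnEdge (G : StrandedGraph D) (t : G.VT) (a : Fin (D + 1)) :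
    StrandedGraph D where
  VT := G.VT ⊕ Unit
  VP := G.VP ⊕ Unit
  R := G.R
  finVT := by have := G.finVT; infer_instance
  finVP := by have := G.finVP; infer_instance
  finR := G.finR
  pairing := (Equiv.swap (Sum.inl t, a) (Sum.inr (), a)).trans (addPair G.pairing)
  strands := fun x => addStrands G.strands (fun _ => 1) (Equiv.swap (Sum.inl t, a) (Sum.inr (), a) x)
  strands_self := by
    intro u i
    have key : ∀ y : (G.VT ⊕ Unit) × Fin (D + 1),
        addStrands G.strands (fun _ => 1) y y.2 = (addPair G.pairing y).2 := by
      rintro ⟨u | u, i⟩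
      · simpa [addStrands, addPair] using G.strands_self u i
      · simp [addStrands, addPair]
    have h2 : (Equiv.swap ((Sum.inl t, a) : (G.VT ⊕ Unit) × Fin (D + 1)) (Sum.inr (), a) (u, i)).2
        = i := by
      rw [Equiv.swap_apply_def]
      split_ifs with h h' <;> simp_all
    have := key (Equiv.swap (Sum.inl t, a) (Sum.inr (), a) (u, i))
    rw [h2] at this
    simpa using this
  ringPerm := G.ringPerm

/-- Insertion of two vertices `T'`, `P'` joined by `D` parallel edges with parallel strands on the
ring `r`: the ring disappears, and the half-edges `0` of `T'` and `P'` are joined by an edge which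
carries the strand permutation of the ring (the strand `k ∈ {0, …, D-1}` of the ring being the strand
`k + 1` of the half-edge `0`). -/
noncomputable def insertOnRing (G : StrandedGraph D) (r : G.R) : StrandedGraph D where
  VT := G.VT ⊕ Unit
  VP := G.VP ⊕ Unit
  R := {r' : G.R // r' ≠ r}
  finVT := by have := G.finVT; infer_instance
  finVP := by have := G.finVP; infer_instance
  finR := by have := G.finR; infer_instance
  pairing := addPair G.pairing
  strands := addStrands G.strands
    (fun c => if c = 0 then Equiv.Perm.decomposeFin.symm (0, G.ringPerm r) else 1)
  strands_self := by
    rintro (u | u) i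
    · simpa [addStrands, addPair] using G.strands_self u i
    · by_cases h : i = 0 <;> simp [addStrands, addPair, h]
  ringPerm := fun r' => G.ringPerm r'.1

/-- A graph is melonic if, in some embedding, it is the melonic ring graph or is obtained from a
melonic graph by inserting, on one of its edges (possibly the closed edge of a ring), two vertices
joined by `D` parallel edges with parallel strands. Each insertion adds two vertices. -/
inductive IsMelonic : StrandedGraph D → Prop
  | ring (G : StrandedGraph D) : G.SameGraph (melonicRing D) → IsMelonic G
  | onEdge (G G' : StrandedGraph D) (t : G'.VT) (a : Fin (D + 1)) :
      IsMelonic G' → G.SameGraph (G'.insertOnEdge t a) → IsMelonic G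
  | onRing (G G' : StrandedGraph D) (r : G'.R) :
      IsMelonic G' → G.SameGraph (G'.insertOnRing r) → IsMelonic G

end StrandedGraph

/-! There are as many `P`-vertices as `T`-vertices, say n of each, so the degree is D + n·C(D,2) −
F. The claim is therefore that F ≤ D + n·C(D,2) for connected graphs, with equality exactly for
melonic ones. An insertion keeps the old faces and adds at least one for each pair of the D parallel
edges, so melonic graphs reach the bound (`IsMelonic.le_numFaces`).

The bound and the case of equality are proved by induction on n (`numFaces_le_and_isMelonic`).
Choose adjacent vertices T, P whose removal leaves a connected graph (`exists_removable`). Making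
their common edges parallel never loses faces, and gains some if the result is melonic, because the
corners of a vertex of a melonic graph lie on different faces (`Colorable`). Then remove T and P,
gluing the half-edge i of T to the half-edge θ i of P, with θ the strand permutation of one common
edge f. The removal is reached by transposing strands: aligning a corner of T with the corresponding
corner of P takes at most two transpositions, of which the first loses at most one face and the
second gains one. A potential shows that D faces are certain to be gained over all alignments
(`faceCount_add_potential_le`). In the end T and P are cut off with at most C(D+1,2) faces of their
own, so the removal costs at most C(D+1,2) − D = C(D,2) faces (`numFaces_le_contract`). The
intermediate states need not be graphs, since strands of one edge may go different ways; hence faces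
are counted for arbitrary bijections of strand ends.

In case of equality the contraction is extremal, hence melonic, and no alignment gains more than is
guaranteed. This forces certain pairs of strands of the glued edges onto common faces
(`faceCount_add_two_le_alignCorner`, `Linked`). The inner faces of a melon have only two strands, so
these links are rigid: T and P form a melon, or a melon of the contraction is already one of G, or P
forms one with some other vertex (`exists_isMelonAt`, where D ≥ 3 enters). Contracting that melon
keeps the graph connected and extremal, so the result is melonic by induction, and G is recovered by
an insertion (`IsMelonAt.isMelonic`). -/

section FaceCounting

open Relation

variable {X Y : Type}

/-! ### Classes of generated equivalence relations -/

lemma Nat.card_quot_le_of_eqvGen [Finite X] {r s : X → X → Prop}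
    (h : ∀ a b, s a b → EqvGen r a b) : Nat.card (Quot r) ≤ Nat.card (Quot s) := by
  refine Nat.card_le_card_of_surjective
    (Quot.lift (fun a => Quot.mk r a) fun a b hab => Quot.eqvGen_sound (h a b hab)) ?_
  rintro ⟨a⟩
  exact ⟨Quot.mk _ a, rfl⟩

/-- The relation `r` with one more pair `(x, y)`. -/
def RelInsert (r : X → X → Prop) (x y : X) (a b : X) : Prop := r a b ∨ (a = x ∧ b = y)

/-- One additional pair can only merge the classes of its two members. -/
lemma eqvGen_relInsert {r : X → X → Prop} {x y a b : X} (h : EqvGen (RelInsert r x y) a b) :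
    EqvGen r a b ∨ ((EqvGen r a x ∨ EqvGen r a y) ∧ (EqvGen r b x ∨ EqvGen r b y)) := by
  induction h with
  | rel a b h =>
    rcases h with h | ⟨rfl, rfl⟩
    · exact Or.inl (.rel _ _ h)
    · exact Or.inr ⟨Or.inl (.refl _), Or.inr (.refl _)⟩
  | refl a => exact Or.inl (.refl _)
  | symm a b _ ih =>
    rcases ih with h | ⟨h1, h2⟩
    · exact Or.inl (.symm _ _ h)
    · exact Or.inr ⟨h2, h1⟩
  | trans a b c _ _ ih1 ih2 =>
    rcases ih1 with h | ⟨h1, h2⟩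
    · rcases ih2 with k | ⟨k1, k2⟩
      · exact Or.inl (.trans _ _ _ h k)
      · exact Or.inr ⟨k1.imp (.trans _ _ _ h) (.trans _ _ _ h), k2⟩
    · rcases ih2 with k | ⟨k1, k2⟩
      · exact Or.inr ⟨h1, h2.imp (.trans _ _ _ (.symm _ _ k)) (.trans _ _ _ (.symm _ _ k))⟩
      · exact Or.inr ⟨h1, k2⟩

lemma card_quot_le_relInsert [Finite X] (r : X → X → Prop) (x y : X) :
    Nat.card (Quot r) ≤ Nat.card (Quot (RelInsert r x y)) + 1 := by
  classical
  have e : Nat.card (Option (Quot (RelInsert r x y))) = Nat.card (Quot (RelInsert r x y)) + 1 :=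
    Finite.card_option
  rw [← e]
  have hr : ∀ a b, r a b → Quot.mk (RelInsert r x y) a = Quot.mk (RelInsert r x y) b :=
    fun a b h => Quot.sound (Or.inl h)
  refine Nat.card_le_card_of_injective
    (fun q : Quot r => if q = Quot.mk r x then none else some (Quot.lift (fun a => Quot.mk _ a) hr q)) ?_
  rintro ⟨a⟩ ⟨b⟩ h
  have key : ∀ {c}, Quot.mk r c ≠ Quot.mk r x → ¬ EqvGen r c x := fun hc h => hc (Quot.eqvGen_sound h)
  by_cases ha : Quot.mk r a = Quot.mk r x <;> by_cases hb : Quot.mk r b = Quot.mk r x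
  · exact ha.trans hb.symm
  · simp [ha, hb] at h
  · simp [ha, hb] at h
  · simp only [ha, hb, if_false, Option.some.injEq] at h
    rcases eqvGen_relInsert (Quot.eqvGen_exact h) with h | ⟨h1, h2⟩
    · exact Quot.eqvGen_sound h
    · have h1 := h1.resolve_left (key ha)
      have h2 := h2.resolve_left (key hb)
      exact Quot.eqvGen_sound (.trans _ _ _ h1 (.symm _ _ h2))

/-- The old classes other than that of `x` still cover the new quotient, since the class of `y`
takes over the role of the missing one. -/
lemma card_quot_relInsert_lt [Finite X] (r : X → X → Prop) {x y : X} (h : ¬ EqvGen r x y) :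
    Nat.card (Quot (RelInsert r x y)) + 1 ≤ Nat.card (Quot r) := by
  classical
  have hr : ∀ a b, r a b → Quot.mk (RelInsert r x y) a = Quot.mk (RelInsert r x y) b :=
    fun a b h => Quot.sound (Or.inl h)
  have e : Nat.card (Option {q : Quot r // q ≠ Quot.mk r x}) = Nat.card (Quot r) :=
    Nat.card_congr (Equiv.optionSubtypeNe (Quot.mk r x))
  rw [← e, Finite.card_option]
  refine Nat.succ_le_succ (Nat.card_le_card_of_surjective
    (fun q : {q : Quot r // q ≠ Quot.mk r x} => Quot.lift (fun a => Quot.mk (RelInsert r x y) a) hr q.1) ?_)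
  rintro ⟨a⟩
  by_cases ha : Quot.mk r a = Quot.mk r x
  · refine ⟨⟨Quot.mk r y, fun h' => h (.symm _ _ (Quot.eqvGen_exact h'))⟩, ?_⟩
    have h1 : Quot.mk (RelInsert r x y) a = Quot.mk (RelInsert r x y) x :=
      congrArg (Quot.lift (fun a => Quot.mk (RelInsert r x y) a) hr) ha
    have h2 : Quot.mk (RelInsert r x y) x = Quot.mk (RelInsert r x y) y :=
      Quot.sound (Or.inr ⟨rfl, rfl⟩)
    exact (h1.trans h2).symm
  · exact ⟨⟨Quot.mk r a, ha⟩, rfl⟩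

lemma Finset.even_card_of_involutive [DecidableEq X] (S : Finset X) (f : X → X) (hS : ∀ x ∈ S, f x ∈ S)
    (hf : Function.Involutive f) (hne : ∀ x, f x ≠ x) : Even S.card := by
  have h := Finset.sum_involution (s := S) (f := fun _ => (1 : ZMod 2)) (fun a _ => f a)
    (fun _ _ => by decide) (fun a _ _ => hne a) (fun a ha => hS a ha) (fun a _ => hf a)
  rw [Finset.sum_const, nsmul_eq_mul, mul_one] at h
  exact (ZMod.natCast_eq_zero_iff_even).1 h

/-! ### Faces of two corner involutions and a strand bijection -/

/-- Two strand ends follow each other along a face, for the corners `κ`, `κ'` and the strands `E`. -/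
def FaceRel (κ : X → X) (κ' : Y → Y) (E : X ≃ Y) (a b : X) : Prop := b = κ a ∨ E b = κ' (E a)

/-- The number of faces formed by the corners `κ`, `κ'` and the strands `E`. -/
noncomputable def faceCount (κ : X → X) (κ' : Y → Y) (E : X ≃ Y) : ℕ :=
  Nat.card (Quot (FaceRel κ κ' E))

/-- Two strand ends lie on the same face. -/
abbrev SameFace (κ : X → X) (κ' : Y → Y) (E : X ≃ Y) : X → X → Prop := EqvGen (FaceRel κ κ' E)

variable {κ : X → X} {κ' : Y → Y}

lemma sameFace_corner (E : X ≃ Y) (a : X) : SameFace κ κ' E a (κ a) := .rel _ _ (Or.inl rfl)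

lemma sameFace_of_apply {E : X ≃ Y} {a b : X} (h : E b = κ' (E a)) : SameFace κ κ' E a b :=
  .rel _ _ (Or.inr h)

/-- A set closed under both corners is a union of faces. -/
lemma SameFace.mem_of_closed {E : X ≃ Y} (hκ : Function.Involutive κ) (hκ' : Function.Involutive κ')
    {p : X → Prop} (h1 : ∀ a, p a → p (κ a)) (h2 : ∀ a b, p a → E b = κ' (E a) → p b) {a b : X}
    (h : SameFace κ κ' E a b) : p a ↔ p b := by
  induction h with
  | rel a b h =>
    rcases h with rfl | h
    · exact ⟨h1 a, fun h => by simpa [hκ a] using h1 _ h⟩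
    · exact ⟨fun ha => h2 _ _ ha h, fun hb => h2 b a hb (by rw [h, hκ'])⟩
  | refl => rfl
  | symm _ _ _ ih => exact ih.symm
  | trans _ _ _ _ _ ih1 ih2 => exact ih1.trans ih2

/-! ### The effect of one transposition on the faces -/

section Swap

variable [DecidableEq X] (E : X ≃ Y) (x b : X)

lemma faceRel_swap_le {a c : X} (h : FaceRel κ κ' ((Equiv.swap x b).trans E) a c) :
    EqvGen (RelInsert (FaceRel κ κ' E) x b) a c := by
  have hs : ∀ w, EqvGen (RelInsert (FaceRel κ κ' E) x b) w (Equiv.swap x b w) := by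
    intro w
    rw [Equiv.swap_apply_def]
    split_ifs with h1 h2
    · exact .rel _ _ (Or.inr ⟨h1, rfl⟩)
    · exact .symm _ _ (.rel _ _ (Or.inr ⟨rfl, h2⟩))
    · exact .refl _
  rcases h with h | h
  · exact .rel _ _ (Or.inl (Or.inl h))
  · exact .trans _ _ _ (hs a) (.trans _ _ _ (.rel _ _ (Or.inl (Or.inr h))) (.symm _ _ (hs c)))

lemma swap_swap_trans : (Equiv.swap x b).trans ((Equiv.swap x b).trans E) = E := by
  ext z; simp

lemma faceCount_le_swap [Finite X] :
    faceCount κ κ' E ≤ faceCount κ κ' ((Equiv.swap x b).trans E) + 1 :=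
  (card_quot_le_relInsert _ x b).trans
    (Nat.succ_le_succ (Nat.card_quot_le_of_eqvGen fun _ _ h => faceRel_swap_le E x b h))

/-- A parity argument. Suppose both bijections separate `x` and `b`, and let `S` consist of the ends
on the face of `x` for both. The involution `κ` matches `S` without fixed points, while `κ'`
transported by `E` matches `S` without `x`. Both cardinalities would be even. -/
lemma sameFace_or_swap [Finite X] (hκ : Function.Involutive κ) (hκ' : Function.Involutive κ')
    (nκ : ∀ a, κ a ≠ a) (nκ' : ∀ a, κ' a ≠ a) :
    SameFace κ κ' E x b ∨ SameFace κ κ' ((Equiv.swap x b).trans E) x b := by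
  classical
  by_contra hcon
  push Not at hcon
  obtain ⟨hE, hE1⟩ := hcon
  set E1 := (Equiv.swap x b).trans E with hE1def
  have := Fintype.ofFinite X
  let S : Finset X := Finset.univ.filter fun z => SameFace κ κ' E z x ∧ SameFace κ κ' E1 z x
  have hxS : x ∈ S := by simp only [S, Finset.mem_filter, Finset.mem_univ, true_and]; exact ⟨.refl _, .refl _⟩
  have h1 : Even S.card := by
    refine S.even_card_of_involutive κ (fun z hz => ?_) hκ nκ
    simp only [S, Finset.mem_filter, Finset.mem_univ, true_and] at hz ⊢
    exact ⟨.trans _ _ _ (.symm _ _ (sameFace_corner E z)) hz.1,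
      .trans _ _ _ (.symm _ _ (sameFace_corner E1 z)) hz.2⟩
  have h2 : Even (S.erase x).card := by
    refine (S.erase x).even_card_of_involutive (fun z => E.symm (κ' (E z))) (fun z hz => ?_)
      (fun z => by simp [hκ' (E z)]) (fun z hz => nκ' (E z) (by simpa using congrArg E hz))
    obtain ⟨hzx, hz⟩ := Finset.mem_erase.1 hz
    simp only [S, Finset.mem_filter, Finset.mem_univ, true_and, Finset.mem_erase] at hz ⊢
    -- Away from `x` and `b` the two bijections agree; so it is enough that neither `z` nor its
    -- partner `w` is one of these.
    have hzb : z ≠ b := by rintro rfl; exact hE (.symm _ _ hz.1)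
    set w := E.symm (κ' (E z)) with hw
    have hEw : E w = κ' (E z) := by simp [hw]
    have hE1z : E1 z = E z := by simp [hE1def, Equiv.swap_apply_of_ne_of_ne hzx hzb]
    have hwx : w ≠ x := by
      intro h
      have : E1 b = κ' (E1 z) := by rw [hE1z, ← hEw, h]; simp [hE1def]
      exact hE1 (.symm _ _ (.trans _ _ _ (.symm _ _ (sameFace_of_apply this)) hz.2))
    have hzw : SameFace κ κ' E z w := sameFace_of_apply hEw
    have hwb : w ≠ b := by
      intro h
      rw [h] at hzw
      exact hE (.symm _ _ (.trans _ _ _ (.symm _ _ hzw) hz.1))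
    have hE1w : E1 w = E w := by simp [hE1def, Equiv.swap_apply_of_ne_of_ne hwx hwb]
    have hzw1 : SameFace κ κ' E1 z w := sameFace_of_apply (by rw [hE1w, hEw, hE1z])
    exact ⟨hwx, .trans _ _ _ (.symm _ _ hzw) hz.1, .trans _ _ _ (.symm _ _ hzw1) hz.2⟩
  rw [Finset.card_erase_of_mem hxS] at h2
  have h3 : 0 < S.card := Finset.card_pos.2 ⟨x, hxS⟩
  obtain ⟨k, hk⟩ := h1
  obtain ⟨l, hl⟩ := h2
  omega

/-- If `x` and `b` are separated afterwards, then by parity they were together before. The old faces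
are thus unions of new ones in which at least these two are merged. -/
lemma faceCount_lt_swap [Finite X] (hκ : Function.Involutive κ) (hκ' : Function.Involutive κ')
    (nκ : ∀ a, κ a ≠ a) (nκ' : ∀ a, κ' a ≠ a)
    (h : ¬ SameFace κ κ' ((Equiv.swap x b).trans E) x b) :
    faceCount κ κ' E + 1 ≤ faceCount κ κ' ((Equiv.swap x b).trans E) := by
  have hE := (sameFace_or_swap E x b hκ hκ' nκ nκ').resolve_right h
  refine le_trans (Nat.succ_le_succ ?_) (card_quot_relInsert_lt _ h)
  refine Nat.card_quot_le_of_eqvGen fun a c hac => ?_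
  rcases hac with hac | ⟨rfl, rfl⟩
  · rcases eqvGen_relInsert (faceRel_swap_le E x b hac) with h | ⟨h1, h2⟩
    · exact h
    · have h1 : SameFace κ κ' E a x := h1.elim id fun h => .trans _ _ _ h (.symm _ _ hE)
      have h2 : SameFace κ κ' E c x := h2.elim id fun h => .trans _ _ _ h (.symm _ _ hE)
      exact .trans _ _ _ h1 (.symm _ _ h2)
  · exact hE

end Swap

/-! ### Aligning a corner by two transpositions -/

section Align

variable [DecidableEq X]

/-- Modify the strands `E` such that `x` is sent to `y` and `κ x` to `κ' y`. -/
def alignCorner (κ : X → X) (κ' : Y → Y) (E : X ≃ Y) (x : X) (y : Y) : X ≃ Y :=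
  (Equiv.swap (κ x) (((Equiv.swap x (E.symm y)).trans E).symm (κ' y))).trans
    ((Equiv.swap x (E.symm y)).trans E)

variable {E : X ≃ Y} {x : X} {y : Y}

lemma swap_symm_trans_apply_self : ((Equiv.swap x (E.symm y)).trans E) x = y := by simp

lemma swap_symm_trans_apply {z : X} (h1 : z ≠ x) (h2 : E z ≠ y) :
    ((Equiv.swap x (E.symm y)).trans E) z = E z := by
  rw [Equiv.trans_apply, Equiv.swap_apply_of_ne_of_ne h1]
  rintro rfl
  simp at h2

lemma swap_symm_trans_eq (h : E x = y) : (Equiv.swap x (E.symm y)).trans E = E := by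
  subst h; ext z; simp

lemma alignCorner_apply_of_ne {z : X} (h1 : z ≠ x) (h2 : z ≠ κ x) (h3 : E z ≠ y) (h4 : E z ≠ κ' y) :
    alignCorner κ κ' E x y z = E z := by
  have h := swap_symm_trans_apply h1 h3
  rw [alignCorner, swap_symm_trans_apply h2 (by rwa [h]), h]

lemma alignCorner_apply_corner : alignCorner κ κ' E x y (κ x) = κ' y := swap_symm_trans_apply_self

lemma alignCorner_apply_self (nκ : ∀ a, κ a ≠ a) (nκ' : ∀ a, κ' a ≠ a) :
    alignCorner κ κ' E x y x = y := by
  rw [alignCorner, swap_symm_trans_apply (nκ x).symm] <;> rw [swap_symm_trans_apply_self]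
  exact (nκ' y).symm

lemma alignCorner_symm_apply (h2 : E.symm y ≠ κ x) (h3 : E x ≠ κ' y) :
    alignCorner κ κ' E x y (E.symm y) = E x := by
  have : ((Equiv.swap x (E.symm y)).trans E) (E.symm y) = E x := by simp
  rw [alignCorner, swap_symm_trans_apply h2 (by rwa [this]), this]

lemma alignCorner_symm_apply_corner (nκ : ∀ a, κ a ≠ a) (nκ' : ∀ a, κ' a ≠ a)
    (h1 : E.symm (κ' y) ≠ x) (h3 : E (κ x) ≠ y) :
    alignCorner κ κ' E x y (E.symm (κ' y)) = E (κ x) := by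
  have e1 : ((Equiv.swap x (E.symm y)).trans E) (E.symm (κ' y)) = κ' y := by
    rw [swap_symm_trans_apply h1] <;> simp [nκ']
  have e2 : ((Equiv.swap x (E.symm y)).trans E) (κ x) = E (κ x) := swap_symm_trans_apply (nκ x) h3
  rw [alignCorner, ← e2]
  set E1 := (Equiv.swap x (E.symm y)).trans E
  have : E.symm (κ' y) = E1.symm (κ' y) := by rw [Equiv.eq_symm_apply]; exact e1
  rw [this]; simp

section Count

variable [Finite X] (hκ : Function.Involutive κ) (hκ' : Function.Involutive κ')
    (nκ : ∀ a, κ a ≠ a) (nκ' : ∀ a, κ' a ≠ a)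
include hκ hκ' nκ nκ'

-- Once both halves of a corner are aligned, its two ends close up to a face of their own.
omit [DecidableEq X] [Finite X] nκ nκ' in
lemma sameFace_iff_of_aligned (h1 : E x = y) (h2 : E (κ x) = κ' y) {a c : X}
    (h : SameFace κ κ' E a c) : (a = x ∨ a = κ x) ↔ (c = x ∨ c = κ x) := by
  subst h1
  refine h.mem_of_closed (p := fun a => a = x ∨ a = κ x) hκ hκ' ?_ ?_
  · rintro a (rfl | rfl)
    · exact Or.inr rfl
    · exact Or.inl (hκ _)
  · rintro a b (rfl | rfl) hb
    · exact Or.inr (E.injective (hb.trans h2.symm))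
    · exact Or.inl (E.injective (by rw [hb, h2, hκ']))

-- Undoing the second transposition merges the face of `κ x` with that of the former preimage of `κ'
-- y`. As the former consists of `x` and `κ x` alone, any other end affected by the merging lies on
-- the latter.
omit [Finite X] in
lemma sameFace_or_of_half_aligned (h1 : E x = y) {a c : X} (h : SameFace κ κ' E a c)
    (hc : c ≠ x) (hc' : c ≠ κ x) :
    SameFace κ κ' ((Equiv.swap (κ x) (E.symm (κ' y))).trans E) a c ∨
      SameFace κ κ' ((Equiv.swap (κ x) (E.symm (κ' y))).trans E) c (E.symm (κ' y)) := by
  set E2 := (Equiv.swap (κ x) (E.symm (κ' y))).trans E with hE2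
  have e1 : E2 x = y := by
    rw [hE2, swap_symm_trans_apply (nκ x).symm, h1]
    rw [h1]; exact (nκ' y).symm
  have e2 : E2 (κ x) = κ' y := swap_symm_trans_apply_self
  have h' : EqvGen (RelInsert (FaceRel κ κ' E2) (κ x) (E.symm (κ' y))) a c := by
    have hE : E = (Equiv.swap (κ x) (E.symm (κ' y))).trans E2 := (swap_swap_trans E _ _).symm
    clear hc hc'
    induction h with
    | rel a b h => rw [hE] at h; exact faceRel_swap_le E2 _ _ h
    | refl => exact .refl _
    | symm _ _ _ ih => exact .symm _ _ ih
    | trans _ _ _ _ _ ih1 ih2 => exact .trans _ _ _ ih1 ih2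
  rcases eqvGen_relInsert h' with h | ⟨-, h | h⟩
  · exact Or.inl h
  · exact absurd ((sameFace_iff_of_aligned hκ hκ' e1 e2 h).2 (Or.inr rfl)) (by tauto)
  · exact Or.inr h

omit [Finite X] in
lemma SameFace.of_half_aligned (h1 : E x = y) {a c : X} (h : SameFace κ κ' E a c)
    (ha : a ≠ x) (ha' : a ≠ κ x) (hc : c ≠ x) (hc' : c ≠ κ x) :
    SameFace κ κ' ((Equiv.swap (κ x) (E.symm (κ' y))).trans E) a c := by
  rcases sameFace_or_of_half_aligned hκ hκ' nκ nκ' h1 h hc hc' with h2 | h2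
  · exact h2
  rcases sameFace_or_of_half_aligned hκ hκ' nκ nκ' h1 (.symm _ _ h) ha ha' with h3 | h3
  · exact .symm _ _ h3
  · exact .trans _ _ _ h3 (.symm _ _ h2)

omit [Finite X] in
lemma SameFace.alignCorner_of_left (h1 : E x = y) {a c : X} (h : SameFace κ κ' E a c)
    (ha : a ≠ x) (ha' : a ≠ κ x) (hc : c ≠ x) (hc' : c ≠ κ x) :
    SameFace κ κ' (alignCorner κ κ' E x y) a c := by
  rw [alignCorner, swap_symm_trans_eq h1]
  exact h.of_half_aligned hκ hκ' nκ nκ' h1 ha ha' hc hc'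

/-- Completing a half aligned corner splits off a face of length two. -/
lemma faceCount_lt_of_half_aligned (h1 : E x = y) (h2 : E (κ x) ≠ κ' y) :
    faceCount κ κ' E + 1 ≤ faceCount κ κ' ((Equiv.swap (κ x) (E.symm (κ' y))).trans E) := by
  refine faceCount_lt_swap E _ _ hκ hκ' nκ nκ' fun h => ?_
  have e1 : ((Equiv.swap (κ x) (E.symm (κ' y))).trans E) x = y := by
    rw [swap_symm_trans_apply (nκ x).symm, h1]
    rw [h1]; exact (nκ' y).symm
  have := (sameFace_iff_of_aligned hκ hκ' e1 swap_symm_trans_apply_self h).1 (Or.inr rfl)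
  rw [Equiv.symm_apply_eq, Equiv.symm_apply_eq] at this
  rcases this with h | h
  · exact nκ' y (h.trans h1)
  · exact h2 h.symm

lemma faceCount_lt_alignCorner_of_left (h1 : E x = y) (h2 : E (κ x) ≠ κ' y) :
    faceCount κ κ' E + 1 ≤ faceCount κ κ' (alignCorner κ κ' E x y) := by
  rw [alignCorner, swap_symm_trans_eq h1]
  exact faceCount_lt_of_half_aligned hκ hκ' nκ nκ' h1 h2

/-- When the half at `κ x` is in place, the second transposition is trivial and the first plays its
role, with the two ends of the corner exchanged. -/
lemma faceCount_lt_alignCorner_of_right (h1 : E x ≠ y) (h2 : E (κ x) = κ' y) :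
    faceCount κ κ' E + 1 ≤ faceCount κ κ' (alignCorner κ κ' E x y) := by
  have h := faceCount_lt_of_half_aligned hκ hκ' nκ nκ' h2 (by rwa [hκ, hκ'])
  rw [hκ, hκ'] at h
  have e1 : ((Equiv.swap x (E.symm y)).trans E) (κ x) = κ' y := by
    rw [swap_symm_trans_apply (nκ x), h2]; rw [h2]; exact nκ' y
  rwa [alignCorner, swap_symm_trans_eq e1]

omit [Finite X] [DecidableEq X] hκ hκ' nκ nκ' in
lemma alignCorner_eq_self [DecidableEq X] (h1 : E x = y) (h2 : E (κ x) = κ' y) :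
    alignCorner κ κ' E x y = E := by
  rw [alignCorner, swap_symm_trans_eq h1, swap_symm_trans_eq h2]

/-- If neither end of a corner is aligned, aligning it gains two faces unless the two strands
which it joins lie on the same face. -/
lemma faceCount_add_two_le_alignCorner (c1 : E x ≠ κ' y) (c2 : E (κ x) ≠ y)
    (h1 : E x ≠ y) (h2 : E (κ x) ≠ κ' y)
    (h : ¬ SameFace κ κ' (alignCorner κ κ' E x y) (E.symm y) (E.symm (κ' y))) :
    faceCount κ κ' E + 2 ≤ faceCount κ κ' (alignCorner κ κ' E x y) := by
  set E1 := (Equiv.swap x (E.symm y)).trans E with hE1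
  have e1 : E1 x = y := swap_symm_trans_apply_self
  have e2 : E1 (κ x) = E (κ x) := swap_symm_trans_apply (nκ x) c2
  have s1 : faceCount κ κ' E1 + 1 ≤ faceCount κ κ' (alignCorner κ κ' E x y) := by
    have := faceCount_lt_of_half_aligned hκ hκ' nκ nκ' e1 (by rwa [e2])
    exact this
  -- If the first transposition left `x` and the old preimage of `y` together, then completing the
  -- corner would cut `x` off and leave the preimages of `y` and `κ' y` on one face, against `h`.
  have s2 : faceCount κ κ' E + 1 ≤ faceCount κ κ' E1 := by
    refine faceCount_lt_swap E _ _ hκ hκ' nκ nκ' fun hc => ?_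
    have hb : E.symm y ≠ x := fun h => h1 (by rw [← h]; simp)
    have hb' : E.symm y ≠ κ x := fun h => c2 (by rw [← h]; simp)
    have e3 : E1.symm (κ' y) = E.symm (κ' y) := by
      rw [Equiv.symm_apply_eq, hE1, swap_symm_trans_apply] <;> simp [nκ']
      intro h; exact c1 (by rw [← h]; simp)
    rcases sameFace_or_of_half_aligned hκ hκ' nκ nκ' e1 hc hb hb' with h3 | h3
    · have e4 : alignCorner κ κ' E x y x = y := alignCorner_apply_self nκ nκ'
      have := (sameFace_iff_of_aligned hκ hκ' e4 alignCorner_apply_corner h3).1 (Or.inl rfl)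
      tauto
    · rw [e3] at h3
      exact h (by rw [alignCorner, e3]; exact h3)
  omega

/-- In the worst case the first transposition loses one face; if neither half was in place, the
second one regains it by splitting off a face of length two. -/
lemma faceCount_le_alignCorner (c2 : E (κ x) ≠ y) :
    faceCount κ κ' E ≤ faceCount κ κ' (alignCorner κ κ' E x y) := by
  by_cases h1 : E x = y
  · by_cases h2 : E (κ x) = κ' y
    · rw [alignCorner_eq_self h1 h2]
    · exact (Nat.le_succ _).trans (faceCount_lt_alignCorner_of_left hκ hκ' nκ nκ' h1 h2)
  · by_cases h2 : E (κ x) = κ' y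
    · exact (Nat.le_succ _).trans (faceCount_lt_alignCorner_of_right hκ hκ' nκ nκ' h1 h2)
    · have e2 : ((Equiv.swap x (E.symm y)).trans E) (κ x) = E (κ x) :=
        swap_symm_trans_apply (nκ x) c2
      exact (faceCount_le_swap E x (E.symm y)).trans
        (faceCount_lt_of_half_aligned hκ hκ' nκ nκ' swap_symm_trans_apply_self (by rwa [e2]))

end Count

end Align

end FaceCounting

/-! ### The strands of a graph as a bijection of strand ends -/

/-- The strand ends at the vertices `V`: the strand end `j` of the half-edge `i` for `i ≠ j`. -/
abbrev StrandEnd (V : Type) (D : ℕ) : Type := {x : V × Fin (D + 1) × Fin (D + 1) // x.2.1 ≠ x.2.2}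

namespace StrandEnd

variable {V : Type} {D : ℕ}

/-- The strand end joined to a given one by a corner. -/
def corner (x : StrandEnd V D) : StrandEnd V D := ⟨(x.1.1, x.1.2.2, x.1.2.1), x.2.symm⟩

lemma corner_involutive : Function.Involutive (corner : StrandEnd V D → StrandEnd V D) := fun _ => rfl

lemma corner_ne (x : StrandEnd V D) : corner x ≠ x := fun h =>
  x.2 (congrArg (fun y : StrandEnd V D => y.1.2.2) h)

lemma eq_iff {x y : StrandEnd V D} :
    x = y ↔ x.1.1 = y.1.1 ∧ x.1.2.1 = y.1.2.1 ∧ x.1.2.2 = y.1.2.2 := by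
  rw [Subtype.ext_iff, Prod.ext_iff, Prod.ext_iff]

end StrandEnd

namespace StrandedGraph

variable {D : ℕ}

open StrandEnd

instance (G : StrandedGraph D) : Finite G.VT := G.finVT
instance (G : StrandedGraph D) : Finite G.VP := G.finVP
instance (G : StrandedGraph D) : Finite G.R := G.finR

lemma strands_ne (G : StrandedGraph D) {t : G.VT} {i j : Fin (D + 1)} (h : i ≠ j) :
    (G.pairing (t, i)).2 ≠ G.strands (t, i) j := by
  rw [← G.strands_self]
  exact (G.strands (t, i)).injective.ne h

/-- The strands of the edges, as a bijection of strand ends. -/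
def strandEquiv (G : StrandedGraph D) : StrandEnd G.VT D ≃ StrandEnd G.VP D where
  toFun x := ⟨G.endP x.1, G.strands_ne x.2⟩
  invFun y := ⟨((G.pairing.symm (y.1.1, y.1.2.1)).1, (G.pairing.symm (y.1.1, y.1.2.1)).2,
      (G.strands (G.pairing.symm (y.1.1, y.1.2.1))).symm y.1.2.2), by
    have h := G.strands_self (G.pairing.symm (y.1.1, y.1.2.1)).1 (G.pairing.symm (y.1.1, y.1.2.1)).2
    simp only [Prod.mk.eta, Equiv.apply_symm_apply] at h
    intro h'
    dsimp only at h'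
    rw [Equiv.eq_symm_apply, h] at h'
    exact y.2 h'⟩
  left_inv x := by
    rw [StrandEnd.eq_iff]
    simp [endP]
  right_inv y := by
    rw [StrandEnd.eq_iff]
    simp [endP]

lemma strandEquiv_apply (G : StrandedGraph D) (x : StrandEnd G.VT D) :
    (G.strandEquiv x).1 = ((G.pairing (x.1.1, x.1.2.1)).1, (G.pairing (x.1.1, x.1.2.1)).2,
      G.strands (x.1.1, x.1.2.1) x.1.2.2) := rfl

lemma strandEquiv_eq_iff (G : StrandedGraph D) {x : StrandEnd G.VT D} {y : StrandEnd G.VP D} :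
    G.strandEquiv x = y ↔ G.pairing (x.1.1, x.1.2.1) = (y.1.1, y.1.2.1) ∧
      G.strands (x.1.1, x.1.2.1) x.1.2.2 = y.1.2.2 := by
  rw [StrandEnd.eq_iff, strandEquiv_apply, Prod.ext_iff, and_assoc]

/-- Two strands of edges lie on the same face. -/
abbrev OnSameFace (G : StrandedGraph D) : StrandEnd G.VT D → StrandEnd G.VT D → Prop :=
  SameFace corner corner G.strandEquiv

lemma numFaces_eq_faceCount (G : StrandedGraph D) [IsEmpty G.R] :
    G.numFaces = faceCount corner corner G.strandEquiv := by
  refine Nat.card_congr ⟨Quot.map (Sum.elim id fun r => isEmptyElim r.1) ?_, Quot.map Sum.inl ?_, ?_, ?_⟩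
  · rintro a b (⟨t, i, j, h⟩ | ⟨x, y, h⟩ | ⟨r, k⟩)
    · exact Or.inl rfl
    · exact Or.inr (Subtype.ext h)
    · exact isEmptyElim r
  · rintro a b (rfl | h)
    · exact .cornerT _ _ _ a.2
    · exact .cornerP _ _ (congrArg Subtype.val h)
  · rintro ⟨a | r⟩
    · rfl
    · exact isEmptyElim r.1
  · rintro ⟨a⟩
    rfl

/-! ### Removing two vertices and gluing their half-edges -/

section Contract

variable (G : StrandedGraph D) (T : G.VT) (P : G.VP) (θ : Equiv.Perm (Fin (D + 1)))

/-- Every edge from `T` to `P` joins a label `i` to the label `θ i`. -/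
def RespectsEdges : Prop := ∀ i, (G.pairing (T, i)).1 = P → (G.pairing (T, i)).2 = θ i

variable {G T P θ}

lemma RespectsEdges.eq_of_pairing (h : G.RespectsEdges T P θ) {i l : Fin (D + 1)}
    (hi : G.pairing (T, i) = (P, θ l)) : i = l := by
  have := h i (by rw [hi])
  rw [hi] at this
  exact (θ.injective this).symm

/-- An edge from `T` to `P` that continues the glued path would end at the very half-edge of `P`
through which the path arrived. Hence a path through the removed pair leaves it after one gluing,
and no iteration is needed to define the contraction. -/
lemma RespectsEdges.pairing_ne (h : G.RespectsEdges T P θ) {t : G.VT} {k : Fin (D + 1)} (ht : t ≠ T)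
    (hk : (G.pairing (t, k)).1 = P) :
    (G.pairing (T, θ.symm (G.pairing (t, k)).2)).1 ≠ P := by
  intro hc
  have h2 := h _ hc
  rw [Equiv.apply_symm_apply] at h2
  have := G.pairing.injective (Prod.ext (hc.trans hk.symm) h2)
  exact ht (congrArg Prod.fst this).symm

open Classical in
/-- The half-edge reached from a half-edge away from `T` when `T` and `P` have been removed and
the half-edge `i` of `T` has been glued to the half-edge `θ i` of `P`. -/
noncomputable def contractFun (h : G.RespectsEdges T P θ) (x : {t : G.VT // t ≠ T} × Fin (D + 1)) :
    {p : G.VP // p ≠ P} × Fin (D + 1) :=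
  if hx : (G.pairing (x.1.1, x.2)).1 = P then
    (⟨(G.pairing (T, θ.symm (G.pairing (x.1.1, x.2)).2)).1, h.pairing_ne x.1.2 hx⟩,
      (G.pairing (T, θ.symm (G.pairing (x.1.1, x.2)).2)).2)
  else (⟨(G.pairing (x.1.1, x.2)).1, hx⟩, (G.pairing (x.1.1, x.2)).2)

lemma contractFun_of_eq (h : G.RespectsEdges T P θ) (x : {t : G.VT // t ≠ T} × Fin (D + 1))
    (hx : (G.pairing (x.1.1, x.2)).1 = P) : Prod.map Subtype.val id (contractFun h x) =
      G.pairing (T, θ.symm (G.pairing (x.1.1, x.2)).2) := by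
  rw [contractFun, dif_pos hx]; rfl

lemma contractFun_of_ne (h : G.RespectsEdges T P θ) (x : {t : G.VT // t ≠ T} × Fin (D + 1))
    (hx : (G.pairing (x.1.1, x.2)).1 ≠ P) : Prod.map Subtype.val id (contractFun h x) =
      G.pairing (x.1.1, x.2) := by
  rw [contractFun, dif_neg hx]; rfl

lemma contractFun_bijective (h : G.RespectsEdges T P θ) : Function.Bijective (contractFun h) := by
  have inj : Function.Injective (Prod.map Subtype.val id : {p : G.VP // p ≠ P} × Fin (D + 1) → _) :=
    Subtype.val_injective.prodMap Function.injective_id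
  have inj' : Function.Injective (Prod.map Subtype.val id : {t : G.VT // t ≠ T} × Fin (D + 1) → _) :=
    Subtype.val_injective.prodMap Function.injective_id
  constructor
  · intro x y hxy
    have hxy' := congrArg (Prod.map Subtype.val id) hxy
    apply inj'
    change (x.1.1, x.2) = (y.1.1, y.2)
    by_cases hx : (G.pairing (x.1.1, x.2)).1 = P <;> by_cases hy : (G.pairing (y.1.1, y.2)).1 = P
    · rw [contractFun_of_eq h x hx, contractFun_of_eq h y hy] at hxy'
      have := θ.symm.injective (congrArg Prod.snd (G.pairing.injective hxy'))
      exact G.pairing.injective (Prod.ext (hx.trans hy.symm) this)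
    · rw [contractFun_of_eq h x hx, contractFun_of_ne h y hy] at hxy'
      exact absurd (congrArg Prod.fst (G.pairing.injective hxy')).symm y.1.2
    · rw [contractFun_of_ne h x hx, contractFun_of_eq h y hy] at hxy'
      exact absurd (congrArg Prod.fst (G.pairing.injective hxy')) x.1.2
    · rw [contractFun_of_ne h x hx, contractFun_of_ne h y hy] at hxy'
      exact G.pairing.injective hxy'
  · rintro ⟨⟨p, hp⟩, l⟩
    obtain ⟨⟨t, k⟩, htk⟩ := G.pairing.surjective (p, l)
    by_cases ht : t = T
    · subst ht
      -- The edge reaching `(p, l)` comes from `T`, so it is preceded in the contraction by the edge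
      -- into the half-edge of `P` glued to `k`.
      obtain ⟨⟨t', k'⟩, htk'⟩ := G.pairing.surjective (P, θ k)
      have ht' : t' ≠ t := by
        rintro rfl
        have := h.eq_of_pairing htk'
        subst this
        rw [htk] at htk'
        exact hp (congrArg Prod.fst htk')
      refine ⟨(⟨t', ht'⟩, k'), inj ?_⟩
      rw [contractFun_of_eq h _ (by simp [htk'])]
      simp [htk', htk]
    · refine ⟨(⟨t, ht⟩, k), inj ?_⟩
      rw [contractFun_of_ne h _ (by simp [htk, hp])]
      simp [htk]

open Classical in
/-- Remove the vertices `T` and `P` and glue the half-edge `i` of `T` to the half-edge `θ i` of `P`,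
strand `j` to strand `θ j`. -/
noncomputable def contract (h : G.RespectsEdges T P θ) : StrandedGraph D where
  VT := {t : G.VT // t ≠ T}
  VP := {p : G.VP // p ≠ P}
  R := G.R
  finVT := inferInstance
  finVP := inferInstance
  finR := inferInstance
  pairing := Equiv.ofBijective _ (contractFun_bijective h)
  strands := fun x => if (G.pairing (x.1.1, x.2)).1 = P then
      G.strands (T, θ.symm (G.pairing (x.1.1, x.2)).2) * θ⁻¹ * G.strands (x.1.1, x.2)
    else G.strands (x.1.1, x.2)
  strands_self := by
    intro t i
    rw [Equiv.ofBijective_apply]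
    by_cases hx : (G.pairing (t.1, i)).1 = P
    · have := congrArg Prod.snd (contractFun_of_eq h (t, i) hx)
      simp only [Prod.map_snd, id] at this
      simp only [hx, if_true, this, Equiv.Perm.mul_apply, G.strands_self]
      exact G.strands_self _ _
    · have := congrArg Prod.snd (contractFun_of_ne h (t, i) hx)
      simp only [Prod.map_snd, id] at this
      simp only [hx, if_false, this, G.strands_self]
  ringPerm := G.ringPerm

variable (h : G.RespectsEdges T P θ)

lemma contract_pairing_of_ne {t : G.VT} (ht : t ≠ T) {k : Fin (D + 1)}
    (hx : (G.pairing (t, k)).1 ≠ P) :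
    (contract h).pairing ((⟨t, ht⟩ : {t : G.VT // t ≠ T}), k) =
      ((⟨(G.pairing (t, k)).1, hx⟩ : {p : G.VP // p ≠ P}), (G.pairing (t, k)).2) := by
  exact dif_neg hx

lemma contract_strands_of_ne {t : G.VT} (ht : t ≠ T) {k : Fin (D + 1)}
    (hx : (G.pairing (t, k)).1 ≠ P) :
    (contract h).strands ((⟨t, ht⟩ : {t : G.VT // t ≠ T}), k) = G.strands (t, k) :=
  if_neg hx

lemma contract_pairing_of_eq {t : G.VT} (ht : t ≠ T) {k l : Fin (D + 1)}
    (hx : G.pairing (t, k) = (P, θ l)) :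
    ∃ hp, (contract h).pairing ((⟨t, ht⟩ : {t : G.VT // t ≠ T}), k) =
      ((⟨(G.pairing (T, l)).1, hp⟩ : {p : G.VP // p ≠ P}), (G.pairing (T, l)).2) := by
  have hl : θ.symm (G.pairing (t, k)).2 = l := by simp [hx]
  have hp := h.pairing_ne ht (k := k) (by rw [hx])
  subst hl
  refine ⟨hp, ?_⟩
  exact dif_pos (by rw [hx])

lemma contract_strands_of_eq {t : G.VT} (ht : t ≠ T) {k l : Fin (D + 1)}
    (hx : G.pairing (t, k) = (P, θ l)) :
    (contract h).strands ((⟨t, ht⟩ : {t : G.VT // t ≠ T}), k) =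
      G.strands (T, l) * θ⁻¹ * G.strands (t, k) := by
  have hl : θ.symm (G.pairing (t, k)).2 = l := by simp [hx]
  subst hl
  exact if_pos (by rw [hx])

/-- The inclusion of strand ends away from `T`. -/
def inclEnd {V : Type} {v : V} (x : StrandEnd {t : V // t ≠ v} D) : StrandEnd V D :=
  ⟨(x.1.1.1, x.1.2.1, x.1.2.2), x.2⟩

lemma inclEnd_injective {V : Type} {v : V} :
    Function.Injective (inclEnd : StrandEnd {t : V // t ≠ v} D → StrandEnd V D) := by
  intro x y h
  rw [StrandEnd.eq_iff] at h ⊢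
  exact ⟨Subtype.ext h.1, h.2⟩

lemma inclEnd_contract_of_ne (z : StrandEnd {t : G.VT // t ≠ T} D)
    (hz : (G.strandEquiv (inclEnd z)).1.1 ≠ P) :
    inclEnd ((contract h).strandEquiv z) = G.strandEquiv (inclEnd z) := by
  have e1 := contract_pairing_of_ne h z.1.1.2 (k := z.1.2.1) hz
  have e2 := contract_strands_of_ne h z.1.1.2 (k := z.1.2.1) hz
  rw [StrandEnd.eq_iff]
  refine ⟨congrArg (fun x => x.1.1) e1, congrArg (fun x => x.2) e1, congrArg (fun x : Equiv.Perm (Fin (D + 1)) => x z.1.2.2) e2⟩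

lemma inclEnd_contract_of_eq (z : StrandEnd {t : G.VT // t ≠ T} D) {i j : Fin (D + 1)} (hij : i ≠ j)
    (hz : G.strandEquiv (inclEnd z) = ⟨(P, θ i, θ j), θ.injective.ne hij⟩) :
    inclEnd ((contract h).strandEquiv z) = G.strandEquiv ⟨(T, i, j), hij⟩ := by
  rw [strandEquiv_eq_iff] at hz
  obtain ⟨hp, e1⟩ := contract_pairing_of_eq h z.1.1.2 hz.1
  have e2 := contract_strands_of_eq h z.1.1.2 hz.1
  rw [StrandEnd.eq_iff]
  refine ⟨congrArg (fun x => x.1.1) e1, congrArg (fun x => x.2) e1,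
    (congrArg (fun x : Equiv.Perm (Fin (D + 1)) => x z.1.2.2) e2).trans ?_⟩
  simp only [strandEquiv_apply, Equiv.Perm.mul_apply]
  exact congrArg _ ((Equiv.symm_apply_eq _).2 hz.2)

end Contract

/-! ### Making common edges parallel -/

section Twist

variable (G : StrandedGraph D)

open Classical in
/-- Exchange the images of the strands `j` and `s⁻¹ l` of the edge leaving `(t, c)`, where `s` is
its strand permutation. -/
noncomputable abbrev twist (t : G.VT) {c j : Fin (D + 1)} (hj : c ≠ j) {l : Fin (D + 1)}
    (hl : (G.pairing (t, c)).2 ≠ l) : StrandedGraph D where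
  VT := G.VT
  VP := G.VP
  R := G.R
  finVT := G.finVT
  finVP := G.finVP
  finR := G.finR
  pairing := G.pairing
  strands := fun x => if x = (t, c) then Equiv.swap (G.strands (t, c) j) l * G.strands (t, c)
    else G.strands x
  strands_self := by
    intro u i
    split_ifs with h
    · obtain ⟨rfl, rfl⟩ := Prod.ext_iff.1 h
      have := G.strands_ne (t := u) hj
      dsimp only at *
      rw [Equiv.Perm.mul_apply, G.strands_self, Equiv.swap_apply_of_ne_of_ne this hl]
    · exact G.strands_self u i
  ringPerm := G.ringPerm

lemma twist_strands_of_ne {t : G.VT} {c j : Fin (D + 1)} (hj : c ≠ j) {l : Fin (D + 1)}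
    (hl : (G.pairing (t, c)).2 ≠ l) {x : G.VT × Fin (D + 1)} (hx : x ≠ (t, c)) :
    (G.twist t hj hl).strands x = G.strands x := if_neg hx

lemma twist_strands {t : G.VT} {c j : Fin (D + 1)} (hj : c ≠ j) {l : Fin (D + 1)}
    (hl : (G.pairing (t, c)).2 ≠ l) :
    (G.twist t hj hl).strands (t, c) = Equiv.swap (G.strands (t, c) j) l * G.strands (t, c) :=
  if_pos rfl

-- Left multiplication of a strand permutation transposes two ends at the `P`-vertex; transported
-- back by `strandEquiv`, it becomes a transposition of ends at the `T`-vertex, as in the face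
-- counts above.
open Classical in
lemma strandEquiv_twist {t : G.VT} {c j : Fin (D + 1)} (hj : c ≠ j) {l : Fin (D + 1)}
    (hl : (G.pairing (t, c)).2 ≠ l) {p : G.VP} {k : Fin (D + 1)} (hp : G.pairing (t, c) = (p, k))
    (hk : k ≠ l) :
    (G.twist t hj hl).strandEquiv =
      (Equiv.swap (⟨(t, c, j), hj⟩ : StrandEnd G.VT D) (G.strandEquiv.symm ⟨(p, k, l), hk⟩)).trans
        G.strandEquiv := by
  set x : StrandEnd G.VT D := ⟨(t, c, j), hj⟩ with hx
  set y : StrandEnd G.VP D := ⟨(p, k, l), hk⟩ with hy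
  have hsw : ∀ z, ((Equiv.swap x (G.strandEquiv.symm y)).trans G.strandEquiv) z =
      Equiv.swap (G.strandEquiv x) y (G.strandEquiv z) := by
    intro z
    rw [Equiv.trans_apply, G.strandEquiv.injective.map_swap, Equiv.apply_symm_apply]
  refine Equiv.ext fun z => Eq.trans ?_ (hsw z).symm
  have hEx : (G.strandEquiv x).1 = (p, k, G.strands (t, c) j) := by
    rw [strandEquiv_apply]; simp [hx, hp]
  by_cases hz : (z.1.1, z.1.2.1) = (t, c)
  · have hEz : (G.strandEquiv z).1 = (p, k, G.strands (t, c) z.1.2.2) := by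
      rw [strandEquiv_apply, hz, hp]
    have h1 : ((G.twist t hj hl).strandEquiv z).1 =
        (p, k, Equiv.swap (G.strands (t, c) j) l (G.strands (t, c) z.1.2.2)) := by
      rw [strandEquiv_apply]
      have : (G.twist t hj hl).pairing (z.1.1, z.1.2.1) = (p, k) := by
        change G.pairing (z.1.1, z.1.2.1) = _
        rw [hz, hp]
      rw [this]
      change (p, k, (G.twist t hj hl).strands (z.1.1, z.1.2.1) z.1.2.2) = _
      rw [show (G.twist t hj hl).strands (z.1.1, z.1.2.1) = _ from
        (congrArg _ hz).trans (G.twist_strands hj hl)]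
      rfl
    refine Subtype.ext (h1.trans ?_)
    simp only [Equiv.swap_apply_def, Subtype.ext_iff, hEx, hEz, hy, Prod.mk.injEq, true_and]
    split_ifs <;> simp_all
  · have hEz : (G.strandEquiv z).1.1 ≠ p ∨ (G.strandEquiv z).1.2.1 ≠ k := by
      by_contra hcon
      push Not at hcon
      exact hz (G.pairing.injective ((Prod.ext hcon.1 hcon.2).trans hp.symm))
    rw [Equiv.swap_apply_of_ne_of_ne]
    · refine Subtype.ext ?_
      rw [strandEquiv_apply, strandEquiv_apply]
      rw [show (G.twist t hj hl).strands (z.1.1, z.1.2.1) = _ from G.twist_strands_of_ne hj hl hz]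
    · intro h
      rw [h, hEx] at hEz
      simp at hEz
    · intro h
      rw [h] at hEz
      simp [hy] at hEz

lemma strandEquiv_symm_eq {t : G.VT} {i : Fin (D + 1)} {y : StrandEnd G.VP D}
    (h : G.pairing (t, i) = (y.1.1, y.1.2.1)) : ∃ j, ∃ hj : i ≠ j, G.strandEquiv.symm y = ⟨(t, i, j), hj⟩ := by
  have hj : i ≠ (G.strands (t, i)).symm y.1.2.2 := by
    intro hi
    rw [Equiv.eq_symm_apply, G.strands_self, h] at hi
    exact y.2 hi
  refine ⟨_, hj, ?_⟩
  rw [Equiv.symm_apply_eq, eq_comm, strandEquiv_eq_iff]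
  exact ⟨h, by simp⟩

variable {G}

lemma label_ne {T : G.VT} {P : G.VP} {c c' : Fin (D + 1)} (hc : c ≠ c')
    (h1 : (G.pairing (T, c)).1 = P) (h2 : (G.pairing (T, c')).1 = P) :
    (G.pairing (T, c)).2 ≠ (G.pairing (T, c')).2 := fun h =>
  hc (congrArg Prod.snd (G.pairing.injective (Prod.ext (h1.trans h2.symm) h)))

/-- Make the strand `c'` of the edge `c` and the strand `c` of the edge `c'` parallel, for two edges
`c`, `c'` with the same ends. -/
noncomputable abbrev alignEdges {T : G.VT} {P : G.VP} {c c' : Fin (D + 1)} (hc : c ≠ c')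
    (h1 : (G.pairing (T, c)).1 = P) (h2 : (G.pairing (T, c')).1 = P) : StrandedGraph D :=
  (G.twist T hc (label_ne hc h1 h2)).twist T hc.symm (l := (G.pairing (T, c)).2)
    (label_ne hc h1 h2).symm

section AlignEdges

variable {T : G.VT} {P : G.VP} {c c' : Fin (D + 1)} (hc : c ≠ c')
    (h1 : (G.pairing (T, c)).1 = P) (h2 : (G.pairing (T, c')).1 = P)

-- The two twists are the two transpositions of `alignCorner`. As both edges end at `P`, each
-- transposition stays within one edge, which is why the result is again a graph.
open Classical in
lemma strandEquiv_alignEdges : (alignEdges hc h1 h2).strandEquiv =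
    alignCorner corner corner G.strandEquiv ⟨(T, c, c'), hc⟩
      ⟨(P, (G.pairing (T, c)).2, (G.pairing (T, c')).2), label_ne hc h1 h2⟩ := by
  have e1 := G.strandEquiv_twist hc (label_ne hc h1 h2) (p := P) (Prod.ext h1 rfl) (label_ne hc h1 h2)
  have e2 := (G.twist T hc (label_ne hc h1 h2)).strandEquiv_twist hc.symm (label_ne hc h1 h2).symm
    (p := P) (Prod.ext h2 rfl) (label_ne hc h1 h2).symm
  exact e2.trans (congrArg (fun E : StrandEnd G.VT D ≃ StrandEnd G.VP D =>
    (Equiv.swap (⟨(T, c', c), hc.symm⟩ : StrandEnd G.VT D)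
      (E.symm ⟨(P, (G.pairing (T, c')).2, (G.pairing (T, c)).2), (label_ne hc h1 h2).symm⟩)).trans E) e1)

lemma alignEdges_strands_fst : (alignEdges hc h1 h2).strands (T, c) =
    Equiv.swap (G.strands (T, c) c') (G.pairing (T, c')).2 * G.strands (T, c) :=
  ((G.twist T hc (label_ne hc h1 h2)).twist_strands_of_ne hc.symm (label_ne hc h1 h2).symm
    (x := (T, c)) (by simp [hc])).trans (G.twist_strands hc _)

lemma alignEdges_strands_snd : (alignEdges hc h1 h2).strands (T, c') =
    Equiv.swap (G.strands (T, c') c) (G.pairing (T, c)).2 * G.strands (T, c') := by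
  have h := G.twist_strands_of_ne hc (label_ne hc h1 h2) (x := (T, c')) (by simp [hc.symm])
  refine (twist_strands _ _ _).trans ?_
  rw [h]

lemma alignEdges_strands_of_ne {a : Fin (D + 1)} (ha : a ≠ c) (ha' : a ≠ c') :
    (alignEdges hc h1 h2).strands (T, a) = G.strands (T, a) :=
  ((G.twist T hc (label_ne hc h1 h2)).twist_strands_of_ne hc.symm (label_ne hc h1 h2).symm
    (x := (T, a)) (by simp [ha'])).trans (G.twist_strands_of_ne hc _ (x := (T, a)) (by simp [ha]))

lemma alignEdges_strands_left :
    (alignEdges hc h1 h2).strands (T, c) c' = (G.pairing (T, c')).2 :=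
  (DFunLike.congr_fun (alignEdges_strands_fst hc h1 h2) c').trans (by simp)

/-- Pairs of strands which are already parallel stay parallel. -/
lemma alignEdges_strands_of_parallel {a b : Fin (D + 1)}
    (hb : (G.pairing (T, b)).1 = P) (h : G.strands (T, a) b = (G.pairing (T, b)).2) :
    (alignEdges hc h1 h2).strands (T, a) b = (G.pairing (T, b)).2 := by
  have hlab : ∀ d, (G.pairing (T, d)).1 = P → (G.pairing (T, b)).2 = (G.pairing (T, d)).2 → b = d :=
    fun d hd he => by_contra fun hne => label_ne hne hb hd he
  by_cases hac : a = c
  · subst hac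
    refine (DFunLike.congr_fun (alignEdges_strands_fst hc h1 h2) b).trans ?_
    rw [Equiv.Perm.mul_apply, h]
    by_cases hbc : b = c'
    · subst hbc; simp [h]
    · rw [Equiv.swap_apply_of_ne_of_ne]
      · rw [← h]; exact (G.strands (T, a)).injective.ne hbc
      · exact fun he => hbc (hlab c' h2 he)
  · by_cases hac' : a = c'
    · subst hac'
      refine (DFunLike.congr_fun (alignEdges_strands_snd hc h1 h2) b).trans ?_
      rw [Equiv.Perm.mul_apply, h]
      by_cases hbc : b = c
      · subst hbc; simp [h]
      · rw [Equiv.swap_apply_of_ne_of_ne]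
        · rw [← h]; exact (G.strands (T, a)).injective.ne hbc
        · exact fun he => hbc (hlab c h1 he)
    · exact (DFunLike.congr_fun (alignEdges_strands_of_ne hc h1 h2 hac hac') b).trans h

end AlignEdges

end Twist

/-! ### Labels constant along the strands -/

section Coloring

/-- Labels of the half-edges of `T`- and `P`-vertices which are constant along all strands. -/
def IsColoring (G : StrandedGraph D) (l : G.VT → Equiv.Perm (Fin (D + 1)))
    (m : G.VP → Equiv.Perm (Fin (D + 1))) : Prop :=
  ∀ t i j, m (G.pairing (t, i)).1 (G.strands (t, i) j) = l t j

/-- In some embedding all labels are constant along the strands, and all rings are trivial. -/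
def Colorable (G : StrandedGraph D) : Prop := (∃ l m, G.IsColoring l m) ∧ ∀ r, G.ringPerm r = 1

/-- Strands preserve the two labels of an end and corners exchange them, so the unordered pair is an
invariant of the face. -/
lemma IsColoring.of_onSameFace {G : StrandedGraph D} {l m} (h : G.IsColoring l m)
    {a b : StrandEnd G.VT D} (hab : G.OnSameFace a b) :
    s(l a.1.1 a.1.2.1, l a.1.1 a.1.2.2) = s(l b.1.1 b.1.2.1, l b.1.1 b.1.2.2) := by
  have key : ∀ a : StrandEnd G.VT D, s(l a.1.1 a.1.2.1, l a.1.1 a.1.2.2) =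
      s(m (G.strandEquiv a).1.1 (G.strandEquiv a).1.2.1, m (G.strandEquiv a).1.1 (G.strandEquiv a).1.2.2) := by
    intro a
    rw [strandEquiv_apply, ← h a.1.1 a.1.2.1 a.1.2.2, ← h a.1.1 a.1.2.1 a.1.2.1, G.strands_self]
  induction hab with
  | rel a b hab =>
    rcases hab with rfl | hab
    · exact Sym2.eq_swap
    · rw [key a, key b, hab]
      exact Sym2.eq_swap
  | refl => rfl
  | symm _ _ _ ih => exact ih.symm
  | trans _ _ _ _ _ ih1 ih2 => exact ih1.trans ih2

/-- The corners of a vertex of a colorable graph lie on different faces. -/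
lemma Colorable.of_onSameFace {G : StrandedGraph D} (h : G.Colorable) {t : G.VT}
    {i j i' j' : Fin (D + 1)} (hij : i ≠ j) (hij' : i' ≠ j')
    (hf : G.OnSameFace ⟨(t, i, j), hij⟩ ⟨(t, i', j'), hij'⟩) :
    (i = i' ∧ j = j') ∨ (i = j' ∧ j = i') := by
  obtain ⟨⟨l, m, h⟩, -⟩ := h
  have := h.of_onSameFace hf
  simpa [Sym2.eq_iff] using this

end Coloring

/-! ### Faces gained by making common edges parallel -/

section AlignCount

variable {G : StrandedGraph D} [IsEmpty G.R] {T : G.VT} {P : G.VP} {c c' : Fin (D + 1)} (hc : c ≠ c')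
    (h1 : (G.pairing (T, c)).1 = P) (h2 : (G.pairing (T, c')).1 = P)

instance : IsEmpty (alignEdges hc h1 h2).R := ‹IsEmpty G.R›

lemma numFaces_le_alignEdges : G.numFaces ≤ (alignEdges hc h1 h2).numFaces := by
  classical
  rw [numFaces_eq_faceCount, numFaces_eq_faceCount, strandEquiv_alignEdges]
  refine faceCount_le_alignCorner corner_involutive corner_involutive corner_ne corner_ne ?_
  intro h
  have := congrArg (fun x : StrandEnd G.VP D => x.1.2.1) h
  exact label_ne hc h1 h2 this.symm

/-- A half aligned corner gains a face. If neither half is aligned, two are gained unless the old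
preimages of `y` and `corner y` share a face afterwards. These are ends at the half-edges `c` and
`c'` of `T`; in a colorable graph they share a face only if they form the corner of `c` and `c'`,
and then `x` was aligned already. -/
lemma numFaces_lt_alignEdges (hcol : (alignEdges hc h1 h2).Colorable)
    (hna : ¬ (G.strands (T, c) c' = (G.pairing (T, c')).2 ∧ G.strands (T, c') c = (G.pairing (T, c)).2)) :
    G.numFaces < (alignEdges hc h1 h2).numFaces := by
  classical
  rw [numFaces_eq_faceCount, numFaces_eq_faceCount]
  set x : StrandEnd G.VT D := ⟨(T, c, c'), hc⟩ with hx
  set y : StrandEnd G.VP D :=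
    ⟨(P, (G.pairing (T, c)).2, (G.pairing (T, c')).2), label_ne hc h1 h2⟩ with hy
  have e : (alignEdges hc h1 h2).strandEquiv = alignCorner corner corner G.strandEquiv x y :=
    strandEquiv_alignEdges hc h1 h2
  have ix : G.strandEquiv x = y ↔ G.strands (T, c) c' = (G.pairing (T, c')).2 := by
    rw [strandEquiv_eq_iff]
    exact and_iff_right (Prod.ext h1 rfl)
  have iy : G.strandEquiv (corner x) = corner y ↔ G.strands (T, c') c = (G.pairing (T, c)).2 := by
    rw [strandEquiv_eq_iff]
    exact and_iff_right (Prod.ext h2 rfl)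
  have c1 : G.strandEquiv x ≠ corner y := fun h =>
    label_ne hc h1 h2 (congrArg (fun x : StrandEnd G.VP D => x.1.2.1) h)
  have c2 : G.strandEquiv (corner x) ≠ y := fun h =>
    label_ne hc h1 h2 (congrArg (fun x : StrandEnd G.VP D => x.1.2.1) h).symm
  by_cases hax : G.strandEquiv x = y
  · have hay : G.strandEquiv (corner x) ≠ corner y := fun h => hna ⟨ix.1 hax, iy.1 h⟩
    rw [e]
    exact faceCount_lt_alignCorner_of_left corner_involutive corner_involutive corner_ne corner_ne hax hay
  · by_cases hay : G.strandEquiv (corner x) = corner y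
    · rw [e]
      exact faceCount_lt_alignCorner_of_right corner_involutive corner_involutive corner_ne corner_ne hax hay
    · have := faceCount_add_two_le_alignCorner corner_involutive corner_involutive corner_ne corner_ne
        c1 c2 hax hay ?_
      · rw [e]; exact Nat.lt_of_succ_lt this
      · rw [← e]
        intro hs
        obtain ⟨j, hj, hbj⟩ := G.strandEquiv_symm_eq (t := T) (i := c) (y := y) (Prod.ext h1 rfl)
        obtain ⟨k, hk, hbk⟩ := G.strandEquiv_symm_eq (t := T) (i := c') (y := corner y) (Prod.ext h2 rfl)
        rw [hbj, hbk] at hs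
        rcases hcol.of_onSameFace hj hk hs with ⟨h, -⟩ | ⟨-, h⟩
        · exact hc h
        · subst h
          exact hax (by rw [← Equiv.eq_symm_apply, hbj])

end AlignCount

/-! ### Invariants of partially aligned strands -/

section AlignAll

variable (G : StrandedGraph D) (T : G.VT) (P : G.VP) (θ : Equiv.Perm (Fin (D + 1)))

/-- The strand end of `P` to which the strand end `(i, j)` of `T` is to be joined. -/
def target {i j : Fin (D + 1)} (h : i ≠ j) : StrandEnd G.VP D := ⟨(P, θ i, θ j), θ.injective.ne h⟩

variable {G} in
/-- The strand end `(i, j)` of `T` is joined to the strand end `(θ i, θ j)` of `P`. -/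
def AlignedAt (E : StrandEnd G.VT D ≃ StrandEnd G.VP D) (i j : Fin (D + 1)) : Prop :=
  ∀ h : i ≠ j, E ⟨(T, i, j), h⟩ = G.target P θ h

/-- The strand bijections which arise from that of `G` by aligning corners of `T` and `P`. -/
structure AlignState (E : StrandEnd G.VT D ≃ StrandEnd G.VP D) : Prop where
  outer : ∀ z, z.1.1 ≠ T → (G.strandEquiv z).1.1 ≠ P → E z = G.strandEquiv z
  leg : ∀ i j (h : i ≠ j), (G.pairing (T, i)).1 ≠ P →
    (E ⟨(T, i, j), h⟩ = G.strandEquiv ⟨(T, i, j), h⟩ ∧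
      E (G.strandEquiv.symm (G.target P θ h)) = G.target P θ h) ∨
    (E ⟨(T, i, j), h⟩ = G.target P θ h ∧
      E (G.strandEquiv.symm (G.target P θ h)) = G.strandEquiv ⟨(T, i, j), h⟩)
  common : ∀ i j (h : i ≠ j), (G.pairing (T, i)).1 = P →
    (E ⟨(T, i, j), h⟩).1.1 = P ∧ (E ⟨(T, i, j), h⟩).1.2.1 = θ i
  aligned : ∀ i j, AlignedAt T P θ G.strandEquiv i j → AlignedAt T P θ E i j
  symm : ∀ i j, (G.pairing (T, i)).1 ≠ P → (G.pairing (T, j)).1 = P → AlignedAt T P θ E i j →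
    AlignedAt T P θ E j i

variable {G T P θ}

section General

variable {X Y : Type} [DecidableEq X] {κ : X → X} {κ' : Y → Y}

/-- The hypotheses `c1`, `c2` prevent a crosswise alignment, in which the two transpositions would
interfere. Alignment then only exchanges images: whatever went to `y` or `κ' y` takes over the old
image of `x` or `κ x`. -/
lemma alignCorner_cases {E : X ≃ Y} {x : X} {y : Y} (nκ : ∀ a, κ a ≠ a) (nκ' : ∀ a, κ' a ≠ a)
    (c1 : E x ≠ κ' y) (c2 : E (κ x) ≠ y) (z : X) :
    (z = x ∧ alignCorner κ κ' E x y z = y) ∨ (z = κ x ∧ alignCorner κ κ' E x y z = κ' y) ∨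
    (z ≠ x ∧ z ≠ κ x ∧ E z = y ∧ alignCorner κ κ' E x y z = E x) ∨
    (z ≠ x ∧ z ≠ κ x ∧ E z = κ' y ∧ alignCorner κ κ' E x y z = E (κ x)) ∨
    (z ≠ x ∧ z ≠ κ x ∧ E z ≠ y ∧ E z ≠ κ' y ∧ alignCorner κ κ' E x y z = E z) := by
  by_cases h1 : z = x
  · subst h1; exact Or.inl ⟨rfl, alignCorner_apply_self nκ nκ'⟩
  by_cases h2 : z = κ x
  · subst h2; exact Or.inr (Or.inl ⟨rfl, alignCorner_apply_corner⟩)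
  by_cases h3 : E z = y
  · refine Or.inr (Or.inr (Or.inl ⟨h1, h2, h3, ?_⟩))
    have hz : z = E.symm y := by rw [← h3]; simp
    rw [hz]
    exact alignCorner_symm_apply (by rwa [← hz]) c1
  by_cases h4 : E z = κ' y
  · refine Or.inr (Or.inr (Or.inr (Or.inl ⟨h1, h2, h4, ?_⟩)))
    have hz : z = E.symm (κ' y) := by rw [← h4]; simp
    rw [hz]
    exact alignCorner_symm_apply_corner nκ nκ' (by rwa [← hz]) c2
  · exact Or.inr (Or.inr (Or.inr (Or.inr ⟨h1, h2, h3, h4, alignCorner_apply_of_ne h1 h2 h3 h4⟩)))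

end General

lemma target_inj {i j i' j' : Fin (D + 1)} {h : i ≠ j} {h' : i' ≠ j'}
    (he : G.target P θ h = G.target P θ h') : i = i' ∧ j = j' := by
  rw [StrandEnd.eq_iff] at he
  exact ⟨θ.injective he.2.1, θ.injective he.2.2⟩

lemma alignState_self (hθ : G.RespectsEdges T P θ) : AlignState G T P θ G.strandEquiv where
  outer _ _ _ := rfl
  leg i j h _ := Or.inl ⟨rfl, by simp⟩
  common i j h hi := ⟨hi, hθ i hi⟩
  aligned _ _ h := h
  symm i j hi hj h hji := absurd (congrArg (fun x : StrandEnd G.VP D => x.1.1) (h hji.symm)) hi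

/-- An edge from `T` into the half-edge `θ i` of `P` would have to leave through `i`, which is a
leg; so the strand arriving there comes from another vertex. -/
lemma symm_target_ne (hθ : G.RespectsEdges T P θ) {i j : Fin (D + 1)} (h : i ≠ j)
    (hi : (G.pairing (T, i)).1 ≠ P) : (G.strandEquiv.symm (G.target P θ h)).1.1 ≠ T := by
  intro hT
  have he : G.strandEquiv (G.strandEquiv.symm (G.target P θ h)) = G.target P θ h := by simp
  rw [strandEquiv_eq_iff, hT] at he
  have := hθ.eq_of_pairing (i := (G.strandEquiv.symm (G.target P θ h)).1.2.1) (l := i) he.1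
  rw [this] at he
  exact hi (congrArg Prod.fst he.1)

namespace AlignState

variable {E : StrandEnd G.VT D ≃ StrandEnd G.VP D} (hE : AlignState G T P θ E)
include hE

/-- This supplies the hypotheses excluding crosswise alignment at every stage: a common edge reaches
`P` only at its own half-edge, and a leg strand reaches `P` only at its own target. -/
lemma not_target_swap {i j : Fin (D + 1)} (h : i ≠ j) :
    E ⟨(T, i, j), h⟩ ≠ G.target P θ h.symm := by
  intro he
  by_cases hi : (G.pairing (T, i)).1 = P
  · have := (hE.common i j h hi).2
    rw [he] at this
    exact h (θ.injective this).symm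
  · rcases hE.leg i j h hi with h' | h'
    · rw [h'.1] at he
      exact hi (congrArg (fun x : StrandEnd G.VP D => x.1.1) he)
    · rw [h'.1] at he
      exact h (target_inj he).1

lemma eq_of_leg {a b i j : Fin (D + 1)} {hab : a ≠ b} {h : i ≠ j} (ha : (G.pairing (T, a)).1 ≠ P)
    (he : E ⟨(T, a, b), hab⟩ = G.target P θ h) : a = i ∧ b = j := by
  rcases hE.leg a b hab ha with h' | h'
  · rw [h'.1] at he
    exact absurd (congrArg (fun x : StrandEnd G.VP D => x.1.1) he) ha
  · rw [h'.1] at he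
    exact target_inj he

open Classical in
lemma apply_alignCorner {i j : Fin (D + 1)} (h : i ≠ j) (z : StrandEnd G.VT D) :
    (z = ⟨(T, i, j), h⟩ ∧ alignCorner corner corner E ⟨(T, i, j), h⟩ (G.target P θ h) z =
      G.target P θ h) ∨
    (z = ⟨(T, j, i), h.symm⟩ ∧ alignCorner corner corner E ⟨(T, i, j), h⟩ (G.target P θ h) z =
      G.target P θ h.symm) ∨
    (z ≠ ⟨(T, i, j), h⟩ ∧ z ≠ ⟨(T, j, i), h.symm⟩ ∧ E z = G.target P θ h ∧
      alignCorner corner corner E ⟨(T, i, j), h⟩ (G.target P θ h) z = E ⟨(T, i, j), h⟩) ∨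
    (z ≠ ⟨(T, i, j), h⟩ ∧ z ≠ ⟨(T, j, i), h.symm⟩ ∧ E z = G.target P θ h.symm ∧
      alignCorner corner corner E ⟨(T, i, j), h⟩ (G.target P θ h) z = E ⟨(T, j, i), h.symm⟩) ∨
    (z ≠ ⟨(T, i, j), h⟩ ∧ z ≠ ⟨(T, j, i), h.symm⟩ ∧ E z ≠ G.target P θ h ∧
      E z ≠ G.target P θ h.symm ∧
      alignCorner corner corner E ⟨(T, i, j), h⟩ (G.target P θ h) z = E z) :=
  alignCorner_cases corner_ne corner_ne (hE.not_target_swap h) (hE.not_target_swap h.symm) z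

open Classical in
lemma alignedAt_mono {i j : Fin (D + 1)} (h : i ≠ j) {a b : Fin (D + 1)}
    (hab : AlignedAt T P θ E a b) :
    AlignedAt T P θ (alignCorner corner corner E ⟨(T, i, j), h⟩ (G.target P θ h)) a b := by
  intro hne
  have hab := hab hne
  rcases hE.apply_alignCorner h ⟨(T, a, b), hne⟩ with ⟨h1, h2⟩ | ⟨h1, h2⟩ | ⟨h1, h1', h2, h3⟩ |
      ⟨h1, h1', h2, h3⟩ | ⟨h1, h1', h2, h3, h4⟩
  · rw [h2]
    obtain ⟨-, rfl, rfl⟩ := StrandEnd.eq_iff.1 h1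
    rfl
  · rw [h2]
    obtain ⟨-, rfl, rfl⟩ := StrandEnd.eq_iff.1 h1
    rfl
  · obtain ⟨rfl, rfl⟩ := target_inj (hab.symm.trans h2)
    exact absurd rfl h1
  · obtain ⟨rfl, rfl⟩ := target_inj (hab.symm.trans h2)
    exact absurd rfl h1'
  · rw [h4, hab]

-- When the corner of a leg strand is aligned, that strand and the strand arriving at its target
-- exchange images; aligning other corners does not touch this pair. In the field `leg`, `w` is the
-- arriving strand, which does not start at `T`.
open Classical in
lemma alignCorner_state (hθ : G.RespectsEdges T P θ) {i j : Fin (D + 1)} (h : i ≠ j) :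
    AlignState G T P θ (alignCorner corner corner E ⟨(T, i, j), h⟩ (G.target P θ h)) where
  outer z hz hz' := by
    have hEz := hE.outer z hz hz'
    rcases hE.apply_alignCorner h z with ⟨h1, h2⟩ | ⟨h1, h2⟩ | ⟨h1, h1', h2, h3⟩ |
      ⟨h1, h1', h2, h3⟩ | ⟨h1, h1', h2, h3, h4⟩
    · rw [h1] at hz; exact absurd rfl hz
    · rw [h1] at hz; exact absurd rfl hz
    · rw [← hEz, h2] at hz'; exact absurd rfl hz'
    · rw [← hEz, h2] at hz'; exact absurd rfl hz'
    · rw [h4, hEz]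
  leg a b hab ha := by
    have hwT := symm_target_ne hθ hab ha
    have hleg := hE.leg a b hab ha
    generalize G.strandEquiv.symm (G.target P θ hab) = w at hwT hleg ⊢
    have hw1 : ∀ {c d : Fin (D + 1)} {hcd : c ≠ d}, w ≠ ⟨(T, c, d), hcd⟩ := by
      rintro c d hcd rfl; exact hwT rfl
    rcases hE.apply_alignCorner h ⟨(T, a, b), hab⟩ with ⟨h1, h2⟩ | ⟨h1, h2⟩ | ⟨h1, h1', h2, h3⟩ |
        ⟨h1, h1', h2, h3⟩ | ⟨h1, h1', h2, h3, h4⟩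
    · obtain ⟨-, rfl, rfl⟩ := StrandEnd.eq_iff.1 h1
      refine Or.inr ⟨h2, ?_⟩
      rcases hE.apply_alignCorner h w with ⟨m1, m2⟩ | ⟨m1, m2⟩ | ⟨m1, m1', m2, m3⟩ |
          ⟨m1, m1', m2, m3⟩ | ⟨m1, m1', m2, m3, m4⟩
      · exact absurd m1 hw1
      · exact absurd m1 hw1
      · rw [m3]
        rcases hleg with ⟨k1, k2⟩ | ⟨k1, k2⟩
        · exact k1
        · rw [k2] at m2
          exact absurd (congrArg (fun x : StrandEnd G.VP D => x.1.1) m2) ha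
      · rcases hleg with ⟨k1, k2⟩ | ⟨k1, k2⟩
        · exact absurd (target_inj (k2.symm.trans m2)).1 h
        · rw [k2] at m2
          exact absurd (congrArg (fun x : StrandEnd G.VP D => x.1.1) m2) ha
      · rcases hleg with ⟨k1, k2⟩ | ⟨k1, k2⟩
        · exact absurd k2 m2
        · rw [m4, k2]
    · obtain ⟨-, rfl, rfl⟩ := StrandEnd.eq_iff.1 h1
      refine Or.inr ⟨h2, ?_⟩
      rcases hE.apply_alignCorner h w with ⟨m1, m2⟩ | ⟨m1, m2⟩ | ⟨m1, m1', m2, m3⟩ |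
          ⟨m1, m1', m2, m3⟩ | ⟨m1, m1', m2, m3, m4⟩
      · exact absurd m1 hw1
      · exact absurd m1 hw1
      · rcases hleg with ⟨k1, k2⟩ | ⟨k1, k2⟩
        · exact absurd (target_inj (k2.symm.trans m2)).1 h.symm
        · rw [k2] at m2
          exact absurd (congrArg (fun x : StrandEnd G.VP D => x.1.1) m2) ha
      · rw [m3]
        rcases hleg with ⟨k1, k2⟩ | ⟨k1, k2⟩
        · exact k1
        · rw [k2] at m2
          exact absurd (congrArg (fun x : StrandEnd G.VP D => x.1.1) m2) ha
      · rcases hleg with ⟨k1, k2⟩ | ⟨k1, k2⟩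
        · exact absurd k2 m3
        · rw [m4, k2]
    · obtain ⟨rfl, rfl⟩ := hE.eq_of_leg ha h2
      exact absurd rfl h1
    · obtain ⟨rfl, rfl⟩ := hE.eq_of_leg ha h2
      exact absurd rfl h1'
    · rw [h4]
      refine hleg.imp (fun k => ⟨k.1, ?_⟩) (fun k => ⟨k.1, ?_⟩)
      all_goals
        rcases hE.apply_alignCorner h w with ⟨m1, m2⟩ | ⟨m1, m2⟩ | ⟨m1, m1', m2, m3⟩ |
          ⟨m1, m1', m2, m3⟩ | ⟨m1, m1', m2, m3, m4⟩
      · exact absurd m1 hw1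
      · exact absurd m1 hw1
      · obtain ⟨rfl, rfl⟩ := target_inj (k.2.symm.trans m2)
        exact absurd rfl h1
      · obtain ⟨rfl, rfl⟩ := target_inj (k.2.symm.trans m2)
        exact absurd rfl h1'
      · rw [m4, k.2]
      · exact absurd m1 hw1
      · exact absurd m1 hw1
      · rw [k.2] at m2
        exact absurd (congrArg (fun x : StrandEnd G.VP D => x.1.1) m2) ha
      · rw [k.2] at m2
        exact absurd (congrArg (fun x : StrandEnd G.VP D => x.1.1) m2) ha
      · rw [m4, k.2]
  common a b hab ha := by
    have hc := hE.common a b hab ha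
    rcases hE.apply_alignCorner h ⟨(T, a, b), hab⟩ with ⟨h1, h2⟩ | ⟨h1, h2⟩ | ⟨h1, h1', h2, h3⟩ |
      ⟨h1, h1', h2, h3⟩ | ⟨h1, h1', h2, h3, h4⟩
    · rw [h2]
      obtain ⟨-, rfl, rfl⟩ := StrandEnd.eq_iff.1 h1
      exact ⟨rfl, rfl⟩
    · rw [h2]
      obtain ⟨-, rfl, rfl⟩ := StrandEnd.eq_iff.1 h1
      exact ⟨rfl, rfl⟩
    · rw [h2] at hc
      have : i = a := θ.injective hc.2
      subst this
      rw [h3]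
      exact hE.common _ _ _ ha
    · rw [h2] at hc
      have : j = a := θ.injective hc.2
      subst this
      rw [h3]
      exact hE.common _ _ _ ha
    · rw [h4]; exact hc
  aligned a b hab := hE.alignedAt_mono h (hE.aligned a b hab)
  symm a b ha hb hab := by
    intro hba
    rcases hE.apply_alignCorner h ⟨(T, a, b), hba.symm⟩ with ⟨h1, h2⟩ | ⟨h1, h2⟩ | ⟨h1, h1', h2, h3⟩ |
      ⟨h1, h1', h2, h3⟩ | ⟨h1, h1', h2, h3, h4⟩
    · obtain ⟨-, rfl, rfl⟩ := StrandEnd.eq_iff.1 h1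
      exact alignCorner_apply_corner
    · obtain ⟨-, rfl, rfl⟩ := StrandEnd.eq_iff.1 h1
      exact alignCorner_apply_self corner_ne corner_ne
    · obtain ⟨rfl, rfl⟩ := hE.eq_of_leg ha h2
      exact absurd rfl h1
    · obtain ⟨rfl, rfl⟩ := hE.eq_of_leg ha h2
      exact absurd rfl h1'
    · have := hab hba.symm
      rw [h4] at this
      exact hE.alignedAt_mono h (hE.symm a b ha hb fun _ => this) hba

end AlignState

end AlignAll

/-! ### Complete alignment and the contraction -/

section Contracted

variable {G : StrandedGraph D} {T : G.VT} {P : G.VP} {θ : Equiv.Perm (Fin (D + 1))}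

instance [IsEmpty G.R] (hθ : G.RespectsEdges T P θ) : IsEmpty (contract hθ).R := ‹IsEmpty G.R›

lemma exists_inclEnd {V : Type} {v : V} {x : StrandEnd V D} (hx : x.1.1 ≠ v) :
    ∃ z : StrandEnd {t : V // t ≠ v} D, inclEnd z = x :=
  ⟨⟨(⟨x.1.1, hx⟩, x.1.2.1, x.1.2.2), x.2⟩, rfl⟩

variable (hθ : G.RespectsEdges T P θ) {E : StrandEnd G.VT D ≃ StrandEnd G.VP D}
  (hE : AlignState G T P θ E) (hall : ∀ i j, AlignedAt T P θ E i j)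
include hθ hE hall

/-- Complete alignment leaves only the second alternative of `leg`: the strand arriving at a target
has taken over the image of the corresponding strand of `T`, which is how the contraction glues
them. -/
lemma AlignState.apply_inclEnd (z : StrandEnd (contract hθ).VT D) :
    E (inclEnd z) = inclEnd ((contract hθ).strandEquiv z) := by
  by_cases hz : (G.strandEquiv (inclEnd z)).1.1 = P
  · obtain ⟨i, hi⟩ := θ.surjective (G.strandEquiv (inclEnd z)).1.2.1
    obtain ⟨j, hj⟩ := θ.surjective (G.strandEquiv (inclEnd z)).1.2.2
    have hij : i ≠ j := by
      rintro rfl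
      exact (G.strandEquiv (inclEnd z)).2 (hi.symm.trans hj)
    have he : G.strandEquiv (inclEnd z) = G.target P θ hij :=
      StrandEnd.eq_iff.2 ⟨hz, hi.symm, hj.symm⟩
    rw [inclEnd_contract_of_eq hθ z hij he]
    have hleg : (G.pairing (T, i)).1 ≠ P := by
      have := hθ.pairing_ne z.1.1.2 (k := z.1.2.1) hz
      have h2 : (G.pairing (z.1.1.1, z.1.2.1)).2 = θ i := hi.symm
      rwa [h2, Equiv.symm_apply_apply] at this
    have hw : G.strandEquiv.symm (G.target P θ hij) = inclEnd z := by rw [← he]; simp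
    rcases hE.leg i j hij hleg with ⟨k1, k2⟩ | ⟨k1, k2⟩
    · have := hall i j hij
      rw [k1] at this
      exact absurd (congrArg (fun x : StrandEnd G.VP D => x.1.1) this) hleg
    · rw [← hw, k2]
  · rw [inclEnd_contract_of_ne hθ z hz]
    exact hE.outer _ z.1.1.2 hz

lemma AlignState.onSameFace_contract {z w : StrandEnd (contract hθ).VT D}
    (h : SameFace corner corner E (inclEnd z) (inclEnd w)) : (contract hθ).OnSameFace z w := by
  have h1 := h.mem_of_closed corner_involutive corner_involutive
    (p := fun x => ∃ z' : StrandEnd (contract hθ).VT D, inclEnd z' = x ∧ (contract hθ).OnSameFace z z')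
    ?_ ?_
  · obtain ⟨w', hw, hzw⟩ := h1.1 ⟨z, rfl, .refl _⟩
    rwa [← inclEnd_injective hw]
  · rintro _ ⟨z', rfl, hz'⟩
    exact ⟨corner z', rfl, .trans _ _ _ hz' (sameFace_corner _ _)⟩
  · rintro _ b ⟨z', rfl, hz'⟩ hb
    refine ⟨(contract hθ).strandEquiv.symm (corner ((contract hθ).strandEquiv z')), ?_,
      .trans _ _ _ hz' (sameFace_of_apply (by simp))⟩
    apply E.injective
    rw [hb, hE.apply_inclEnd hθ hall, hE.apply_inclEnd hθ hall, Equiv.apply_symm_apply]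
    rfl

/-- A face through `T` contains one of its corners, of which there is one for each pair of labels;
every other face is the image of a face of the contraction. -/
lemma AlignState.faceCount_le [IsEmpty G.R] :
    faceCount corner corner E ≤ (contract hθ).numFaces + (D + 1).choose 2 := by
  classical
  have hc : Nat.card {s : Sym2 (Fin (D + 1)) // ¬ s.IsDiag} = (D + 1).choose 2 := by
    rw [Nat.card_eq_fintype_card, Sym2.card_subtype_not_diag, Fintype.card_fin]
  have hout : ∀ s : {s : Sym2 (Fin (D + 1)) // ¬ s.IsDiag}, (Quot.out s.1).1 ≠ (Quot.out s.1).2 := by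
    intro s h
    refine s.2 ?_
    rw [← Quot.out_eq s.1]
    exact h
  have hlift : ∀ a b, FaceRel corner corner (contract hθ).strandEquiv a b →
      Quot.mk (FaceRel corner corner E) (inclEnd a) = Quot.mk (FaceRel corner corner E) (inclEnd b) := by
    rintro a b (rfl | h)
    · exact Quot.sound (Or.inl rfl)
    · refine Quot.sound (Or.inr ?_)
      rw [hE.apply_inclEnd hθ hall, hE.apply_inclEnd hθ hall, h]
      rfl
  rw [← hc, numFaces_eq_faceCount, faceCount, faceCount, ← Nat.card_sum]
  refine Nat.card_le_card_of_surjective (Sum.elim (Quot.lift _ hlift)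
    fun s => Quot.mk _ ⟨(T, (Quot.out s.1).1, (Quot.out s.1).2), hout s⟩) ?_
  rintro ⟨x⟩
  by_cases hx : x.1.1 = T
  · refine ⟨Sum.inr ⟨s(x.1.2.1, x.1.2.2), x.2⟩, ?_⟩
    simp only [Sum.elim_inr]
    have h1 : Quot.mk _ (Quot.out s(x.1.2.1, x.1.2.2)) = s(x.1.2.1, x.1.2.2) := Quot.out_eq _
    have h2 := Sym2.eq_iff.1 h1
    rcases h2 with ⟨h2, h3⟩ | ⟨h2, h3⟩
    · congr 1
      exact StrandEnd.eq_iff.2 ⟨hx.symm, h2, h3⟩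
    · refine Quot.sound (Or.inl ?_)
      exact StrandEnd.eq_iff.2 ⟨hx, h3.symm, h2.symm⟩
  · obtain ⟨z, rfl⟩ := exists_inclEnd hx
    exact ⟨Sum.inl (Quot.mk _ z), rfl⟩

end Contracted

/-! ### The faces certain to be gained -/

section Potential

variable (G : StrandedGraph D) (T : G.VT) (P : G.VP) (θ : Equiv.Perm (Fin (D + 1)))
  (f : Fin (D + 1))

/-- The edges from `T` to `P` are pairwise parallel. -/
def ParallelAt : Prop := ∀ a b, (G.pairing (T, a)).1 = P → (G.pairing (T, b)).1 = P →
  G.strands (T, a) b = (G.pairing (T, b)).2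

variable {G} in
lemma ParallelAt.respectsEdges {G : StrandedGraph D} {T : G.VT} {P : G.VP} {f : Fin (D + 1)}
    (h : G.ParallelAt T P) (hf : (G.pairing (T, f)).1 = P) : G.RespectsEdges T P (G.strands (T, f)) :=
  fun i hi => (h f i hf hi).symm

variable {G}

open Classical in
/-- The number of faces which are certain to be gained when the remaining corners of `T` and `P`
are aligned. -/
noncomputable def alignPotential (E : StrandEnd G.VT D ≃ StrandEnd G.VP D) : ℕ :=
  (Finset.univ.filter fun i => (G.pairing (T, i)).1 ≠ P ∧ ¬ AlignedAt T P θ E i f).card +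
  (Finset.univ.filter fun c => (G.pairing (T, c)).1 = P ∧ c ≠ f ∧
    ∃ i, (G.pairing (T, i)).1 ≠ P ∧ ¬ AlignedAt T P θ E i c).card

variable {T P θ f}

lemma alignedAt_strandEquiv (hθ : G.RespectsEdges T P θ) (hpar : G.ParallelAt T P) {a b : Fin (D + 1)}
    (ha : (G.pairing (T, a)).1 = P) (hb : (G.pairing (T, b)).1 = P) :
    AlignedAt T P θ G.strandEquiv a b := fun _ =>
  StrandEnd.eq_iff.2 ⟨ha, hθ a ha, (hpar a b ha hb).trans (hθ b hb)⟩

lemma alignedAt_strandEquiv_of_strands (hf : (G.pairing (T, f)).1 = P) (hfθ : G.strands (T, f) = θ)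
    (j : Fin (D + 1)) : AlignedAt T P θ G.strandEquiv f j := fun _ =>
  StrandEnd.eq_iff.2 ⟨hf, by rw [← hfθ]; exact (G.strands_self T f).symm, by rw [← hfθ]; rfl⟩

lemma not_alignedAt_strandEquiv {i j : Fin (D + 1)} (h : i ≠ j) (hi : (G.pairing (T, i)).1 ≠ P) :
    ¬ AlignedAt T P θ G.strandEquiv i j := fun hc =>
  hi (congrArg (fun x : StrandEnd G.VP D => x.1.1) (hc h))

-- Initially all legs count, and so do all common edges except `f`, because a leg exists: together D
-- + 1 − 1.
open Classical in
lemma alignPotential_self (hf : (G.pairing (T, f)).1 = P) (hm : ∃ i, (G.pairing (T, i)).1 ≠ P) :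
    alignPotential T P θ f G.strandEquiv = D := by
  have e1 : (Finset.univ.filter fun i => (G.pairing (T, i)).1 ≠ P ∧
      ¬ AlignedAt T P θ G.strandEquiv i f) = Finset.univ.filter fun i => ¬ (G.pairing (T, i)).1 = P := by
    refine Finset.filter_congr fun i _ => and_iff_left_of_imp fun hi => ?_
    exact not_alignedAt_strandEquiv (by rintro rfl; exact hi hf) hi
  have e2 : (Finset.univ.filter fun c => (G.pairing (T, c)).1 = P ∧ c ≠ f ∧
      ∃ i, (G.pairing (T, i)).1 ≠ P ∧ ¬ AlignedAt T P θ G.strandEquiv i c) =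
      (Finset.univ.filter fun i => (G.pairing (T, i)).1 = P).erase f := by
    ext c
    simp only [Finset.mem_filter, Finset.mem_univ, true_and, Finset.mem_erase]
    refine ⟨fun h => ⟨h.2.1, h.1⟩, fun h => ⟨h.2, h.1, ?_⟩⟩
    obtain ⟨i, hi⟩ := hm
    exact ⟨i, hi, not_alignedAt_strandEquiv (by rintro rfl; exact hi h.2) hi⟩
  rw [alignPotential, e1, e2, Finset.card_erase_of_mem (by simpa using hf)]
  have h1 := Finset.card_filter_add_card_filter_not (s := (Finset.univ : Finset (Fin (D + 1))))
    (fun i => (G.pairing (T, i)).1 = P)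
  have h2 : 0 < (Finset.univ.filter fun i => (G.pairing (T, i)).1 = P).card :=
    Finset.card_pos.2 ⟨f, by simpa using hf⟩
  simp only [Finset.card_univ, Fintype.card_fin] at h1
  omega

end Potential

namespace AlignState

variable {G : StrandedGraph D} {T : G.VT} {P : G.VP} {θ : Equiv.Perm (Fin (D + 1))}
  {E : StrandEnd G.VT D ≃ StrandEnd G.VP D}

section

variable (hE : AlignState G T P θ E)
include hE

open Classical in
lemma faceCount_le_align {i j : Fin (D + 1)} (h : i ≠ j) :
    faceCount corner corner E ≤
      faceCount corner corner (alignCorner corner corner E ⟨(T, i, j), h⟩ (G.target P θ h)) :=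
  faceCount_le_alignCorner corner_involutive corner_involutive corner_ne corner_ne
    (hE.not_target_swap h.symm)

omit hE in
open Classical in
lemma faceCount_lt_align {i j : Fin (D + 1)} (h : i ≠ j) (h1 : ¬ AlignedAt T P θ E i j)
    (h2 : AlignedAt T P θ E j i) : faceCount corner corner E + 1 ≤
      faceCount corner corner (alignCorner corner corner E ⟨(T, i, j), h⟩ (G.target P θ h)) :=
  faceCount_lt_alignCorner_of_right corner_involutive corner_involutive corner_ne corner_ne
    (fun h' => h1 fun _ => h') (h2 h.symm)

open Classical in
lemma alignedAt_of_alignCorner {i j : Fin (D + 1)} (h : i ≠ j) {a b : Fin (D + 1)}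
    (ha : (G.pairing (T, a)).1 ≠ P)
    (hab : AlignedAt T P θ (alignCorner corner corner E ⟨(T, i, j), h⟩ (G.target P θ h)) a b) :
    AlignedAt T P θ E a b ∨ (a = i ∧ b = j) ∨ (a = j ∧ b = i) := by
  by_cases hne : a = b
  · exact Or.inl fun h => absurd hne h
  rcases hE.apply_alignCorner h ⟨(T, a, b), hne⟩ with ⟨h1, h2⟩ | ⟨h1, h2⟩ | ⟨h1, h1', h2, h3⟩ |
      ⟨h1, h1', h2, h3⟩ | ⟨h1, h1', h2, h3, h4⟩
  · exact Or.inr (Or.inl (StrandEnd.eq_iff.1 h1).2)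
  · exact Or.inr (Or.inr (StrandEnd.eq_iff.1 h1).2)
  · exact Or.inr (Or.inl (hE.eq_of_leg ha h2))
  · exact Or.inr (Or.inr (hE.eq_of_leg ha h2))
  · exact Or.inl fun _ => h4 ▸ hab hne

/-- If all strands of a common edge except one are aligned, then so is the last one. -/
lemma alignedAt_last {c i : Fin (D + 1)} (hc : (G.pairing (T, c)).1 = P)
    (h : ∀ k, k ≠ i → AlignedAt T P θ E c k) : AlignedAt T P θ E c i := by
  intro hci
  obtain ⟨e1, e2⟩ := hE.common c i hci hc
  obtain ⟨k, hk⟩ := θ.surjective (E ⟨(T, c, i), hci⟩).1.2.2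
  have hck : c ≠ k := by
    rintro rfl
    exact (E ⟨(T, c, i), hci⟩).2 (e2.trans hk)
  have he : E ⟨(T, c, i), hci⟩ = G.target P θ hck := StrandEnd.eq_iff.2 ⟨e1, e2, hk.symm⟩
  by_cases hki : k = i
  · subst hki; exact he
  · have h1 := h k hki hck
    have := E.injective (he.trans h1.symm)
    exact absurd (StrandEnd.eq_iff.1 this).2.2.symm hki

end

variable (hθ : G.RespectsEdges T P θ) (hpar : G.ParallelAt T P) {f : Fin (D + 1)}
  (hf : (G.pairing (T, f)).1 = P) (hfθ : G.strands (T, f) = θ)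

include hθ hpar in
lemma alignedAt_common (hE : AlignState G T P θ E) {a b : Fin (D + 1)}
    (ha : (G.pairing (T, a)).1 = P) (hb : (G.pairing (T, b)).1 = P) :
    AlignedAt T P θ E a b := hE.aligned a b (alignedAt_strandEquiv hθ hpar ha hb)

include hθ hpar in
lemma allAligned (hE : AlignState G T P θ E)
    (h : ∀ i j, (G.pairing (T, i)).1 ≠ P → AlignedAt T P θ E i j) (i j : Fin (D + 1)) :
    AlignedAt T P θ E i j := by
  by_cases hi : (G.pairing (T, i)).1 = P
  · by_cases hj : (G.pairing (T, j)).1 = P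
    · exact hE.alignedAt_common hθ hpar hi hj
    · exact hE.symm j i hj hi (h j i hj)
  · exact h i j hi

include hθ hpar hf hfθ

-- Every drop of the potential is paid for by a new face. All strands of `f` are aligned from the
-- start because `θ` is its strand permutation, so a corner between `f` and a leg is half aligned
-- and gains one face. For any other common edge the gain comes with its last unaligned leg. Corners
-- between two legs do not change the potential.
open Classical in
lemma faceCount_add_potential_le (hE : AlignState G T P θ E) {i j : Fin (D + 1)} (h : i ≠ j)
    (hi : (G.pairing (T, i)).1 ≠ P) (hij : ¬ AlignedAt T P θ E i j) :
    faceCount corner corner E + alignPotential T P θ f E ≤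
      faceCount corner corner (alignCorner corner corner E ⟨(T, i, j), h⟩ (G.target P θ h)) +
      alignPotential T P θ f (alignCorner corner corner E ⟨(T, i, j), h⟩ (G.target P θ h)) := by
  set E' := alignCorner corner corner E ⟨(T, i, j), h⟩ (G.target P θ h) with hE'
  have key : ∀ a b, (G.pairing (T, a)).1 ≠ P → AlignedAt T P θ E' a b →
      AlignedAt T P θ E a b ∨ (a = i ∧ b = j) ∨ (a = j ∧ b = i) :=
    fun a b ha hab => hE.alignedAt_of_alignCorner h ha hab
  have le : faceCount corner corner E ≤ faceCount corner corner E' := hE.faceCount_le_align h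
  unfold alignPotential
  set S1 := Finset.univ.filter fun i => (G.pairing (T, i)).1 ≠ P ∧ ¬ AlignedAt T P θ E i f with hS1
  set S2 := Finset.univ.filter fun c => (G.pairing (T, c)).1 = P ∧ c ≠ f ∧
    ∃ i, (G.pairing (T, i)).1 ≠ P ∧ ¬ AlignedAt T P θ E i c with hS2
  set S1' := Finset.univ.filter fun i => (G.pairing (T, i)).1 ≠ P ∧ ¬ AlignedAt T P θ E' i f with hS1'
  set S2' := Finset.univ.filter fun c => (G.pairing (T, c)).1 = P ∧ c ≠ f ∧
    ∃ i, (G.pairing (T, i)).1 ≠ P ∧ ¬ AlignedAt T P θ E' i c with hS2'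
  by_cases hj : (G.pairing (T, j)).1 = P
  · by_cases hjf : j = f
    · subst hjf
      have lt : faceCount corner corner E + 1 ≤ faceCount corner corner E' := AlignState.faceCount_lt_align h hij
        (hE.aligned j i (alignedAt_strandEquiv_of_strands hf hfθ i))
      have c1 : S1 ⊆ insert i S1' := by
        intro a ha
        simp only [hS1, hS1', Finset.mem_filter, Finset.mem_univ, true_and, Finset.mem_insert] at ha ⊢
        by_cases hai : a = i
        · exact Or.inl hai
        · refine Or.inr ⟨ha.1, fun hc => ?_⟩
          rcases key a j ha.1 hc with h1 | h1 | h1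
          · exact ha.2 h1
          · exact hai h1.1
          · exact h h1.2.symm
      have c2 : S2 ⊆ S2' := by
        intro c hc
        simp only [hS2, hS2', Finset.mem_filter, Finset.mem_univ, true_and] at hc ⊢
        obtain ⟨k1, k2, a, k3, k4⟩ := hc
        refine ⟨k1, k2, a, k3, fun hc => ?_⟩
        rcases key a c k3 hc with h1 | h1 | h1
        · exact k4 h1
        · exact k2 h1.2
        · exact k3 (h1.1 ▸ hj)
      have := Finset.card_le_card c1
      have := Finset.card_le_card c2
      have := Finset.card_insert_le i S1'
      omega
    · have c1 : S1 ⊆ S1' := by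
        intro a ha
        simp only [hS1, hS1', Finset.mem_filter, Finset.mem_univ, true_and] at ha ⊢
        refine ⟨ha.1, fun hc => ?_⟩
        rcases key a f ha.1 hc with h1 | h1 | h1
        · exact ha.2 h1
        · exact hjf h1.2.symm
        · exact ha.1 (h1.1 ▸ hj)
      have c1' := Finset.card_le_card c1
      by_cases hex : ∃ k, k ≠ i ∧ (G.pairing (T, k)).1 ≠ P ∧ ¬ AlignedAt T P θ E k j
      · have c2 : S2 ⊆ S2' := by
          intro c hc
          simp only [hS2, hS2', Finset.mem_filter, Finset.mem_univ, true_and] at hc ⊢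
          obtain ⟨k1, k2, a, k3, k4⟩ := hc
          by_cases hcj : c = j
          · subst hcj
            obtain ⟨k, hki, hk, hkc⟩ := hex
            refine ⟨k1, k2, k, hk, fun hc => ?_⟩
            rcases key k c hk hc with h1 | h1 | h1
            · exact hkc h1
            · exact hki h1.1
            · exact h h1.2.symm
          · refine ⟨k1, k2, a, k3, fun hc => ?_⟩
            rcases key a c k3 hc with h1 | h1 | h1
            · exact k4 h1
            · exact hcj h1.2
            · exact k3 (h1.1 ▸ hj)
        have := Finset.card_le_card c2
        omega
      · push Not at hex
        -- All strands of `j` other than `i` are in place, so the strand `i` has no choice left and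
        -- the corner is half aligned.
        have hji : AlignedAt T P θ E j i := by
          refine hE.alignedAt_last hj fun k hk => ?_
          by_cases hkP : (G.pairing (T, k)).1 = P
          · exact hE.alignedAt_common hθ hpar hj hkP
          · exact hE.symm k j hkP hj (hex k hk hkP)
        have lt : faceCount corner corner E + 1 ≤ faceCount corner corner E' := AlignState.faceCount_lt_align h hij hji
        have c2 : S2 ⊆ insert j S2' := by
          intro c hc
          simp only [hS2, hS2', Finset.mem_filter, Finset.mem_univ, true_and, Finset.mem_insert] at hc ⊢
          obtain ⟨k1, k2, a, k3, k4⟩ := hc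
          by_cases hcj : c = j
          · exact Or.inl hcj
          · refine Or.inr ⟨k1, k2, a, k3, fun hc => ?_⟩
            rcases key a c k3 hc with h1 | h1 | h1
            · exact k4 h1
            · exact hcj h1.2
            · exact k3 (h1.1 ▸ hj)
        have := Finset.card_le_card c2
        have := Finset.card_insert_le j S2'
        omega
  · have c1 : S1 ⊆ S1' := by
      intro a ha
      simp only [hS1, hS1', Finset.mem_filter, Finset.mem_univ, true_and] at ha ⊢
      refine ⟨ha.1, fun hc => ?_⟩
      rcases key a f ha.1 hc with h1 | h1 | h1
      · exact ha.2 h1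
      · exact hj (h1.2 ▸ hf)
      · exact hi (h1.2 ▸ hf)
    have c2 : S2 ⊆ S2' := by
      intro c hc
      simp only [hS2, hS2', Finset.mem_filter, Finset.mem_univ, true_and] at hc ⊢
      obtain ⟨k1, k2, a, k3, k4⟩ := hc
      refine ⟨k1, k2, a, k3, fun hc => ?_⟩
      rcases key a c k3 hc with h1 | h1 | h1
      · exact k4 h1
      · exact hj (h1.2 ▸ k1)
      · exact hi (h1.2 ▸ k1)
    have := Finset.card_le_card c1
    have := Finset.card_le_card c2
    omega

/-- All corners outside a set `S` can be aligned without decreasing the number of faces plus the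
potential. -/
lemma exists_aligned_off (S : Fin (D + 1) → Fin (D + 1) → Prop) (hS : ∀ i j, S i j → S j i) :
    ∃ E, AlignState G T P θ E ∧ faceCount corner corner G.strandEquiv +
        alignPotential T P θ f G.strandEquiv ≤ faceCount corner corner E + alignPotential T P θ f E ∧
      (∀ i j, (G.pairing (T, i)).1 ≠ P → ¬ S i j → AlignedAt T P θ E i j) ∧
      (∀ i j, i ≠ j → (G.pairing (T, i)).1 ≠ P → S i j → ¬ AlignedAt T P θ E i j) := by
  classical
  -- Here `n` bounds the number of unaligned leg strands. That the strands in `S` are still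
  -- unaligned has to be carried through the induction.
  suffices H : ∀ n, ∀ E, AlignState G T P θ E →
      (∀ i j, i ≠ j → (G.pairing (T, i)).1 ≠ P → S i j → ¬ AlignedAt T P θ E i j) →
      (Finset.univ.filter fun x : Fin (D + 1) × Fin (D + 1) =>
        (G.pairing (T, x.1)).1 ≠ P ∧ ¬ AlignedAt T P θ E x.1 x.2).card ≤ n →
      ∃ E', AlignState G T P θ E' ∧ faceCount corner corner E +
        alignPotential T P θ f E ≤ faceCount corner corner E' + alignPotential T P θ f E' ∧
      (∀ i j, (G.pairing (T, i)).1 ≠ P → ¬ S i j → AlignedAt T P θ E' i j) ∧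
      (∀ i j, i ≠ j → (G.pairing (T, i)).1 ≠ P → S i j → ¬ AlignedAt T P θ E' i j) from
    H _ G.strandEquiv (alignState_self hθ) (fun i j h hi _ => not_alignedAt_strandEquiv h hi) le_rfl
  intro n
  induction n with
  | zero =>
    intro E hE hES hn
    refine ⟨E, hE, le_rfl, fun i j hi _ => ?_, hES⟩
    by_contra hc
    have : (i, j) ∈ (Finset.univ.filter fun x : Fin (D + 1) × Fin (D + 1) =>
        (G.pairing (T, x.1)).1 ≠ P ∧ ¬ AlignedAt T P θ E x.1 x.2) := by simp [hi, hc]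
    rw [Finset.card_eq_zero.1 (Nat.le_zero.1 hn)] at this
    simp at this
  | succ n ih =>
    intro E hE hES hn
    by_cases hex : ∃ i j, (G.pairing (T, i)).1 ≠ P ∧ ¬ S i j ∧ ¬ AlignedAt T P θ E i j
    · obtain ⟨i, j, hi, hSij, hij⟩ := hex
      have h : i ≠ j := by
        rintro rfl; exact hij fun h => absurd rfl h
      have IH := ih _ (hE.alignCorner_state hθ h) ?_ ?_
      · obtain ⟨E', h1, h2, h3, h4⟩ := IH
        exact ⟨E', h1, (hE.faceCount_add_potential_le hθ hpar hf hfθ h hi hij).trans h2, h3, h4⟩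
      · intro a b hab ha hSab hc
        rcases hE.alignedAt_of_alignCorner h ha hc with h1 | ⟨rfl, rfl⟩ | ⟨rfl, rfl⟩
        · exact hES a b hab ha hSab h1
        · exact hSij hSab
        · exact hSij (hS _ _ hSab)
      · refine Nat.le_of_lt_succ (lt_of_lt_of_le (Finset.card_lt_card ?_) hn)
        rw [Finset.ssubset_iff_of_subset]
        · refine ⟨(i, j), by simp [hi, hij], ?_⟩
          simp only [Finset.mem_filter, Finset.mem_univ, true_and, not_and, not_not]
          exact fun _ _ => alignCorner_apply_self corner_ne corner_ne
        · intro x hx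
          simp only [Finset.mem_filter, Finset.mem_univ, true_and] at hx ⊢
          exact ⟨hx.1, fun hc => hx.2 (hE.alignedAt_mono h hc)⟩
    · push Not at hex
      exact ⟨E, hE, le_rfl, hex, hES⟩

end AlignState

/-! ### Loss of faces under contraction and the case of equality -/

section Comparison

variable {G : StrandedGraph D} {T : G.VT} {P : G.VP} {θ : Equiv.Perm (Fin (D + 1))} {f : Fin (D + 1)}

lemma alignPotential_eq_zero {E : StrandEnd G.VT D ≃ StrandEnd G.VP D}
    (hf : (G.pairing (T, f)).1 = P)
    (h : ∀ i c, (G.pairing (T, i)).1 ≠ P → (G.pairing (T, c)).1 = P → AlignedAt T P θ E i c) :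
    alignPotential T P θ f E = 0 := by
  classical
  rw [alignPotential, Finset.filter_false_of_mem, Finset.filter_false_of_mem]
  · simp
  · rintro c - ⟨h1, -, i, h2, h3⟩
    exact h3 (h i c h2 h1)
  · rintro i - ⟨h1, h2⟩
    exact h2 (h i f h1 hf)

variable (hθ : G.RespectsEdges T P θ) (hpar : G.ParallelAt T P)
  (hf : (G.pairing (T, f)).1 = P) (hfθ : G.strands (T, f) = θ) (hm : ∃ i, (G.pairing (T, i)).1 ≠ P)
include hpar hf hfθ hm

/-- Removing two vertices joined by parallel edges loses at most `D (D - 1) / 2` faces. -/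
lemma numFaces_le_contract [IsEmpty G.R] :
    G.numFaces + D ≤ (contract hθ).numFaces + (D + 1).choose 2 := by
  obtain ⟨E, hE, h1, h2, -⟩ := AlignState.exists_aligned_off hθ hpar hf hfθ (fun _ _ => False)
    fun _ _ h => h
  have hall := hE.allAligned hθ hpar fun i j hi => h2 i j hi id
  rw [alignPotential_self hf hm, alignPotential_eq_zero hf fun i c hi _ => h2 i c hi id,
    ← numFaces_eq_faceCount] at h1
  exact h1.trans (hE.faceCount_le hθ hall)

variable [IsEmpty G.R] (heq : (contract hθ).numFaces + (D + 1).choose 2 ≤ G.numFaces + D)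
include heq

/-- Align all corners except the one between `i` and `j`. The potential is then exhausted, so by
`heq` the last alignment cannot gain anything. It would gain two faces if the two arriving strands
were on different faces. -/
lemma onSameFace_of_legs {i j : Fin (D + 1)} (hij : i ≠ j) (hi : (G.pairing (T, i)).1 ≠ P)
    (hj : (G.pairing (T, j)).1 ≠ P) {z w : StrandEnd (contract hθ).VT D}
    (hz : G.strandEquiv (inclEnd z) = G.target P θ hij)
    (hw : G.strandEquiv (inclEnd w) = G.target P θ hij.symm) : (contract hθ).OnSameFace z w := by
  classical
  obtain ⟨E, hE, h1, h2, h3⟩ := AlignState.exists_aligned_off hθ hpar hf hfθ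
    (fun a b => (a = i ∧ b = j) ∨ (a = j ∧ b = i)) fun _ _ h => by tauto
  rw [alignPotential_self hf hm, alignPotential_eq_zero hf (fun a c ha hc => h2 a c ha ?_),
    ← numFaces_eq_faceCount] at h1
  swap
  · rintro (⟨rfl, rfl⟩ | ⟨rfl, rfl⟩)
    · exact hj hc
    · exact hi hc
  have n1 := h3 i j hij hi (Or.inl ⟨rfl, rfl⟩)
  have n2 := h3 j i hij.symm hj (Or.inr ⟨rfl, rfl⟩)
  set E' := alignCorner corner corner E ⟨(T, i, j), hij⟩ (G.target P θ hij) with hE'def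
  have hE' : AlignState G T P θ E' := hE.alignCorner_state hθ hij
  have hall : ∀ a b, AlignedAt T P θ E' a b := by
    refine hE'.allAligned hθ hpar fun a b ha => ?_
    by_cases hab : (a = i ∧ b = j) ∨ (a = j ∧ b = i)
    · rcases hab with ⟨rfl, rfl⟩ | ⟨rfl, rfl⟩
      · exact fun _ => alignCorner_apply_self corner_ne corner_ne
      · exact fun _ => alignCorner_apply_corner
    · exact hE.alignedAt_mono hij (h2 a b ha hab)
  apply hE'.onSameFace_contract hθ hall
  have ez : E.symm (G.target P θ hij) = inclEnd z := by
    rw [Equiv.symm_apply_eq]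
    rcases hE.leg i j hij hi with h | h
    · rw [← h.2, ← hz]; simp
    · exact absurd (fun _ => h.1) n1
  have ew : E.symm (G.target P θ hij.symm) = inclEnd w := by
    rw [Equiv.symm_apply_eq]
    rcases hE.leg j i hij.symm hj with h | h
    · rw [← h.2, ← hw]; simp
    · exact absurd (fun _ => h.1) n2
  rw [← ez, ← ew]
  by_contra hcon
  have := faceCount_add_two_le_alignCorner corner_involutive corner_involutive corner_ne corner_ne
    (hE.not_target_swap hij) (hE.not_target_swap hij.symm) (fun h => n1 fun _ => h)
    (fun h => n2 fun _ => h) hcon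
  have := hE'.faceCount_le hθ hall
  have e0 : faceCount corner corner E' = faceCount corner corner (alignCorner corner corner E ⟨(T, i, j), hij⟩ (G.target P θ hij)) := rfl
  omega

/-- Leave only the corners of `c` with `i` and `j` unaligned. At most one unit of potential remains,
and it is spent on the corner aligned last, whose half at `c` is then in place. So aligning the
corner of `i` and `c` gains nothing, which puts `z` on the face of the strand `j` of `c`, and that
strand is followed by `w`. As `f` was aligned from the start, `c ≠ f` is essential. -/
lemma onSameFace_of_common {c i j : Fin (D + 1)} (hij : i ≠ j) (hi : (G.pairing (T, i)).1 ≠ P)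
    (hj : (G.pairing (T, j)).1 ≠ P) (hc : (G.pairing (T, c)).1 = P) (hcf : c ≠ f)
    (hic : i ≠ c) (hjc : j ≠ c) {z w : StrandEnd (contract hθ).VT D}
    (hz : G.strandEquiv (inclEnd z) = G.target P θ hic)
    (hw : G.strandEquiv (inclEnd w) = G.target P θ hjc) : (contract hθ).OnSameFace z w := by
  classical
  have nc : ∀ {a}, (G.pairing (T, a)).1 ≠ P → a ≠ c := by rintro a ha rfl; exact ha hc
  obtain ⟨E, hE, h1, h2, h3⟩ := AlignState.exists_aligned_off hθ hpar hf hfθ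
    (fun a b => ((a = i ∨ a = j) ∧ b = c) ∨ (a = c ∧ (b = i ∨ b = j))) fun _ _ h => by tauto
  -- The corners of `f` have all been aligned, and `c` is the only other common edge with an
  -- unaligned corner.
  have hpot : alignPotential T P θ f E ≤ 1 := by
    rw [alignPotential, Finset.filter_false_of_mem, Finset.card_empty, zero_add]
    · refine (Finset.card_le_card (t := {c}) fun d hd => ?_).trans (by simp)
      simp only [Finset.mem_filter, Finset.mem_univ, true_and] at hd
      obtain ⟨k1, k2, a, k3, k4⟩ := hd
      by_contra hdc
      rw [Finset.mem_singleton] at hdc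
      exact k4 (h2 a d k3 (by have := nc k3; tauto))
    · rintro a - ⟨k1, k2⟩
      exact k2 (h2 a f k1 (by have := nc k1; have := hcf.symm; tauto))
  rw [alignPotential_self hf hm, ← numFaces_eq_faceCount] at h1
  have n1 := h3 i c hic hi (Or.inl ⟨Or.inl rfl, rfl⟩)
  have n2 := h3 j c hjc hj (Or.inl ⟨Or.inr rfl, rfl⟩)
  have hck : ∀ k, k ≠ i → k ≠ j → AlignedAt T P θ E c k := by
    intro k hki hkj
    by_cases hk : (G.pairing (T, k)).1 = P
    · exact hE.alignedAt_common hθ hpar hc hk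
    · exact hE.symm k c hk hc (h2 k c hk (by have := nc hk; tauto))
  set E1 := alignCorner corner corner E ⟨(T, i, c), hic⟩ (G.target P θ hic) with hE1def
  have hE1 : AlignState G T P θ E1 := hE.alignCorner_state hθ hic
  have m1 : ¬ AlignedAt T P θ E1 j c := by
    intro h
    rcases hE.alignedAt_of_alignCorner hic hj h with h | h | h
    · exact n2 h
    · exact hij h.1.symm
    · exact hjc h.1
  have a1 : AlignedAt T P θ E1 c i := fun _ => alignCorner_apply_corner
  have m2 : AlignedAt T P θ E1 c j := by
    refine hE1.alignedAt_last hc fun k hk => ?_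
    by_cases hki : k = i
    · subst hki; exact a1
    · exact hE.alignedAt_mono hic (hck k hki hk)
  set E2 := alignCorner corner corner E1 ⟨(T, c, j), hjc.symm⟩ (G.target P θ hjc.symm) with hE2def
  have hE2 : AlignState G T P θ E2 := hE1.alignCorner_state hθ hjc.symm
  have f2 : faceCount corner corner E1 + 1 ≤ faceCount corner corner E2 :=
    faceCount_lt_alignCorner_of_left corner_involutive corner_involutive corner_ne corner_ne
      (m2 hjc.symm) (fun h => m1 fun _ => h)
  have hall : ∀ a b, AlignedAt T P θ E2 a b := by
    refine hE2.allAligned hθ hpar fun a b ha => ?_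
    by_cases hab : ((a = i ∨ a = j) ∧ b = c) ∨ (a = c ∧ (b = i ∨ b = j))
    · rcases hab with ⟨rfl | rfl, rfl⟩ | ⟨rfl, -⟩
      · exact hE1.alignedAt_mono hjc.symm fun _ => alignCorner_apply_self corner_ne corner_ne
      · exact fun _ => alignCorner_apply_corner
      · exact absurd hc ha
    · exact hE1.alignedAt_mono hjc.symm (hE.alignedAt_mono hic (h2 a b ha hab))
  have up := hE2.faceCount_le hθ hall
  have n3 : ¬ AlignedAt T P θ E c i := by
    intro h
    have : faceCount corner corner E + 1 ≤ faceCount corner corner E1 :=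
      AlignState.faceCount_lt_align hic n1 h
    omega
  have n4 : ¬ AlignedAt T P θ E c j := by
    intro h
    refine n3 (hE.alignedAt_last hc fun k hk => ?_)
    by_cases hkj : k = j
    · subst hkj; exact h
    · exact hck k hk hkj
  have ez : E.symm (G.target P θ hic) = inclEnd z := by
    rw [Equiv.symm_apply_eq]
    rcases hE.leg i c hic hi with h | h
    · rw [← h.2, ← hz]; simp
    · exact absurd (fun _ => h.1) n1
  -- The strands of `c` other than `i`, `j` are in place and these two are not, so they are crossed:
  -- the target of `(c, i)` is hit by `(c, j)`.
  have ec : E.symm (G.target P θ hic.symm) = ⟨(T, c, j), hjc.symm⟩ := by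
    rw [Equiv.symm_apply_eq]
    obtain ⟨e1, e2⟩ := hE.common c j hjc.symm hc
    obtain ⟨k, hk⟩ := θ.surjective (E ⟨(T, c, j), hjc.symm⟩).1.2.2
    have hckne : c ≠ k := by
      rintro rfl
      exact (E ⟨(T, c, j), hjc.symm⟩).2 (e2.trans hk)
    have he : E ⟨(T, c, j), hjc.symm⟩ = G.target P θ hckne := StrandEnd.eq_iff.2 ⟨e1, e2, hk.symm⟩
    have hkj : k ≠ j := by rintro rfl; exact n4 fun _ => he
    by_cases hki : k = i
    · subst hki; exact he.symm
    · have := E.injective (he.trans (hck k hki hkj hckne).symm)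
      exact absurd (StrandEnd.eq_iff.1 this).2.2.symm hkj
  have same1 : SameFace corner corner E1 (inclEnd z) ⟨(T, c, j), hjc.symm⟩ := by
    rw [← ez, ← ec]
    by_contra hcon
    have := faceCount_add_two_le_alignCorner corner_involutive corner_involutive corner_ne corner_ne
      (hE.not_target_swap hic) (hE.not_target_swap hic.symm) (fun h => n1 fun _ => h)
      (fun h => n3 fun _ => h) hcon
    have e0 : faceCount corner corner E1 = faceCount corner corner (alignCorner corner corner E ⟨(T, i, c), hic⟩ (G.target P θ hic)) := rfl
    omega
  have same2 : SameFace corner corner E1 ⟨(T, c, j), hjc.symm⟩ (inclEnd w) := by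
    apply sameFace_of_apply
    rw [m2 hjc.symm]
    rcases hE1.leg j c hjc hj with h | h
    · have : inclEnd w = G.strandEquiv.symm (G.target P θ hjc) := by rw [← hw]; simp
      rw [this, h.2]
      rfl
    · exact absurd (fun _ => h.1) m1
  have hne : ∀ (v : StrandEnd (contract hθ).VT D) {a b : Fin (D + 1)} {hab : a ≠ b},
      inclEnd v ≠ ⟨(T, a, b), hab⟩ := fun v a b hab h =>
    v.1.1.2 (congrArg (fun x : StrandEnd G.VT D => x.1.1) h)
  exact hE2.onSameFace_contract hθ hall (SameFace.alignCorner_of_left corner_involutive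
    corner_involutive corner_ne corner_ne (m2 hjc.symm) (.trans _ _ _ same1 same2)
    (hne z) (hne z) (hne w) (hne w))

end Comparison

end StrandedGraph

/-! ### Connectivity and removable pairs of vertices -/

/-- In a finite connected graph without leaves one can remove two adjacent vertices without
disconnecting the graph. -/
lemma SimpleGraph.Connected.exists_adj_induce_compl_connected {V : Type*} [Finite V]
    {S : SimpleGraph V} (hS : S.Connected) (hdeg : ∀ u v, S.Adj u v → ∃ w, w ≠ v ∧ S.Adj u w)
    (hne : ∃ u v, S.Adj u v) : ∃ u v, S.Adj u v ∧ (S.induce {u, v}ᶜ).Connected := by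
  -- A maximal connected vertex set whose complement still contains an edge will turn out to omit
  -- just the two ends of an edge.
  let A : Set (Set V) := {K | (S.induce K).Connected ∧ ∃ u v, S.Adj u v ∧ u ∉ K ∧ v ∉ K}
  have hA : A.Nonempty := by
    obtain ⟨u, v, huv⟩ := hne
    obtain ⟨w, hwv, huw⟩ := hdeg u v huv
    refine ⟨{w}, ?_, u, v, huv, ?_, ?_⟩
    · exact (SimpleGraph.connected_iff _).2 ⟨SimpleGraph.Preconnected.of_subsingleton, ⟨⟨w, rfl⟩⟩⟩
    · simpa using huw.ne
    · simpa using hwv.symm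
  obtain ⟨K, hK⟩ := (Set.toFinite A).exists_maximal hA
  obtain ⟨⟨hKc, u, v, huv, hu, hv⟩, hmax⟩ := hK
  have hext : ∀ x ∈ K, ∀ y, S.Adj x y → (S.induce (K ∪ {y})).Connected := fun x hx y hxy =>
    SimpleGraph.connected_induce_union (v := x) (w := y) hKc.preconnected
      SimpleGraph.Preconnected.of_subsingleton hx rfl hxy
  -- By maximality, a vertex outside `K` with a neighbour in `K` must meet every edge outside `K`.
  have hgrow : ∀ x ∈ K, ∀ y ∉ K, S.Adj x y → ∀ u v, S.Adj u v → u ∉ K → v ∉ K → u ≠ y → v ≠ y → False := by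
    intro x hx y hy hxy u v huv hu hv huy hvy
    have : K ∪ {y} ∈ A := ⟨hext x hx y hxy, u, v, huv, by simp [hu, huy], by simp [hv, hvy]⟩
    exact hy (hmax this Set.subset_union_left (Or.inr rfl))
  obtain ⟨⟨k, hk⟩⟩ := hKc.nonempty
  obtain ⟨d, -, hd1, hd2⟩ := (hS.preconnected k u).some.exists_boundary_dart K hk hu
  have hy : d.snd = u ∨ d.snd = v := by
    by_contra hcon
    push Not at hcon
    exact hgrow _ hd1 _ hd2 d.adj u v huv hu hv hcon.1.symm hcon.2.symm
  refine ⟨u, v, huv, ?_⟩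
  have hKeq : K = {u, v}ᶜ := by
    refine Set.Subset.antisymm (fun x hx => ?_) fun w hw => ?_
    · rintro (rfl | rfl)
      · exact hu hx
      · exact hv hx
    · by_contra hwK
      simp only [Set.mem_compl_iff, Set.mem_insert_iff, Set.mem_singleton_iff, not_or] at hw
      have hwd : w ≠ d.snd := by rcases hy with h | h <;> rw [h]; exacts [hw.1, hw.2]
      obtain ⟨d', -, hd1', -⟩ := (hS.preconnected w u).some.exists_boundary_dart {w} rfl
        (by simpa using Ne.symm hw.1)
      have hadj : S.Adj w d'.snd := by
        have := d'.adj
        rwa [show d'.fst = w from hd1'] at this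
      -- A further vertex `w` outside `K` has a neighbour `z` other than `d.snd`, as there are no
      -- leaves. If `z ∈ K`, the edge `u v` should meet `w`; if not, the edge `w z` should meet
      -- `d.snd`.
      obtain ⟨z, hz, hwz⟩ : ∃ z, z ≠ d.snd ∧ S.Adj w z := by
        by_cases h : d'.snd = d.snd
        · exact hdeg w d.snd (h ▸ hadj)
        · exact ⟨_, h, hadj⟩
      have hzK : z ∉ K := fun hzK => hgrow z hzK w hwK hwz.symm u v huv hu hv (Ne.symm hw.1) (Ne.symm hw.2)
      exact hgrow _ hd1 _ hd2 d.adj w z hwz hwK hzK hwd hz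
  rwa [← hKeq]

namespace StrandedGraph

variable {D : ℕ}

open StrandEnd Relation

section Connectivity

variable {G : StrandedGraph D}

lemma skeleton_adj {t : G.VT} {p : G.VP} :
    G.skeleton.Adj (Sum.inl (Sum.inl t)) (Sum.inl (Sum.inr p)) ↔ ∃ i, (G.pairing (t, i)).1 = p := by
  rw [skeleton, SimpleGraph.fromRel_adj]
  constructor
  · rintro ⟨-, ⟨t', i, h1, h2⟩ | ⟨t', i, h1, h2⟩⟩
    · cases h1
      exact ⟨i, by simpa using h2.symm⟩
    · cases h1
  · rintro ⟨i, rfl⟩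
    exact ⟨by simp, Or.inl ⟨t, i, rfl, rfl⟩⟩

lemma skeleton_adj_cases {x y : (G.VT ⊕ G.VP) ⊕ G.R} (h : G.skeleton.Adj x y) :
    ∃ t i, (x = Sum.inl (Sum.inl t) ∧ y = Sum.inl (Sum.inr (G.pairing (t, i)).1)) ∨
      (y = Sum.inl (Sum.inl t) ∧ x = Sum.inl (Sum.inr (G.pairing (t, i)).1)) := by
  rw [skeleton, SimpleGraph.fromRel_adj] at h
  obtain ⟨-, ⟨t, i, h⟩ | ⟨t, i, h⟩⟩ := h
  · exact ⟨t, i, Or.inl h⟩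
  · exact ⟨t, i, Or.inr h⟩

lemma isConnected_of_map {H : StrandedGraph D} (hG : G.IsConnected)
    (φ : (G.VT ⊕ G.VP) ⊕ G.R → (H.VT ⊕ H.VP) ⊕ H.R) (hφ : Function.Surjective φ)
    (h : ∀ t i, H.skeleton.Adj (φ (Sum.inl (Sum.inl t))) (φ (Sum.inl (Sum.inr (G.pairing (t, i)).1)))) :
    H.IsConnected := by
  refine SimpleGraph.Connected.map (f := (⟨φ, ?_⟩ : G.skeleton →g H.skeleton)) hφ hG
  intro x y hxy
  obtain ⟨t, i, ⟨rfl, rfl⟩ | ⟨rfl, rfl⟩⟩ := skeleton_adj_cases hxy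
  · exact h t i
  · exact (h t i).symm

/-- A connected graph is a single ring or has no rings. -/
lemma IsConnected.ring_or (hG : G.IsConnected) :
    (IsEmpty G.VT ∧ IsEmpty G.VP ∧ ∃ r : G.R, ∀ r', r' = r) ∨ (IsEmpty G.R ∧ Nonempty G.VT) := by
  by_cases hR : Nonempty G.R
  · left
    obtain ⟨r⟩ := hR
    have key : ∀ y, y = (Sum.inr r : (G.VT ⊕ G.VP) ⊕ G.R) := by
      intro y
      by_contra hne
      obtain ⟨d, -, hd1, -⟩ := (hG.preconnected (Sum.inr r) y).some.exists_boundary_dart {Sum.inr r} rfl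
        (by simpa using hne)
      have := d.adj
      rw [show d.fst = _ from hd1] at this
      obtain ⟨t, i, h | h⟩ := skeleton_adj_cases this
      · cases h.1
      · cases h.2
    refine ⟨⟨fun t => ?_⟩, ⟨fun p => ?_⟩, r, fun r' => ?_⟩
    · cases key (Sum.inl (Sum.inl t))
    · cases key (Sum.inl (Sum.inr p))
    · exact Sum.inr.inj (key (Sum.inr r'))
  · right
    rw [not_nonempty_iff] at hR
    refine ⟨hR, ?_⟩
    obtain ⟨(t | p) | r⟩ := hG.nonempty
    · exact ⟨t⟩
    · exact ⟨(G.pairing.symm (p, 0)).1⟩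
    · exact isEmptyElim r

lemma card_VT_eq_card_VP (G : StrandedGraph D) : Nat.card G.VT = Nat.card G.VP := by
  have := Nat.card_congr G.pairing
  rw [Nat.card_prod, Nat.card_prod] at this
  exact Nat.eq_of_mul_eq_mul_right (by simp) this

/-- If all half-edges of `T` are joined to `P`, then conversely. -/
lemma pairing_symm_eq {T : G.VT} {P : G.VP} (h : ∀ i, (G.pairing (T, i)).1 = P) (k : Fin (D + 1)) :
    (G.pairing.symm (P, k)).1 = T := by
  have hinj : Function.Injective fun i => (G.pairing (T, i)).2 := fun i j hij =>
    congrArg Prod.snd (G.pairing.injective (Prod.ext ((h i).trans (h j).symm) hij))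
  obtain ⟨i, hi⟩ := (Finite.injective_iff_surjective.1 hinj) k
  have : G.pairing (T, i) = (P, k) := Prod.ext (h i) hi
  rw [← this]; simp

/-- If all half-edges of `P` are joined to `T`, then conversely. -/
lemma pairing_eq {T : G.VT} {P : G.VP} (h : ∀ k, (G.pairing.symm (P, k)).1 = T) (i : Fin (D + 1)) :
    (G.pairing (T, i)).1 = P := by
  have hinj : Function.Injective fun i => (G.pairing.symm (P, i)).2 := fun i j hij =>
    congrArg Prod.snd (G.pairing.symm.injective (Prod.ext ((h i).trans (h j).symm) hij))
  obtain ⟨k, hk⟩ := (Finite.injective_iff_surjective.1 hinj) i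
  have : G.pairing.symm (P, k) = (T, i) := Prod.ext (h k) hk
  rw [← this]; simp

/-- A connected graph in which all half-edges of a vertex end at the same vertex has no other
vertices. -/
lemma IsConnected.eq_of_forall_pairing (hG : G.IsConnected) {T : G.VT} {P : G.VP}
    (h : ∀ i, (G.pairing (T, i)).1 = P) (t : G.VT) : t = T := by
  by_contra hne
  obtain ⟨d, -, hd1, hd2⟩ := (hG.preconnected (Sum.inl (Sum.inl T)) (Sum.inl (Sum.inl t))).some
    |>.exists_boundary_dart {Sum.inl (Sum.inl T), Sum.inl (Sum.inr P)} (by simp) (by simpa using hne)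
  obtain ⟨t', i, ⟨h1, h2⟩ | ⟨h1, h2⟩⟩ := skeleton_adj_cases d.adj
  · rw [h1] at hd1
    have : t' = T := by simpa using hd1
    subst this
    rw [h2, h i] at hd2
    simp at hd2
  · rw [h2] at hd1
    have h3 : (G.pairing (t', i)).1 = P := by simpa using hd1
    have := pairing_symm_eq h (G.pairing (t', i)).2
    rw [← h3, Prod.mk.eta, Equiv.symm_apply_apply] at this
    rw [h1, show t' = T from this] at hd2
    simp at hd2

/-- Away from `T` and `P` the contraction keeps all edges and only adds some. -/
lemma isConnected_contract {T : G.VT} {P : G.VP} {θ : Equiv.Perm (Fin (D + 1))}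
    (hθ : G.RespectsEdges T P θ)
    (hc : (G.skeleton.induce {Sum.inl (Sum.inl T), Sum.inl (Sum.inr P)}ᶜ).Connected) :
    (contract hθ).IsConnected := by
  let φ : ({Sum.inl (Sum.inl T), Sum.inl (Sum.inr P)}ᶜ : Set ((G.VT ⊕ G.VP) ⊕ G.R)) →
      ((contract hθ).VT ⊕ (contract hθ).VP) ⊕ (contract hθ).R := fun x =>
    match x with
    | ⟨Sum.inl (Sum.inl t), h⟩ => Sum.inl (Sum.inl ⟨t, by rintro rfl; simp at h⟩)
    | ⟨Sum.inl (Sum.inr p), h⟩ => Sum.inl (Sum.inr ⟨p, by rintro rfl; simp at h⟩)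
    | ⟨Sum.inr r, _⟩ => Sum.inr r
  have key : ∀ t i h1 h2, (contract hθ).skeleton.Adj (φ ⟨Sum.inl (Sum.inl t), h1⟩)
      (φ ⟨Sum.inl (Sum.inr (G.pairing (t, i)).1), h2⟩) := by
    intro t i h1 h2
    refine skeleton_adj.2 ⟨i, ?_⟩
    rw [contract_pairing_of_ne hθ (by rintro rfl; simp at h1) (by intro h; simp [h] at h2)]
  refine SimpleGraph.Connected.map (f := (⟨φ, ?_⟩ : G.skeleton.induce _ →g (contract hθ).skeleton)) ?_ hc
  · rintro ⟨x, hx⟩ ⟨y, hy⟩ hxy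
    obtain ⟨t, i, ⟨rfl, rfl⟩ | ⟨rfl, rfl⟩⟩ := skeleton_adj_cases hxy
    · exact key t i hx hy
    · exact (key t i hy hx).symm
  · rintro ((⟨t, ht⟩ | ⟨p, hp⟩) | r)
    · exact ⟨⟨Sum.inl (Sum.inl t), by simpa using ht⟩, rfl⟩
    · exact ⟨⟨Sum.inl (Sum.inr p), by simpa using hp⟩, rfl⟩
    · exact ⟨⟨Sum.inr r, by simp⟩, rfl⟩

/-- A connected graph with more than two vertices has two adjacent vertices whose removal leaves a
connected graph. -/
lemma IsConnected.exists_removable (hG : G.IsConnected) [IsEmpty G.R] (h2 : 2 ≤ Nat.card G.VT) :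
    ∃ T P f, (G.pairing (T, f)).1 = P ∧
      (G.skeleton.induce {Sum.inl (Sum.inl T), Sum.inl (Sum.inr P)}ᶜ).Connected := by
  have hnt : Nontrivial G.VT := Finite.one_lt_card_iff_nontrivial.1 h2
  obtain ⟨T0⟩ := hnt.to_nonempty
  -- A vertex with a single neighbour sends all its half-edges there; the two then form the whole
  -- graph, against the assumed number of vertices.
  have hdeg : ∀ u v, G.skeleton.Adj u v → ∃ w, w ≠ v ∧ G.skeleton.Adj u w := by
    intro u v huv
    by_contra hcon
    push Not at hcon
    obtain ⟨t, i, ⟨rfl, rfl⟩ | ⟨rfl, rfl⟩⟩ := skeleton_adj_cases huv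
    · have : ∀ j, (G.pairing (t, j)).1 = (G.pairing (t, i)).1 := by
        intro j
        by_contra hj
        exact hcon (Sum.inl (Sum.inr (G.pairing (t, j)).1)) (by simpa using hj) (skeleton_adj.2 ⟨j, rfl⟩)
      obtain ⟨t', ht'⟩ := exists_ne t
      exact ht' (hG.eq_of_forall_pairing this t')
    · have : ∀ k, (G.pairing.symm ((G.pairing (t, i)).1, k)).1 = t := by
        intro k
        by_contra hk
        exact hcon (Sum.inl (Sum.inl (G.pairing.symm ((G.pairing (t, i)).1, k)).1)) (by simpa using hk)
          (skeleton_adj.2 ⟨(G.pairing.symm ((G.pairing (t, i)).1, k)).2, by simp⟩).symm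
      obtain ⟨t', ht'⟩ := exists_ne t
      exact ht' (hG.eq_of_forall_pairing (pairing_eq this) t')
  obtain ⟨u, v, huv, hc⟩ := SimpleGraph.Connected.exists_adj_induce_compl_connected hG hdeg
    ⟨_, _, (skeleton_adj (t := T0)).2 ⟨0, rfl⟩⟩
  obtain ⟨t, i, ⟨rfl, rfl⟩ | ⟨rfl, rfl⟩⟩ := skeleton_adj_cases huv
  · exact ⟨t, _, i, rfl, hc⟩
  · refine ⟨t, _, i, rfl, ?_⟩
    rwa [Set.pair_comm]

end Connectivity

/-! ### Melons inside a graph -/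

section IsMelonAt

/-- The edges of `t` other than `a` all go to `p` and are pairwise parallel. -/
def IsMelonAt (G : StrandedGraph D) (t : G.VT) (p : G.VP) (a : Fin (D + 1))
    (θ : Equiv.Perm (Fin (D + 1))) : Prop :=
  ∀ c, c ≠ a → (G.pairing (t, c)).1 = p ∧ G.strands (t, c) = θ

variable {G : StrandedGraph D} {T : G.VT} {P : G.VP} {a : Fin (D + 1)} {θ : Equiv.Perm (Fin (D + 1))}
  (h : G.IsMelonAt T P a θ) (ha : (G.pairing (T, a)).1 ≠ P)
include h

lemma IsMelonAt.pairing {c : Fin (D + 1)} (hc : c ≠ a) : G.pairing (T, c) = (P, θ c) :=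
  Prod.ext (h c hc).1 (by rw [← G.strands_self, (h c hc).2])

include ha

lemma IsMelonAt.respectsEdges : G.RespectsEdges T P θ := by
  intro i hi
  have hia : i ≠ a := by rintro rfl; exact ha hi
  rw [h.pairing hia]

lemma IsMelonAt.parallelAt : G.ParallelAt T P := by
  intro i j hi hj
  have hia : i ≠ a := by rintro rfl; exact ha hi
  have hja : j ≠ a := by rintro rfl; exact ha hj
  rw [h.pairing hja, (h i hia).2]

omit ha in
lemma IsMelonAt.eq_of_pairing {t : G.VT} {i : Fin (D + 1)} (ht : t ≠ T) (hp : (G.pairing (t, i)).1 = P) :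
    (t, i) = G.pairing.symm (P, θ a) := by
  rw [Equiv.eq_symm_apply]
  obtain ⟨c, hc⟩ := θ.surjective (G.pairing (t, i)).2
  have hca : c = a := by
    by_contra hca
    have : G.pairing (T, c) = G.pairing (t, i) := (h.pairing hca).trans (Prod.ext hp.symm hc)
    exact ht (congrArg Prod.fst (G.pairing.injective this)).symm
  exact Prod.ext hp (by rw [← hc, hca])

lemma IsMelonAt.symm_ne : (G.pairing.symm (P, θ a)).1 ≠ T := by
  intro hT
  have h1 : G.pairing (T, (G.pairing.symm (P, θ a)).2) = (P, θ a) := by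
    rw [← hT]; simp
  have := (h.respectsEdges ha).eq_of_pairing h1
  rw [this] at h1
  exact ha (congrArg Prod.fst h1)

/-- A melon can always be contracted: sending `T` and `P` to the two ends of the glued edge maps the
skeleton onto that of the contraction, edges to edges. -/
lemma IsMelonAt.isConnected_contract (hG : G.IsConnected) :
    (contract (h.respectsEdges ha)).IsConnected := by
  classical
  let hθ := h.respectsEdges ha
  let p0 : (contract hθ).VP := ⟨(G.pairing (T, a)).1, ha⟩
  let t0 : (contract hθ).VT := ⟨(G.pairing.symm (P, θ a)).1, h.symm_ne ha⟩
  have h0 : (contract hθ).skeleton.Adj (Sum.inl (Sum.inl t0)) (Sum.inl (Sum.inr p0)) := by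
    obtain ⟨hp, e⟩ := contract_pairing_of_eq hθ (h.symm_ne ha) (k := (G.pairing.symm (P, θ a)).2)
      (l := a) (by simp)
    refine skeleton_adj.2 ⟨(G.pairing.symm (P, θ a)).2, ?_⟩
    rw [e]
  let φT : G.VT → (contract hθ).VT := fun t => if ht : t = T then t0 else ⟨t, ht⟩
  let φP : G.VP → (contract hθ).VP := fun p => if hp : p = P then p0 else ⟨p, hp⟩
  refine isConnected_of_map (H := contract hθ) hG (Sum.map (Sum.map φT φP) id) ?_ ?_
  · rintro ((⟨t, ht⟩ | ⟨p, hp⟩) | r)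
    · exact ⟨Sum.inl (Sum.inl t), congrArg (fun x => Sum.inl (Sum.inl x)) (dif_neg ht)⟩
    · exact ⟨Sum.inl (Sum.inr p), congrArg (fun x => Sum.inl (Sum.inr x)) (dif_neg hp)⟩
    · exact ⟨Sum.inr r, rfl⟩
  · intro t i
    change (contract hθ).skeleton.Adj (Sum.inl (Sum.inl (φT t))) (Sum.inl (Sum.inr (φP (G.pairing (t, i)).1)))
    by_cases ht : t = T
    · have e1 : φT t = t0 := dif_pos ht
      subst ht
      have e2 : φP (G.pairing (t, i)).1 = p0 := by
        by_cases hi : i = a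
        · subst hi; exact dif_neg ha
        · exact dif_pos (h i hi).1
      rw [e1, e2]; exact h0
    · have e1 : φT t = ⟨t, ht⟩ := dif_neg ht
      by_cases hp : (G.pairing (t, i)).1 = P
      · have e2 : φP (G.pairing (t, i)).1 = p0 := dif_pos hp
        have e3 := h.eq_of_pairing ht hp
        have e4 : φT t = t0 := by
          rw [e1]; exact Subtype.ext (congrArg Prod.fst e3)
        rw [e4, e2]; exact h0
      · have e2 : φP (G.pairing (t, i)).1 = ⟨(G.pairing (t, i)).1, hp⟩ := dif_neg hp
        rw [e1, e2]
        exact skeleton_adj.2 ⟨i, congrArg Prod.fst (contract_pairing_of_ne hθ ht hp)⟩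

end IsMelonAt

/-! ### Edges and strands after an insertion -/

section Insertions

variable (G : StrandedGraph D) (t : G.VT) (a : Fin (D + 1))

lemma insertOnEdge_pairing_self :
    (G.insertOnEdge t a).pairing (Sum.inl t, a) = (Sum.inr (), a) := by
  classical
  exact congrArg (addPair G.pairing) (Equiv.swap_apply_left _ _)

lemma insertOnEdge_strands_self : (G.insertOnEdge t a).strands (Sum.inl t, a) = 1 := by
  classical
  exact congrArg (addStrands G.strands fun _ => 1) (Equiv.swap_apply_left _ _)

lemma insertOnEdge_pairing_inr_self : (G.insertOnEdge t a).pairing (Sum.inr (), a) =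
    (Sum.inl (G.pairing (t, a)).1, (G.pairing (t, a)).2) := by
  classical
  exact congrArg (addPair G.pairing) (Equiv.swap_apply_right _ _)

lemma insertOnEdge_strands_inr_self :
    (G.insertOnEdge t a).strands (Sum.inr (), a) = G.strands (t, a) := by
  classical
  exact congrArg (addStrands G.strands fun _ => 1) (Equiv.swap_apply_right _ _)

variable {t a}

lemma insertOnEdge_pairing_of_ne {x : (G.VT ⊕ Unit) × Fin (D + 1)} (h1 : x ≠ (Sum.inl t, a))
    (h2 : x ≠ (Sum.inr (), a)) : (G.insertOnEdge t a).pairing x = addPair G.pairing x := by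
  classical
  exact congrArg (addPair G.pairing) (Equiv.swap_apply_of_ne_of_ne h1 h2)

lemma insertOnEdge_strands_of_ne {x : (G.VT ⊕ Unit) × Fin (D + 1)} (h1 : x ≠ (Sum.inl t, a))
    (h2 : x ≠ (Sum.inr (), a)) :
    (G.insertOnEdge t a).strands x = addStrands G.strands (fun _ => 1) x := by
  classical
  exact congrArg (addStrands G.strands fun _ => 1) (Equiv.swap_apply_of_ne_of_ne h1 h2)

lemma insertOnEdge_pairing_inl {u : G.VT} {i : Fin (D + 1)} (h : (u, i) ≠ (t, a)) :
    (G.insertOnEdge t a).pairing (Sum.inl u, i) =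
      (Sum.inl (G.pairing (u, i)).1, (G.pairing (u, i)).2) :=
  insertOnEdge_pairing_of_ne G (fun h' => h (Prod.ext (Sum.inl_injective (congrArg Prod.fst h'))
    (Prod.ext_iff.1 h').2)) fun h' => Sum.inl_ne_inr (congrArg Prod.fst h')

lemma insertOnEdge_strands_inl {u : G.VT} {i : Fin (D + 1)} (h : (u, i) ≠ (t, a)) :
    (G.insertOnEdge t a).strands (Sum.inl u, i) = G.strands (u, i) :=
  insertOnEdge_strands_of_ne G (fun h' => h (Prod.ext (Sum.inl_injective (congrArg Prod.fst h'))
    (Prod.ext_iff.1 h').2)) fun h' => Sum.inl_ne_inr (congrArg Prod.fst h')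

lemma insertOnEdge_pairing_inr {i : Fin (D + 1)} (h : i ≠ a) :
    (G.insertOnEdge t a).pairing (Sum.inr (), i) = (Sum.inr (), i) :=
  insertOnEdge_pairing_of_ne G (fun h' => Sum.inr_ne_inl (congrArg Prod.fst h'))
    fun h' => h (congrArg Prod.snd h')

lemma insertOnEdge_strands_inr {i : Fin (D + 1)} (h : i ≠ a) :
    (G.insertOnEdge t a).strands (Sum.inr (), i) = 1 :=
  insertOnEdge_strands_of_ne G (fun h' => Sum.inr_ne_inl (congrArg Prod.fst h'))
    fun h' => h (congrArg Prod.snd h')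

variable (r : G.R)

lemma insertOnRing_pairing_inr (i : Fin (D + 1)) :
    (G.insertOnRing r).pairing (Sum.inr (), i) = (Sum.inr (), i) := rfl

lemma insertOnRing_strands_zero :
    (G.insertOnRing r).strands (Sum.inr (), 0) = Equiv.Perm.decomposeFin.symm (0, G.ringPerm r) := by
  have : ∀ x y : Equiv.Perm (Fin (D + 1)), (if (0 : Fin (D + 1)) = 0 then x else y) = x :=
    fun _ _ => if_pos rfl
  exact this _ 1

lemma insertOnRing_strands_inr {i : Fin (D + 1)} (h : i ≠ 0) :
    (G.insertOnRing r).strands (Sum.inr (), i) = 1 := if_neg h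

lemma insertOnRing_strands_inr_of_trivial (h : G.ringPerm r = 1) (i : Fin (D + 1)) :
    (G.insertOnRing r).strands (Sum.inr (), i) = 1 := by
  by_cases hi : i = 0
  · subst hi
    rw [insertOnRing_strands_zero, h]
    ext j
    refine Fin.cases ?_ (fun j => ?_) j <;> simp
  · exact insertOnRing_strands_inr G r hi

end Insertions

/-! ### Melonic graphs are colorable -/

section Colorable

lemma SameGraph.colorable {G H : StrandedGraph D} (h : G.SameGraph H) (hH : H.Colorable) :
    G.Colorable := by
  obtain ⟨eT, eP, eR, ρT, ρP, τ, h1, h2, h3⟩ := h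
  obtain ⟨⟨l, m, hlm⟩, hr⟩ := hH
  refine ⟨⟨fun t => l (eT t) * ρT t, fun p => m (eP p) * ρP p, fun t i j => ?_⟩, fun r => ?_⟩
  · have := hlm (eT t) (ρT t i) (ρT t j)
    rw [h1, h2] at this
    exact this
  · ext1 k
    have := h3 r k
    rw [hr] at this
    exact ((τ r).injective this).symm

/-- The strands between `t` and the inserted pair are parallel, so both new vertices copy the labels
of `t`. -/
lemma Colorable.insertOnEdge {G : StrandedGraph D} (h : G.Colorable) (t : G.VT) (a : Fin (D + 1)) :
    (G.insertOnEdge t a).Colorable := by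
  obtain ⟨⟨l, m, hlm⟩, hr⟩ := h
  refine ⟨⟨Sum.elim l fun _ => l t, Sum.elim m fun _ => l t, ?_⟩, hr⟩
  rintro (u | u) i j
  · by_cases hu : (u, i) = (t, a)
    · obtain ⟨rfl, rfl⟩ := Prod.ext_iff.1 hu
      rw [insertOnEdge_pairing_self, insertOnEdge_strands_self]
      rfl
    · rw [insertOnEdge_pairing_inl G hu, insertOnEdge_strands_inl G hu]
      exact hlm u i j
  · by_cases hi : i = a
    · subst hi
      rw [insertOnEdge_pairing_inr_self, insertOnEdge_strands_inr_self]
      exact hlm t i j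
    · rw [insertOnEdge_pairing_inr G hi, insertOnEdge_strands_inr G hi]
      rfl

lemma Colorable.insertOnRing {G : StrandedGraph D} (h : G.Colorable) (r : G.R) :
    (G.insertOnRing r).Colorable := by
  obtain ⟨⟨l, m, hlm⟩, hr⟩ := h
  refine ⟨⟨Sum.elim l fun _ => 1, Sum.elim m fun _ => 1, ?_⟩, fun r' => hr r'.1⟩
  rintro (u | u) i j
  · exact hlm u i j
  · rw [insertOnRing_pairing_inr, insertOnRing_strands_inr_of_trivial G r (hr r)]
    rfl

lemma IsMelonic.colorable {G : StrandedGraph D} (h : G.IsMelonic) : G.Colorable := by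
  induction h with
  | ring G h => exact h.colorable ⟨⟨fun _ => 1, fun _ => 1, fun t => t.elim⟩, fun _ => rfl⟩
  | onEdge G G' t a _ h ih => exact h.colorable (ih.insertOnEdge t a)
  | onRing G G' r _ h ih => exact h.colorable (ih.insertOnRing r)

end Colorable

/-! ### Melons of melonic graphs, and their reinsertion -/

section Melons

/-- For every edge there are two vertices joined by `D` parallel edges all different from it. -/
def HasMelons (G : StrandedGraph D) : Prop :=
  ∀ t₀ i₀, ∃ t p a θ, G.IsMelonAt t p a θ ∧ ¬ (t₀ = t ∧ i₀ ≠ a)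

lemma SameGraph.hasMelons {G H : StrandedGraph D} (h : G.SameGraph H) (hH : H.HasMelons) :
    G.HasMelons := by
  obtain ⟨eT, eP, eR, ρT, ρP, τ, h1, h2, h3⟩ := h
  intro t₀ i₀
  obtain ⟨t', p', a', θ, hm, hn⟩ := hH (eT t₀) (ρT t₀ i₀)
  obtain ⟨t, rfl⟩ := eT.surjective t'
  obtain ⟨p, rfl⟩ := eP.surjective p'
  obtain ⟨a, rfl⟩ := (ρT t).surjective a'
  refine ⟨t, p, a, (ρP p)⁻¹ * θ * ρT t, fun c hc => ?_, ?_⟩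
  · obtain ⟨k1, k2⟩ := hm (ρT t c) ((ρT t).injective.ne hc)
    rw [h1] at k1
    have k3 : (G.pairing (t, c)).1 = p := eP.injective k1
    refine ⟨k3, ?_⟩
    ext1 j
    have := h2 t c j
    rw [k2, k3] at this
    simp [this]
  · rintro ⟨rfl, hi⟩
    exact hn ⟨rfl, (ρT t₀).injective.ne hi⟩

/-- The freedom to avoid a prescribed edge is what carries the induction. The new melon serves
unless it contains the edge; then a melon of the smaller graph avoiding the place of insertion is
still intact. On a ring all D + 1 new edges are parallel, and any one may be left out. -/
lemma IsMelonic.hasMelons {G : StrandedGraph D} (h : G.IsMelonic) : G.HasMelons := by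
  induction h with
  | ring G h => exact h.hasMelons fun t => t.elim
  | onEdge G G' t a _ h ih =>
    refine h.hasMelons ?_
    intro t₀ i₀
    have new : (G'.insertOnEdge t a).IsMelonAt (Sum.inr ()) (Sum.inr ()) a 1 := fun c hc =>
      ⟨by rw [insertOnEdge_pairing_inr G' hc], insertOnEdge_strands_inr G' hc⟩
    by_cases ht : t₀ = Sum.inr () ∧ i₀ ≠ a
    · obtain ⟨t1, p1, a1, θ, hm, hn⟩ := ih t a
      refine ⟨Sum.inl t1, Sum.inl p1, a1, θ, fun c hc => ?_, fun h => ?_⟩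
      · have hne : (t1, c) ≠ (t, a) := by
          rintro he
          obtain ⟨rfl, rfl⟩ := Prod.ext_iff.1 he
          exact hn ⟨rfl, hc⟩
        rw [insertOnEdge_pairing_inl G' hne, insertOnEdge_strands_inl G' hne]
        exact ⟨congrArg Sum.inl (hm c hc).1, (hm c hc).2⟩
      · rw [ht.1] at h
        cases h.1
    · exact ⟨_, _, _, _, new, ht⟩
  | onRing G G' r hG' h ih =>
    refine h.hasMelons fun t₀ i₀ => ?_
    exact ⟨Sum.inr (), Sum.inr (), i₀, 1, fun c _ => ⟨by rw [insertOnRing_pairing_inr],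
      insertOnRing_strands_inr_of_trivial G' r (hG'.colorable.2 r) c⟩, fun h => h.2 rfl⟩

/-- If `G` has two vertices joined by `D` parallel edges, it arises by inserting them. -/
lemma IsMelonAt.isMelonic {G : StrandedGraph D} {T : G.VT} {P : G.VP} {a : Fin (D + 1)}
    {θ : Equiv.Perm (Fin (D + 1))} (h : G.IsMelonAt T P a θ) (ha : (G.pairing (T, a)).1 ≠ P)
    (hm : (contract (h.respectsEdges ha)).IsMelonic) : G.IsMelonic := by
  classical
  have hθ := h.respectsEdges ha
  set t0 := (G.pairing.symm (P, θ a)).1 with ht0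
  set b := (G.pairing.symm (P, θ a)).2 with hb
  have htb : G.pairing (t0, b) = (P, θ a) := by simp [ht0, hb]
  have ht0T : t0 ≠ T := h.symm_ne ha
  obtain ⟨hp0, q1⟩ := contract_pairing_of_eq hθ ht0T htb
  have q2 := contract_strands_of_eq hθ ht0T htb
  let eT : G.VT ≃ {t // t ≠ T} ⊕ Unit :=
    ⟨fun t => if ht : t = T then Sum.inr () else Sum.inl ⟨t, ht⟩, Sum.elim Subtype.val fun _ => T,
      fun t => by by_cases ht : t = T <;> simp [ht],
      by rintro (t | u); exacts [dif_neg t.2, dif_pos rfl]⟩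
  let eP : G.VP ≃ {p // p ≠ P} ⊕ Unit :=
    ⟨fun p => if hp : p = P then Sum.inr () else Sum.inl ⟨p, hp⟩, Sum.elim Subtype.val fun _ => P,
      fun p => by by_cases hp : p = P <;> simp [hp],
      by rintro (p | u); exacts [dif_neg p.2, dif_pos rfl]⟩
  have eT1 : eT T = Sum.inr () := dif_pos rfl
  have eT2 : ∀ {t} (ht : t ≠ T), eT t = Sum.inl ⟨t, ht⟩ := fun ht => dif_neg ht
  have eP1 : eP P = Sum.inr () := dif_pos rfl
  have eP2 : ∀ {p} (hp : p ≠ P), eP p = Sum.inl ⟨p, hp⟩ := fun hp => dif_neg hp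
  -- `insertOnEdge` has parallel strands on the edge from `t0` to the new `P`-vertex and on the
  -- melon edges. Relabelling `P` by `σ` achieves the former, and `T` by `σ * θ` the latter; the
  -- label `a` of the melon becomes `b`.
  set σ := (G.strands (t0, b))⁻¹ with hσ
  have hσa : σ (θ a) = b := by
    rw [hσ, Equiv.Perm.inv_eq_iff_eq, G.strands_self, htb]
  let ρT : G.VT → Equiv.Perm (Fin (D + 1)) := fun t => if t = T then σ * θ else 1
  let ρP : G.VP → Equiv.Perm (Fin (D + 1)) := fun p => if p = P then σ else 1
  have ρT1 : ρT T = σ * θ := if_pos rfl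
  have ρT2 : ∀ {t}, t ≠ T → ρT t = 1 := fun ht => if_neg ht
  have ρP1 : ρP P = σ := if_pos rfl
  have ρP2 : ∀ {p}, p ≠ P → ρP p = 1 := fun hp => if_neg hp
  obtain ⟨pr, hpr⟩ : ∃ pr : ({t // t ≠ T} ⊕ Unit) × Fin (D + 1) → ({p // p ≠ P} ⊕ Unit) × Fin (D + 1),
    ∀ x, ((contract hθ).insertOnEdge ⟨t0, ht0T⟩ b).pairing x = pr x := ⟨_, fun _ => rfl⟩
  obtain ⟨st, hst⟩ : ∃ st : ({t // t ≠ T} ⊕ Unit) × Fin (D + 1) → Equiv.Perm (Fin (D + 1)),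
    ∀ x, ((contract hθ).insertOnEdge ⟨t0, ht0T⟩ b).strands x = st x := ⟨_, fun _ => rfl⟩
  have pr1 : pr (Sum.inr (), b) = (Sum.inl ⟨(G.pairing (T, a)).1, ha⟩, (G.pairing (T, a)).2) :=
    ((hpr _).symm.trans (insertOnEdge_pairing_inr_self _ _ _)).trans
      (congrArg (fun y : {p // p ≠ P} × Fin (D + 1) => (Sum.inl y.1, y.2)) q1)
  have st1 : st (Sum.inr (), b) = G.strands (T, a) * θ⁻¹ * G.strands (t0, b) :=
    ((hst _).symm.trans (insertOnEdge_strands_inr_self _ _ _)).trans q2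
  have pr2 : ∀ {i}, i ≠ b → pr (Sum.inr (), i) = (Sum.inr (), i) := fun hi =>
    (hpr _).symm.trans (insertOnEdge_pairing_inr _ hi)
  have st2 : ∀ {i}, i ≠ b → st (Sum.inr (), i) = 1 := fun hi =>
    (hst _).symm.trans (insertOnEdge_strands_inr _ hi)
  have pr3 : pr (Sum.inl ⟨t0, ht0T⟩, b) = (Sum.inr (), b) :=
    (hpr _).symm.trans (insertOnEdge_pairing_self _ _ _)
  have st3 : st (Sum.inl ⟨t0, ht0T⟩, b) = 1 :=
    (hst _).symm.trans (insertOnEdge_strands_self _ _ _)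
  have hne : ∀ {t i} (ht : t ≠ T), (G.pairing (t, i)).1 ≠ P →
      ((⟨t, ht⟩, i) : {t // t ≠ T} × Fin (D + 1)) ≠ (⟨t0, ht0T⟩, b) := by
    intro t i ht hp he
    obtain ⟨he1, he2⟩ := Prod.ext_iff.1 he
    have he1 : t = t0 := congrArg Subtype.val he1
    have he2 : i = b := he2
    rw [he1, he2, htb] at hp
    exact hp rfl
  have pr4 : ∀ {t i} (ht : t ≠ T) (hp : (G.pairing (t, i)).1 ≠ P),
      pr (Sum.inl ⟨t, ht⟩, i) = (Sum.inl ⟨(G.pairing (t, i)).1, hp⟩, (G.pairing (t, i)).2) :=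
    fun ht hp => ((hpr _).symm.trans (insertOnEdge_pairing_inl _ (hne ht hp))).trans
      (congrArg (fun y : {p // p ≠ P} × Fin (D + 1) => (Sum.inl y.1, y.2))
        (contract_pairing_of_ne hθ ht hp))
  have st4 : ∀ {t i} (ht : t ≠ T), (G.pairing (t, i)).1 ≠ P →
      st (Sum.inl ⟨t, ht⟩, i) = G.strands (t, i) :=
    fun ht hp => ((hst _).symm.trans (insertOnEdge_strands_inl _ (hne ht hp))).trans
      (contract_strands_of_ne hθ ht hp)
  have goal1 : ∀ t i, pr (eT t, ρT t i) =
      (eP (G.pairing (t, i)).1, ρP (G.pairing (t, i)).1 (G.pairing (t, i)).2) := by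
    intro t i
    by_cases ht : t = T
    · rw [ht, eT1, ρT1]
      by_cases hi : i = a
      · rw [hi, Equiv.Perm.mul_apply, hσa, pr1, eP2 ha, ρP2 ha]
        rfl
      · have hne : σ (θ i) ≠ b := by
          rw [← hσa]; exact σ.injective.ne (θ.injective.ne hi)
        rw [Equiv.Perm.mul_apply, pr2 hne, h.pairing hi, eP1, ρP1]
    · rw [eT2 ht, ρT2 ht, Equiv.Perm.one_apply]
      by_cases hp : (G.pairing (t, i)).1 = P
      · obtain ⟨ht', hi'⟩ : t = t0 ∧ i = b := Prod.ext_iff.1 (h.eq_of_pairing ht hp)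
        subst hi'
        simp only [ht']
        rw [pr3, htb, eP1, ρP1, hσa]
      · rw [pr4 ht hp, eP2 hp, ρP2 hp]
        rfl
  have goal2 : ∀ t i j, st (eT t, ρT t i) (ρT t j) =
      ρP (G.pairing (t, i)).1 (G.strands (t, i) j) := by
    intro t i j
    by_cases ht : t = T
    · rw [ht, eT1, ρT1]
      by_cases hi : i = a
      · rw [hi, Equiv.Perm.mul_apply, hσa, st1, ρP2 ha]
        simp [hσ]
      · have hne : σ (θ i) ≠ b := by
          rw [← hσa]; exact σ.injective.ne (θ.injective.ne hi)
        rw [Equiv.Perm.mul_apply, st2 hne, h.pairing hi, ρP1, (h i hi).2]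
        rfl
    · rw [eT2 ht, ρT2 ht, Equiv.Perm.one_apply]
      by_cases hp : (G.pairing (t, i)).1 = P
      · obtain ⟨ht', hi'⟩ : t = t0 ∧ i = b := Prod.ext_iff.1 (h.eq_of_pairing ht hp)
        subst hi'
        simp only [ht']
        rw [st3, htb, ρP1]
        simp [hσ]
      · rw [st4 ht hp, ρP2 hp]
        rfl
  exact IsMelonic.onEdge G (contract hθ) ⟨t0, ht0T⟩ b hm ⟨eT, eP, Equiv.refl _, ρT, ρP, fun _ => 1,
    fun t i => (hpr _).trans (goal1 t i),
    fun t i j => (DFunLike.congr_fun (hst _) _).trans (goal2 t i j), fun _ _ => rfl⟩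

/-- Two vertices joined by `D + 1` parallel edges form a melonic graph. -/
lemma isMelonic_of_parallel {G : StrandedGraph D} [IsEmpty G.R] {T : G.VT} {P : G.VP}
    (hT : ∀ t, t = T) (hP : ∀ p, p = P) (hpar : G.ParallelAt T P) : G.IsMelonic := by
  have hs : ∀ i, G.strands (T, i) = G.strands (T, 0) := by
    intro i
    ext1 j
    rw [hpar i j (hP _) (hP _), hpar 0 j (hP _) (hP _)]
  have uT : Unique G.VT := ⟨⟨T⟩, hT⟩
  have uP : Unique G.VP := ⟨⟨P⟩, hP⟩
  have ring1 : IsMelonic (melonicRing D) := .ring _ ⟨Equiv.refl _, Equiv.refl _, Equiv.refl _,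
    fun _ => 1, fun _ => 1, fun _ => 1, fun t => t.elim, fun t => t.elim, fun _ _ => rfl⟩
  let eT : G.VT ≃ Empty ⊕ Unit := (Equiv.equivPUnit G.VT).trans (Equiv.emptySum Empty Unit).symm
  let eP : G.VP ≃ Empty ⊕ Unit := (Equiv.equivPUnit G.VP).trans (Equiv.emptySum Empty Unit).symm
  have : IsEmpty {r : (melonicRing D).R // r ≠ ()} := ⟨fun r => r.2 rfl⟩
  refine IsMelonic.onRing G (melonicRing D) () ring1 ⟨eT, eP,
    Equiv.equivOfIsEmpty G.R {r : (melonicRing D).R // r ≠ ()},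
    fun _ => G.strands (T, 0), fun _ => 1, fun _ => 1, ?_, ?_, fun r => isEmptyElim r⟩
  · intro t i
    obtain rfl := hT t
    exact (insertOnRing_pairing_inr (melonicRing D) (() : Unit) _).trans
      (Prod.ext rfl (hpar 0 i (hP _) (hP _)))
  · intro t i j
    obtain rfl := hT t
    exact (DFunLike.congr_fun
      (insertOnRing_strands_inr_of_trivial (melonicRing D) (() : Unit) rfl _) _).trans
      (DFunLike.congr_fun (hs i).symm j)

end Melons

/-! ### Melonic graphs reach the bound -/

section LowerBound

instance (G : StrandedGraph D) : Finite G.Face := by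
  have := G.finVT
  have := G.finR
  exact inferInstanceAs (Finite (Quot _))

lemma SameGraph.numFaces_le {G H : StrandedGraph D} (h : G.SameGraph H) :
    H.numFaces ≤ G.numFaces := by
  obtain ⟨eT, eP, eR, ρT, ρP, τ, h1, h2, h3⟩ := h
  let f : G.Strand → H.Strand := Sum.map
    (fun x => ⟨(eT x.1.1, ρT x.1.1 x.1.2.1, ρT x.1.1 x.1.2.2), (ρT x.1.1).injective.ne x.2⟩)
    fun y => (eR y.1, τ y.1 y.2)
  have hend : ∀ x : G.VT × Fin (D + 1) × Fin (D + 1), H.endP (eT x.1, ρT x.1 x.2.1, ρT x.1 x.2.2) =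
      (eP (G.endP x).1, ρP (G.endP x).1 (G.endP x).2.1, ρP (G.endP x).1 (G.endP x).2.2) := by
    rintro ⟨t, i, j⟩
    simp only [endP, h1, h2]
  have hf : ∀ x y, G.Consecutive x y → H.Consecutive (f x) (f y) := by
    rintro _ _ (⟨t, i, j, h⟩ | ⟨x, y, h⟩ | ⟨r, k⟩)
    · exact .cornerT _ _ _ _
    · refine .cornerP _ _ ?_
      rw [hend, hend, h]
    · change H.Consecutive (Sum.inr (eR r, τ r k)) (Sum.inr (eR r, τ r (G.ringPerm r k)))
      rw [← h3]
      exact .ring _ _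
  refine Nat.card_le_card_of_surjective (Quot.map f hf : G.Face → H.Face) ?_
  intro q
  obtain ⟨⟨⟨t, i, j⟩, h⟩ | ⟨r, k⟩, rfl⟩ := Quot.exists_rep q
  · obtain ⟨t, rfl⟩ := eT.surjective t
    obtain ⟨i, rfl⟩ := (ρT t).surjective i
    obtain ⟨j, rfl⟩ := (ρT t).surjective j
    exact ⟨Quot.mk _ (Sum.inl ⟨(t, i, j), fun e => h (congrArg (ρT t) e)⟩), rfl⟩
  · obtain ⟨r, rfl⟩ := eR.surjective r
    obtain ⟨k, rfl⟩ := (τ r).surjective k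
    exact ⟨Quot.mk _ (Sum.inr (r, k)), rfl⟩

lemma SameGraph.card_VT_eq {G H : StrandedGraph D} (h : G.SameGraph H) :
    Nat.card G.VT = Nat.card H.VT := by
  obtain ⟨eT, -⟩ := h
  exact Nat.card_congr eT

variable (G : StrandedGraph D) {a : Fin (D + 1)} {R' : Type}

/-- The unordered pairs of distinct labels different from `a`. -/
abbrev LabelPair (a : Fin (D + 1)) : Type := {s : Sym2 {c : Fin (D + 1) // c ≠ a} // ¬ s.IsDiag}

lemma card_labelPair (a : Fin (D + 1)) : Nat.card (LabelPair a) = D.choose 2 := by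
  rw [Nat.card_eq_fintype_card, Sym2.card_subtype_not_diag]
  simp

variable {G} in
/-- The face through the strand ends `k`, `l` of an inserted vertex whose half-edge `a` carries the
old faces `φ`. -/
def pairFace (φ : {c : Fin (D + 1) // c ≠ a} → G.Face) (k l : Fin (D + 1)) (h : k ≠ l) :
    G.Face ⊕ LabelPair a :=
  if hk : k = a then Sum.inl (φ ⟨l, fun e => h (hk.trans e.symm)⟩)
  else if hl : l = a then Sum.inl (φ ⟨k, hk⟩)
  else Sum.inr ⟨s(⟨k, hk⟩, ⟨l, hl⟩), fun e => h (congrArg Subtype.val (Sym2.mk_isDiag_iff.1 e))⟩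

variable {G}

lemma pairFace_left (φ : {c : Fin (D + 1) // c ≠ a} → G.Face) (l : Fin (D + 1)) (h : a ≠ l) :
    pairFace φ a l h = Sum.inl (φ ⟨l, h.symm⟩) := dif_pos rfl

lemma pairFace_of_ne (φ : {c : Fin (D + 1) // c ≠ a} → G.Face) (k l : Fin (D + 1)) (h : k ≠ l)
    (hk : k ≠ a) (hl : l ≠ a) : pairFace φ k l h = Sum.inr ⟨s(⟨k, hk⟩, ⟨l, hl⟩),
      fun e => h (congrArg Subtype.val (Sym2.mk_isDiag_iff.1 e))⟩ :=
  (dif_neg hk).trans (dif_neg hl)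

lemma pairFace_comm (φ : {c : Fin (D + 1) // c ≠ a} → G.Face) (k l : Fin (D + 1)) (h : k ≠ l) :
    pairFace φ l k h.symm = pairFace φ k l h := by
  by_cases hk : k = a
  · have hl : l ≠ a := fun e => h (hk.trans e.symm)
    subst hk
    rw [pairFace_left]
    exact (dif_neg hl).trans (dif_pos rfl)
  · by_cases hl : l = a
    · subst hl
      rw [pairFace_left]
      exact ((dif_neg hk).trans (dif_pos rfl)).symm
    · rw [pairFace_of_ne φ k l h hk hl, pairFace_of_ne φ l k h.symm hl hk]
      exact congrArg Sum.inr (Subtype.ext Sym2.eq_swap)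

variable (G) in
/-- The strand ends at the `T`-vertices after the addition of one vertex. -/
abbrev NewEnd : Type := {x : (G.VT ⊕ Unit) × Fin (D + 1) × Fin (D + 1) // x.2.1 ≠ x.2.2}

/-- The old face, or the pair of labels of the inserted edges, to which a strand belongs after an
insertion. -/
def liftFace (φ : {c : Fin (D + 1) // c ≠ a} → G.Face) : G.NewEnd → G.Face ⊕ LabelPair a
  | ⟨(Sum.inl u, i, j), h⟩ => Sum.inl (Quot.mk _ (Sum.inl ⟨(u, i, j), h⟩))
  | ⟨(Sum.inr _, i, j), h⟩ => pairFace φ i j h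

/-- `liftFace φ` is determined by the end `E x` at a `P`-vertex of a strand `x`. -/
def EndsMatch (φ : {c : Fin (D + 1) // c ≠ a} → G.Face)
    (E : G.NewEnd → (G.VP ⊕ Unit) × Fin (D + 1) × Fin (D + 1)) : Prop :=
  ∀ x, (∃ x0 : {x : G.VT × Fin (D + 1) × Fin (D + 1) // x.2.1 ≠ x.2.2},
      E x = (Sum.inl (G.endP x0).1, (G.endP x0).2) ∧ liftFace φ x = Sum.inl (Quot.mk _ (Sum.inl x0))) ∨
    ∃ k l, ∃ h : k ≠ l, E x = (Sum.inr (), k, l) ∧ liftFace φ x = pairFace φ k l h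

lemma EndsMatch.eq {φ : {c : Fin (D + 1) // c ≠ a} → G.Face}
    {E : G.NewEnd → (G.VP ⊕ Unit) × Fin (D + 1) × Fin (D + 1)} (hE : EndsMatch φ E) {x y : G.NewEnd}
    (h : E y = ((E x).1, (E x).2.2, (E x).2.1)) : liftFace φ x = liftFace φ y := by
  rcases hE x with ⟨x0, hx1, hx2⟩ | ⟨k, l, hkl, hx1, hx2⟩ <;>
    rcases hE y with ⟨y0, hy1, hy2⟩ | ⟨k', l', hkl', hy1, hy2⟩ <;> rw [hx1, hy1] at h
  · rw [hx2, hy2]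
    refine congrArg Sum.inl (Quot.sound (.cornerP _ _ ?_))
    simp only [Prod.mk.injEq, Sum.inl.injEq] at h
    exact Prod.ext h.1 h.2
  · simp at h
  · simp at h
  · simp only [Prod.mk.injEq, true_and] at h
    obtain ⟨rfl, rfl⟩ := h
    rw [hx2, hy2, pairFace_comm]

lemma liftFace_swap (φ : {c : Fin (D + 1) // c ≠ a} → G.Face) (t : G.VT ⊕ Unit) (i j : Fin (D + 1))
    (h : i ≠ j) : liftFace φ ⟨(t, i, j), h⟩ = liftFace φ ⟨(t, j, i), h.symm⟩ := by
  rcases t with u | u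
  · exact congrArg Sum.inl (Quot.sound (.cornerT _ _ _ _))
  · exact (pairFace_comm φ i j h).symm

lemma exists_liftFace_eq_inr (φ : {c : Fin (D + 1) // c ≠ a} → G.Face) (s : LabelPair a) :
    ∃ x, liftFace φ x = Sum.inr s := by
  obtain ⟨s, hs⟩ := s
  induction s using Sym2.ind with
  | _ k l =>
    have h : k.1 ≠ l.1 := fun e => hs (Sym2.mk_isDiag_iff.2 (Subtype.ext e))
    exact ⟨⟨(Sum.inr (), k.1, l.1), h⟩, pairFace_of_ne φ _ _ h k.2 l.2⟩

/-- The faces of the new graph are mapped onto the old faces and the pairs of labels other than `a`.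
The corner of a new vertex between `a` and `c` lies on the old face through the strand `c` of the
cut edge; a corner between two parallel edges gives a pair. Only surjectivity is needed. -/
lemma numFaces_add_le_insertOnEdge (t : G.VT) (a : Fin (D + 1)) :
    G.numFaces + D.choose 2 ≤ (G.insertOnEdge t a).numFaces := by
  let φ : {c : Fin (D + 1) // c ≠ a} → G.Face := fun c =>
    Quot.mk _ (Sum.inl ⟨(t, a, c.1), c.2.symm⟩)
  have hE : EndsMatch φ fun x => (G.insertOnEdge t a).endP x.1 := by
    rintro ⟨⟨u | ⟨⟩, i, j⟩, hij⟩
    · by_cases hu : (u, i) = (t, a)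
      · obtain ⟨rfl, rfl⟩ := Prod.ext_iff.1 hu
        refine Or.inr ⟨i, j, hij, ?_, ?_⟩
        · simp only [endP]
          rw [insertOnEdge_pairing_self, insertOnEdge_strands_self]
          rfl
        · rw [pairFace_left]
          rfl
      · refine Or.inl ⟨⟨(u, i, j), hij⟩, ?_, rfl⟩
        simp only [endP]
        rw [insertOnEdge_pairing_inl G hu, insertOnEdge_strands_inl G hu]
        rfl
    · by_cases hi : i = a
      · subst hi
        refine Or.inl ⟨⟨(t, i, j), hij⟩, ?_, ?_⟩
        · simp only [endP]
          rw [insertOnEdge_pairing_inr_self, insertOnEdge_strands_inr_self]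
          rfl
        · exact pairFace_left φ j hij
      · refine Or.inr ⟨i, j, hij, ?_, rfl⟩
        simp only [endP]
        rw [insertOnEdge_pairing_inr G hi, insertOnEdge_strands_inr G hi]
        rfl
  let g : (G.insertOnEdge t a).Strand → G.Face ⊕ LabelPair a :=
    Sum.elim (liftFace φ) fun y => Sum.inl (Quot.mk _ (Sum.inr y))
  have hg : ∀ x y, (G.insertOnEdge t a).Consecutive x y → g x = g y := by
    rintro _ _ (⟨t, i, j, h⟩ | ⟨x, y, h⟩ | ⟨r, k⟩)
    · exact liftFace_swap φ _ _ _ h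
    · exact hE.eq h
    · exact congrArg Sum.inl (Quot.sound (.ring _ _))
  have := Nat.card_le_card_of_surjective (Quot.lift g hg : (G.insertOnEdge t a).Face → _) ?_
  · rwa [Nat.card_sum, card_labelPair] at this
  · rintro (q | s)
    on_goal 1 => obtain ⟨⟨⟨u, i, j⟩, h⟩ | y, rfl⟩ := Quot.exists_rep q
    · exact ⟨Quot.mk _ (Sum.inl ⟨(Sum.inl u, i, j), h⟩), rfl⟩
    · exact ⟨Quot.mk _ (Sum.inr y), rfl⟩
    · obtain ⟨x, hx⟩ := exists_liftFace_eq_inr φ s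
      exact ⟨Quot.mk _ (Sum.inl x), hx⟩

lemma numFaces_add_le_insertOnRing (r : G.R) :
    G.numFaces + D.choose 2 ≤ (G.insertOnRing r).numFaces := by
  let φ : {c : Fin (D + 1) // c ≠ 0} → G.Face := fun c =>
    Quot.mk _ (Sum.inr (r, c.1.pred c.2))
  have hE : EndsMatch φ fun x => (G.insertOnRing r).endP x.1 := by
    rintro ⟨⟨u | ⟨⟩, i, j⟩, hij⟩
    · exact Or.inl ⟨⟨(u, i, j), hij⟩, rfl, rfl⟩
    · by_cases hi : i = 0
      · subst hi
        obtain ⟨k, rfl⟩ := Fin.exists_succ_eq.2 hij.symm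
        refine Or.inr ⟨0, (G.ringPerm r k).succ, (Fin.succ_ne_zero _).symm, ?_, ?_⟩
        · simp only [endP]
          rw [insertOnRing_pairing_inr, insertOnRing_strands_zero]
          simp only [Equiv.Perm.decomposeFin_symm_apply_succ, Equiv.swap_self, Equiv.refl_apply]
          rfl
        · rw [pairFace_left]
          refine (pairFace_left φ _ hij).trans (congrArg Sum.inl ?_)
          -- The two ends of this strand carry the labels of `k` and of its image under the ring
          -- permutation, which lie on the same old face.
          exact Quot.sound (.ring r k)
      · refine Or.inr ⟨i, j, hij, ?_, rfl⟩
        simp only [endP]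
        rw [insertOnRing_pairing_inr, insertOnRing_strands_inr G r hi]
        rfl
  let g : (G.insertOnRing r).Strand → G.Face ⊕ LabelPair (0 : Fin (D + 1)) :=
    Sum.elim (liftFace φ) fun y => Sum.inl (Quot.mk _ (Sum.inr (y.1.1, y.2)))
  have hg : ∀ x y, (G.insertOnRing r).Consecutive x y → g x = g y := by
    rintro _ _ (⟨t, i, j, h⟩ | ⟨x, y, h⟩ | ⟨r, k⟩)
    · exact liftFace_swap φ _ _ _ h
    · exact hE.eq h
    · exact congrArg Sum.inl (Quot.sound (.ring _ _))
  have := Nat.card_le_card_of_surjective (Quot.lift g hg : (G.insertOnRing r).Face → _) ?_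
  · rwa [Nat.card_sum, card_labelPair] at this
  · rintro (q | s)
    on_goal 1 => obtain ⟨⟨⟨u, i, j⟩, h⟩ | ⟨r', k⟩, rfl⟩ := Quot.exists_rep q
    · exact ⟨Quot.mk _ (Sum.inl ⟨(Sum.inl u, i, j), h⟩), rfl⟩
    · by_cases hr : r' = r
      · subst hr
        exact ⟨Quot.mk _ (Sum.inl ⟨(Sum.inr (), 0, k.succ), (Fin.succ_ne_zero k).symm⟩),
          pairFace_left φ k.succ (Fin.succ_ne_zero k).symm⟩
      · exact ⟨Quot.mk _ (Sum.inr (⟨r', hr⟩, k)), rfl⟩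
    · obtain ⟨x, hx⟩ := exists_liftFace_eq_inr φ s
      exact ⟨Quot.mk _ (Sum.inl x), hx⟩

lemma le_numFaces_melonicRing : D ≤ (melonicRing D).numFaces := by
  let g : (melonicRing D).Strand → Fin D := Sum.elim (fun x => x.1.1.elim) Prod.snd
  have hg : ∀ x y, (melonicRing D).Consecutive x y → g x = g y := by
    rintro _ _ (⟨t, i, j, h⟩ | ⟨⟨⟨t, x⟩, hx⟩, y, h⟩ | ⟨r, k⟩)
    · exact t.elim
    · exact t.elim
    · rfl
  have := Nat.card_le_card_of_surjective (Quot.lift g hg : (melonicRing D).Face → _)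
    fun k => ⟨Quot.mk _ (Sum.inr ((), k)), rfl⟩
  rwa [Nat.card_fin] at this

lemma IsMelonic.le_numFaces {G : StrandedGraph D} (h : G.IsMelonic) :
    D + Nat.card G.VT * D.choose 2 ≤ G.numFaces := by
  have succ : ∀ G : StrandedGraph D, Nat.card (G.VT ⊕ Unit) = Nat.card G.VT + 1 := fun G => by
    have := G.finVT
    rw [Nat.card_sum, Nat.card_unique (α := Unit)]
  induction h with
  | ring G h =>
    refine le_trans ?_ (le_numFaces_melonicRing.trans h.numFaces_le)
    have : Nat.card (melonicRing D).VT = 0 := Nat.card_of_isEmpty (α := Empty)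
    rw [h.card_VT_eq, this, zero_mul, add_zero]
  | onEdge G G' t a _ h ih =>
    refine le_trans ?_ ((numFaces_add_le_insertOnEdge t a).trans h.numFaces_le)
    have : Nat.card (G'.insertOnEdge t a).VT = _ := succ G'
    rw [h.card_VT_eq, this, add_mul, one_mul, ← add_assoc]
    exact Nat.add_le_add_right ih _
  | onRing G G' r _ h ih =>
    refine le_trans ?_ ((numFaces_add_le_insertOnRing r).trans h.numFaces_le)
    have : Nat.card (G'.insertOnRing r).VT = _ := succ G'
    rw [h.card_VT_eq, this, add_mul, one_mul, ← add_assoc]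
    exact Nat.add_le_add_right ih _

end LowerBound

lemma perm_eq_of_forall_ne {α : Type*} {σ τ : Equiv.Perm α} (a : α) (h : ∀ x, x ≠ a → σ x = τ x) :
    σ = τ := by
  ext1 x
  by_cases hx : x = a
  · subst hx
    obtain ⟨y, hy⟩ := τ.surjective (σ x)
    by_cases hyx : y = x
    · rw [← hy, hyx]
    · rw [← h y hyx] at hy
      exact absurd (σ.injective hy) hyx
  · exact h x hx

/-! ### From melons of the contraction to melons of the graph -/

section Melons

/-- A corner of a melon between its parallel edges lies on a face with two strands. -/
lemma IsMelonAt.eq_or_of_onSameFace {G : StrandedGraph D} {t : G.VT} {p : G.VP} {a : Fin (D + 1)}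
    {ψ : Equiv.Perm (Fin (D + 1))} (h : G.IsMelonAt t p a ψ) {c l : Fin (D + 1)} (hcl : c ≠ l)
    (hc : c ≠ a) (hl : l ≠ a) {w : StrandEnd G.VT D} (hw : G.OnSameFace ⟨(t, c, l), hcl⟩ w) :
    w = ⟨(t, c, l), hcl⟩ ∨ w = ⟨(t, l, c), hcl.symm⟩ := by
  have e : ∀ {x y : Fin (D + 1)} (hxy : x ≠ y), x ≠ a →
      G.strandEquiv ⟨(t, x, y), hxy⟩ = ⟨(p, ψ x, ψ y), ψ.injective.ne hxy⟩ := fun hxy hx =>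
    (strandEquiv_eq_iff _).2 ⟨h.pairing hx, by rw [(h _ hx).2]⟩
  refine (hw.mem_of_closed (p := fun w => w = ⟨(t, c, l), hcl⟩ ∨ w = ⟨(t, l, c), hcl.symm⟩)
    corner_involutive corner_involutive ?_ ?_).1 (Or.inl rfl)
  · rintro _ (rfl | rfl)
    · exact Or.inr rfl
    · exact Or.inl rfl
  · rintro _ b (rfl | rfl) hb
    · rw [e hcl hc] at hb
      exact Or.inr (G.strandEquiv.injective (hb.trans (e hcl.symm hl).symm))
    · rw [e hcl.symm hl] at hb
      exact Or.inl (G.strandEquiv.injective (hb.trans (e hcl hc).symm))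

variable {G : StrandedGraph D} {T : G.VT} {P : G.VP} {θ : Equiv.Perm (Fin (D + 1))}

/-- Two vertices joined by all but one of their edges, which are parallel, form a melon. -/
lemma ParallelAt.isMelonAt (hθ : G.RespectsEdges T P θ) (hpar : G.ParallelAt T P) {a : Fin (D + 1)}
    (ha : ∀ c, c ≠ a → (G.pairing (T, c)).1 = P) : G.IsMelonAt T P a θ := fun c hc =>
  ⟨ha c hc, perm_eq_of_forall_ne a fun x hx => by rw [hpar c x (ha c hc) (ha x hx), hθ x (ha x hx)]⟩

variable (hθ : G.RespectsEdges T P θ)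

/-- A melon of `contract hθ` none of whose parallel edges was created by the contraction. -/
lemma IsMelonAt.of_contract {t : {t // t ≠ T}} {p : {p // p ≠ P}} {a : Fin (D + 1)}
    {ψ : Equiv.Perm (Fin (D + 1))} (h : (contract hθ).IsMelonAt t p a ψ)
    (hP : ∀ c, c ≠ a → (G.pairing (t.1, c)).1 ≠ P) : G.IsMelonAt t.1 p.1 a ψ := by
  intro c hc
  obtain ⟨h1, h2⟩ := h c hc
  have e1 := contract_pairing_of_ne hθ t.2 (hP c hc)
  have e2 := contract_strands_of_ne hθ t.2 (hP c hc)
  exact ⟨congrArg Subtype.val ((congrArg Prod.fst e1).symm.trans h1), e2.symm.trans h2⟩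

/-- In `contract hθ`, the strand `u` of the edge through the half-edge `i` and the strand `u'` of the
edge through the half-edge `j` of the removed vertices lie on the same face. -/
def Linked (i u j u' : Fin (D + 1)) : Prop :=
  ∀ (t t' : {t // t ≠ T}) (k x k' x' : Fin (D + 1)) (h : k ≠ x) (h' : k' ≠ x'),
    G.pairing (t.1, k) = (P, θ i) → G.strands (t.1, k) x = θ u →
    G.pairing (t'.1, k') = (P, θ j) → G.strands (t'.1, k') x' = θ u' →
    (contract hθ).OnSameFace ⟨(t, k, x), h⟩ ⟨(t', k', x'), h'⟩

include hθ in
lemma exists_half_edge {i : Fin (D + 1)} (hi : (G.pairing (T, i)).1 ≠ P) :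
    ∃ (t : {t // t ≠ T}) (k : Fin (D + 1)), G.pairing (t.1, k) = (P, θ i) := by
  refine ⟨⟨(G.pairing.symm (P, θ i)).1, fun hT => ?_⟩, (G.pairing.symm (P, θ i)).2, by simp⟩
  have h1 : G.pairing (T, (G.pairing.symm (P, θ i)).2) = (P, θ i) := by
    rw [← hT]; simp
  have := hθ.eq_of_pairing h1
  rw [this] at h1
  exact hi (congrArg Prod.fst h1)

include hθ in
lemma exists_leg_of_pairing {t : {t // t ≠ T}} {c : Fin (D + 1)} (hc : (G.pairing (t.1, c)).1 = P) :
    ∃ i, (G.pairing (T, i)).1 ≠ P ∧ G.pairing (t.1, c) = (P, θ i) :=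
  ⟨_, hθ.pairing_ne t.2 hc, Prod.ext hc (by simp)⟩

lemma exists_strand {t : G.VT} {k i u : Fin (D + 1)} (h : G.pairing (t, k) = (P, θ i)) (hu : i ≠ u) :
    ∃ x, k ≠ x ∧ G.strands (t, k) x = θ u := by
  refine ⟨(G.strands (t, k)).symm (θ u), fun hk => hu (θ.injective ?_), by simp⟩
  rw [Equiv.eq_symm_apply, G.strands_self, h] at hk
  exact hk

section Links

variable {hθ} {i u j u' : Fin (D + 1)} (hL : Linked hθ i u j u') (hij : i ≠ j) (hiu : i ≠ u)
  (hju : j ≠ u')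
include hL hij hiu hju

/-- Different corners of a vertex of a colorable graph lie on different faces, so two linked strand
ends at one vertex must be the two ends of a single corner. -/
lemma Linked.strands_eq (hcol : (contract hθ).Colorable) {t : {t // t ≠ T}} {k k' : Fin (D + 1)}
    (hk : G.pairing (t.1, k) = (P, θ i)) (hk' : G.pairing (t.1, k') = (P, θ j)) :
    G.strands (t.1, k) k' = θ u ∧ G.strands (t.1, k') k = θ u' := by
  obtain ⟨x, hx, ex⟩ := exists_strand hk hiu
  obtain ⟨x', hx', ex'⟩ := exists_strand hk' hju
  rcases hcol.of_onSameFace (G := contract hθ) (t := t) hx hx' (hL t t k x k' x' hx hx' hk ex hk' ex')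
    with h | h
  · rw [h.1, hk'] at hk
    exact absurd (θ.injective (congrArg Prod.snd hk)).symm hij
  · obtain ⟨rfl, rfl⟩ := h
    exact ⟨ex, ex'⟩

/-- The face of an inner corner of a melon has no strand ends at `T`-vertices besides the two of
that corner. The linked strand, on the edge through `j`, must therefore be the second one. -/
lemma Linked.pairing_eq (hj : (G.pairing (T, j)).1 ≠ P) {t : {t // t ≠ T}} {p : {p // p ≠ P}}
    {a : Fin (D + 1)} {ψ : Equiv.Perm (Fin (D + 1))} (h : (contract hθ).IsMelonAt t p a ψ)
    {c l : Fin (D + 1)} (hca : c ≠ a) (hla : l ≠ a) (hc : G.pairing (t.1, c) = (P, θ i))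
    (hl : G.strands (t.1, c) l = θ u) : G.pairing (t.1, l) = (P, θ j) := by
  have hcl : c ≠ l := by
    rintro rfl
    rw [G.strands_self, hc] at hl
    exact hiu (θ.injective hl)
  obtain ⟨t', k', hk'⟩ := exists_half_edge hθ hj
  obtain ⟨x', hx', ex'⟩ := exists_strand hk' hju
  rcases h.eq_or_of_onSameFace hcl hca hla (hL t t' c l k' x' hcl hx' hc hl hk' ex') with e | e
  · obtain ⟨e1, e2, -⟩ := StrandEnd.eq_iff.1 e
    have e1 : t' = t := e1
    have e2 : k' = c := e2
    rw [e1, e2, hc] at hk'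
    exact absurd (θ.injective (congrArg Prod.snd hk')) hij
  · obtain ⟨e1, e2, -⟩ := StrandEnd.eq_iff.1 e
    have e1 : t' = t := e1
    have e2 : k' = l := e2
    rwa [e1, e2] at hk'

end Links

section Equality

variable {f : Fin (D + 1)} (hpar : G.ParallelAt T P) (hf : (G.pairing (T, f)).1 = P)
  (hfθ : G.strands (T, f) = θ) [IsEmpty G.R]
  (heq : (contract hθ).numFaces + (D + 1).choose 2 ≤ G.numFaces + D)
include hpar hf hfθ heq

lemma linked_legs {i j : Fin (D + 1)} (hij : i ≠ j) (hi : (G.pairing (T, i)).1 ≠ P)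
    (hj : (G.pairing (T, j)).1 ≠ P) : Linked hθ i j j i := fun t t' k x k' x' h h' hk ex hk' ex' =>
  onSameFace_of_legs hθ hpar hf hfθ ⟨i, hi⟩ heq hij hi hj
    (z := ⟨(t, k, x), h⟩) (w := ⟨(t', k', x'), h'⟩)
    ((strandEquiv_eq_iff _).2 ⟨hk, ex⟩) ((strandEquiv_eq_iff _).2 ⟨hk', ex'⟩)

lemma linked_common {c i j : Fin (D + 1)} (hij : i ≠ j) (hi : (G.pairing (T, i)).1 ≠ P)
    (hj : (G.pairing (T, j)).1 ≠ P) (hc : (G.pairing (T, c)).1 = P) (hcf : c ≠ f) (hic : i ≠ c)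
    (hjc : j ≠ c) : Linked hθ i c j c := fun t t' k x k' x' h h' hk ex hk' ex' =>
  onSameFace_of_common hθ hpar hf hfθ ⟨i, hi⟩ heq hij hi hj hc hcf hic hjc
    (z := ⟨(t, k, x), h⟩) (w := ⟨(t', k', x'), h'⟩)
    ((strandEquiv_eq_iff _).2 ⟨hk, ex⟩) ((strandEquiv_eq_iff _).2 ⟨hk', ex'⟩)

/-- If the contraction of at least two parallel edges gives a melonic graph and loses as many faces
as possible, a melon of the contraction is a melon of the graph. -/
lemma exists_isMelonAt_of_common (hcol : (contract hθ).Colorable) {i₀ j₀ c : Fin (D + 1)}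
    (hij₀ : i₀ ≠ j₀) (hi₀ : (G.pairing (T, i₀)).1 ≠ P) (hj₀ : (G.pairing (T, j₀)).1 ≠ P)
    (hc : (G.pairing (T, c)).1 = P) (hcf : c ≠ f)
    {t : {t // t ≠ T}} {p : {p // p ≠ P}} {a : Fin (D + 1)} {ψ : Equiv.Perm (Fin (D + 1))}
    (h : (contract hθ).IsMelonAt t p a ψ) : G.IsMelonAt t.1 p.1 a ψ := by
  refine h.of_contract hθ fun d hda hd => ?_
  obtain ⟨i, hi, hdi⟩ := exists_leg_of_pairing hθ hd
  obtain ⟨j, hij, hj⟩ : ∃ j, i ≠ j ∧ (G.pairing (T, j)).1 ≠ P := by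
    by_cases h : i = i₀
    · exact ⟨j₀, h ▸ hij₀, hj₀⟩
    · exact ⟨i₀, h, hi₀⟩
  have hic : i ≠ c := by rintro rfl; exact hi hc
  have hjc : j ≠ c := by rintro rfl; exact hj hc
  have L1 := linked_legs hθ hpar hf hfθ heq hij hi hj
  have L2 := linked_common hθ hpar hf hfθ heq hij hi hj hc hcf hic hjc
  -- The strands `x` and `y` lead to the strand ends `j` and `c` at `P`. They differ, so at least
  -- one is not `a` and forms an inner melon corner with `d`; its link then brings the edge through
  -- `j` to `t`.
  obtain ⟨x, -, ex⟩ := exists_strand hdi hij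
  obtain ⟨y, -, ey⟩ := exists_strand hdi hic
  have hxy : x ≠ y := by
    rintro rfl
    exact hjc (θ.injective (ex.symm.trans ey))
  obtain ⟨l, hl⟩ : ∃ l, G.pairing (t.1, l) = (P, θ j) := by
    by_cases hxa : x = a
    · exact ⟨y, L2.pairing_eq hij hic hjc hj h hda (fun hya => hxy (hxa.trans hya.symm)) hdi ey⟩
    · exact ⟨x, L1.pairing_eq hij hij hij.symm hj h hda hxa hdi ex⟩
  -- The two links make contradictory demands on the strand `d` of that edge: it should lead to `θ
  -- i` and to `θ c`.
  have e1 := (L1.strands_eq hij hij hij.symm hcol hdi hl).2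
  have e2 := (L2.strands_eq hij hic hjc hcol hdi hl).2
  exact hic (θ.injective (e1.symm.trans e2))

/-- For a single common edge, a melon of the contraction which avoids one new edge is a melon of the
graph or all other new edges share a vertex. -/
lemma isMelonAt_or_of_hasMelons (hmel : (contract hθ).HasMelons) {i₀ : Fin (D + 1)}
    (hi₀ : (G.pairing (T, i₀)).1 ≠ P) : (∃ t p a ψ, G.IsMelonAt t p a ψ) ∨
    ∃ t : {t // t ≠ T}, ∀ j, j ≠ i₀ → (G.pairing (T, j)).1 ≠ P →
      ∃ k, G.pairing (t.1, k) = (P, θ j) := by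
  obtain ⟨t₀, k₀, h₀⟩ := exists_half_edge hθ hi₀
  obtain ⟨t, p, a, ψ, h, hn⟩ := hmel t₀ k₀
  by_cases hP : ∀ c, c ≠ a → (G.pairing (t.1, c)).1 ≠ P
  · exact Or.inl ⟨_, _, _, _, IsMelonAt.of_contract hθ (t := t) (p := p) h hP⟩
  push Not at hP
  obtain ⟨d, hda, hd⟩ := hP
  obtain ⟨i, hi, hdi⟩ := exists_leg_of_pairing hθ (t := t) hd
  have hne : ∀ l, l ≠ a → G.pairing (t.1, l) ≠ (P, θ i₀) := by
    intro l hl he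
    have := G.pairing.injective (h₀.trans he.symm)
    obtain ⟨e1, e2⟩ := Prod.ext_iff.1 this
    have e2 : k₀ = l := e2
    exact hn ⟨Subtype.ext e1, e2 ▸ hl⟩
  have hii₀ : i ≠ i₀ := by
    rintro rfl
    exact hne d hda hdi
  obtain ⟨x₀, -, ex₀⟩ := exists_strand hdi hii₀
  -- Otherwise the link would make the edge through `i₀` one of the parallel edges, although the
  -- melon was chosen to avoid it.
  have hx₀ : x₀ = a := by
    by_contra hx
    exact hne x₀ hx ((linked_legs hθ hpar hf hfθ heq hii₀ hi hi₀).pairing_eq hii₀ hii₀ hii₀.symm hi₀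
      (t := t) (p := p) h hda hx hdi ex₀)
  refine Or.inr ⟨t, fun j hj₀ hj => ?_⟩
  by_cases hij : i = j
  · exact ⟨d, hij ▸ hdi⟩
  obtain ⟨x, -, ex⟩ := exists_strand hdi hij
  refine ⟨x, (linked_legs hθ hpar hf hfθ heq hij hi hj).pairing_eq hij hij (Ne.symm hij) hj
      (t := t) (p := p) h hda ?_ hdi ex⟩
  intro hxa
  rw [hxa, ← hx₀, ex₀] at ex
  exact hj₀ (θ.injective ex).symm

/-- Avoiding two different legs gives, unless a melon is found, two vertices, each joined to `P` by
the edges of all legs but the avoided one. A third leg, available as D ≥ 3, shows that they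
coincide. So one vertex shares D edges with `P`, and the links make them parallel. -/
lemma exists_isMelonAt_of_forall_ne (hD : 3 ≤ D) (hcol : (contract hθ).Colorable)
    (hmel : (contract hθ).HasMelons) (hleg : ∀ i, i ≠ f → (G.pairing (T, i)).1 ≠ P) :
    ∃ t p a ψ, G.IsMelonAt t p a ψ := by
  classical
  obtain ⟨s, hs, hs3⟩ := Finset.exists_subset_card_eq (s := Finset.univ.erase f) (n := 3) (by simpa using hD)
  obtain ⟨i₁, i₂, i₃, h12, h13, h23, rfl⟩ := Finset.card_eq_three.1 hs3
  have m1 : i₁ ≠ f := by have := @hs i₁ (by simp); simpa using this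
  have m2 : i₂ ≠ f := by have := @hs i₂ (by simp); simpa using this
  have m3 : i₃ ≠ f := by have := @hs i₃ (by simp); simpa using this
  rcases isMelonAt_or_of_hasMelons hθ hpar hf hfθ heq hmel (hleg i₁ m1) with h | ⟨t, ht⟩
  · exact h
  rcases isMelonAt_or_of_hasMelons hθ hpar hf hfθ heq hmel (hleg i₂ m2) with h | ⟨t', ht'⟩
  · exact h
  have htt : t' = t := by
    obtain ⟨k, hk⟩ := ht i₃ h13.symm (hleg _ m3)
    obtain ⟨k', hk'⟩ := ht' i₃ h23.symm (hleg _ m3)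
    exact Subtype.ext (congrArg Prod.fst (G.pairing.injective (hk'.trans hk.symm)))
  have hall : ∀ j : {j // j ≠ f}, ∃ k, G.pairing (t.1, k) = (P, θ j.1) := by
    intro j
    by_cases h : j.1 = i₁
    · rw [← htt]
      exact ht' j.1 (h ▸ h12) (hleg _ j.2)
    · exact ht j.1 h (hleg _ j.2)
  choose k hk using hall
  have hkinj : Function.Injective k := by
    intro i j hij
    have := hk i
    rw [hij, hk j] at this
    exact Subtype.ext (θ.injective (congrArg Prod.snd this)).symm
  obtain ⟨a, ha⟩ : ∃ a, ∀ c, c ≠ a → ∃ j, k j = c := by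
    have hcard : (Finset.univ.image k)ᶜ.card = 1 := by
      rw [Finset.card_compl, Finset.card_image_of_injective _ hkinj]
      simp
    obtain ⟨a, ha⟩ := Finset.card_eq_one.1 hcard
    refine ⟨a, fun c hc => ?_⟩
    have : c ∉ (Finset.univ.image k)ᶜ := by rw [ha]; simpa using hc
    simpa using this
  have hst : ∀ i j, G.strands (t.1, k i) (k j) = θ j.1 := by
    intro i j
    by_cases hij : i = j
    · rw [hij, G.strands_self, hk]
    · have hij' : i.1 ≠ j.1 := fun h => hij (Subtype.ext h)
      exact ((linked_legs hθ hpar hf hfθ heq hij' (hleg _ i.2) (hleg _ j.2)).strands_eq hij' hij'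
        hij'.symm hcol (hk i) (hk j)).1
  refine ⟨t.1, P, a, G.strands (t.1, k ⟨i₁, m1⟩), fun c hc => ?_⟩
  obtain ⟨j, rfl⟩ := ha c hc
  refine ⟨by rw [hk], perm_eq_of_forall_ne a fun x hx => ?_⟩
  obtain ⟨l, rfl⟩ := ha x hx
  rw [hst, hst]

/-- If the contraction of two vertices joined by parallel edges is melonic and loses as many faces as
possible, then `G` contains a melon. -/
lemma exists_isMelonAt (hD : 3 ≤ D) (hm : ∃ i, (G.pairing (T, i)).1 ≠ P)
    (hmel : (contract hθ).IsMelonic) : ∃ t p a ψ, G.IsMelonAt t p a ψ := by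
  obtain ⟨i, hi⟩ := hm
  by_cases hone : ∀ c, c ≠ i → (G.pairing (T, c)).1 = P
  · exact ⟨T, P, i, θ, hpar.isMelonAt hθ hone⟩
  push Not at hone
  obtain ⟨j, hji, hj⟩ := hone
  by_cases hc : ∃ c, c ≠ f ∧ (G.pairing (T, c)).1 = P
  · obtain ⟨c, hcf, hc⟩ := hc
    obtain ⟨t₀, k₀, -⟩ := exists_half_edge hθ hi
    obtain ⟨t, p, a, ψ, h, -⟩ := hmel.hasMelons t₀ k₀
    exact ⟨_, _, _, _, exists_isMelonAt_of_common hθ hpar hf hfθ heq hmel.colorable hji.symm hi hj hc hcf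
      (t := t) (p := p) h⟩
  · push Not at hc
    exact exists_isMelonAt_of_forall_ne hθ hpar hf hfθ heq hD hmel.colorable hmel.hasMelons hc

end Equality

end Melons

/-! ### The upper bound and its equality case -/

section UpperBound

/-- To bound the number of faces of graphs with two distinguished adjacent vertices it suffices to
treat those whose common edges are parallel. -/
lemma bound_of_parallelAt (N : ℕ) (C : ∀ G : StrandedGraph D, G.VT → G.VP → Prop)
    (hR : ∀ G T P, C G T P → IsEmpty G.R)
    (hC : ∀ (G : StrandedGraph D) (T : G.VT) (P : G.VP) (c c' : Fin (D + 1)) (hc : c ≠ c')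
      (h1 : (G.pairing (T, c)).1 = P) (h2 : (G.pairing (T, c')).1 = P), C G T P →
      C (alignEdges hc h1 h2) T P)
    (base : ∀ G T P, C G T P → G.ParallelAt T P →
      G.numFaces ≤ N ∧ (N ≤ G.numFaces → G.IsMelonic))
    (G : StrandedGraph D) (T : G.VT) (P : G.VP) (h : C G T P) :
    G.numFaces ≤ N ∧ (N ≤ G.numFaces → G.IsMelonic) := by
  classical
  obtain ⟨k, hk⟩ : ∃ k, (Finset.univ.filter fun ab : Fin (D + 1) × Fin (D + 1) =>
      (G.pairing (T, ab.1)).1 = P ∧ (G.pairing (T, ab.2)).1 = P ∧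
        G.strands (T, ab.1) ab.2 ≠ (G.pairing (T, ab.2)).2).card = k := ⟨_, rfl⟩
  induction k using Nat.strong_induction_on generalizing G with
  | _ k ih =>
    by_cases hpar : G.ParallelAt T P
    · exact base G T P h hpar
    rw [ParallelAt] at hpar
    push Not at hpar
    obtain ⟨a, b, ha, hb, hab⟩ := hpar
    have hne : a ≠ b := by
      rintro rfl
      exact hab (G.strands_self T a)
    have := hR G T P h
    have hlt : (Finset.univ.filter fun ab : Fin (D + 1) × Fin (D + 1) =>
      (G.pairing (T, ab.1)).1 = P ∧ (G.pairing (T, ab.2)).1 = P ∧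
        (alignEdges hne ha hb).strands (T, ab.1) ab.2 ≠ (G.pairing (T, ab.2)).2).card < k := by
      rw [← hk]
      refine Finset.card_lt_card ⟨fun ab hm => ?_, fun hs => ?_⟩
      · simp only [Finset.mem_filter, Finset.mem_univ, true_and] at hm ⊢
        exact ⟨hm.1, hm.2.1, fun he => hm.2.2 (alignEdges_strands_of_parallel hne ha hb hm.2.1 he)⟩
      · have := @hs (a, b) (by simpa using ⟨ha, hb, hab⟩)
        exact (Finset.mem_filter.1 this).2.2.2 (alignEdges_strands_left hne ha hb)
    obtain ⟨h1, h2⟩ := ih _ hlt (alignEdges hne ha hb) T P (hC G T P a b hne ha hb h) rfl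
    have hle := numFaces_le_alignEdges (G := G) hne ha hb
    refine ⟨hle.trans h1, fun hN => ?_⟩
    -- If `G` attained the bound, so would the aligned graph; being melonic it is colorable, so the
    -- alignment gained a face and exceeded the bound.
    have hlt := numFaces_lt_alignEdges hne ha hb (h2 (hN.trans hle)).colorable fun h => hab h.1
    omega

lemma numFaces_eq_zero (G : StrandedGraph D) [IsEmpty G.R] (h : IsEmpty G.VT) : G.numFaces = 0 := by
  rw [numFaces_eq_faceCount]
  have : IsEmpty (StrandEnd G.VT D) := ⟨fun x => h.elim x.1.1⟩
  have : IsEmpty (Quot (FaceRel corner corner G.strandEquiv)) := ⟨fun q =>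
    isEmptyElim (Quot.exists_rep q).choose⟩
  exact Nat.card_of_isEmpty

/-- A graph with two vertices, joined by parallel edges, has at most `(D + 1) D / 2` faces. -/
lemma numFaces_le_of_parallelAt {G : StrandedGraph D} [IsEmpty G.R] {T : G.VT} {P : G.VP}
    (hT : ∀ t, t = T) (hP : ∀ p, p = P) (hpar : G.ParallelAt T P) :
    G.numFaces ≤ (D + 1).choose 2 := by
  have hθ := hpar.respectsEdges (f := 0) (hP _)
  have hall : ∀ i j, AlignedAt T P (G.strands (T, 0)) G.strandEquiv i j := fun i j =>
    alignedAt_strandEquiv hθ hpar (hP _) (hP _)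
  have := (alignState_self hθ).faceCount_le hθ hall
  rw [← numFaces_eq_faceCount,
    numFaces_eq_zero (contract hθ) ⟨fun t : {t // t ≠ T} => t.2 (hT _)⟩, zero_add] at this
  exact this

lemma card_VT_contract {G : StrandedGraph D} {T : G.VT} {P : G.VP} {θ : Equiv.Perm (Fin (D + 1))}
    (hθ : G.RespectsEdges T P θ) : Nat.card (contract hθ).VT + 1 = Nat.card G.VT := by
  classical
  have := Fintype.ofFinite G.VT
  have h : Nat.card (contract hθ).VT = Fintype.card {t : G.VT // t ≠ T} :=
    Nat.card_eq_fintype_card (α := {t : G.VT // t ≠ T})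
  have hpos : 0 < Fintype.card G.VT := Fintype.card_pos_iff.2 ⟨T⟩
  rw [h, Fintype.card_subtype_compl, Fintype.card_subtype_eq, Nat.card_eq_fintype_card]
  omega

theorem numFaces_le_and_isMelonic (hD : 3 ≤ D) (n : ℕ) (G : StrandedGraph D) [IsEmpty G.R]
    (hG : G.IsConnected) (hn : Nat.card G.VT = n + 1) :
    G.numFaces ≤ D + (n + 1) * D.choose 2 ∧
      (D + (n + 1) * D.choose 2 ≤ G.numFaces → G.IsMelonic) := by
  have hchoose : (D + 1).choose 2 = D + D.choose 2 := by
    rw [Nat.choose_succ_succ' D 1, Nat.choose_one_right]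
  induction n generalizing G with
  | zero =>
    have huniq : ∀ G : StrandedGraph D, Nat.card G.VT = 1 →
        (∀ t t' : G.VT, t = t') ∧ ∀ p p' : G.VP, p = p' := fun G h => by
      have h1 := (Nat.card_eq_one_iff_unique.1 h).1
      have h2 := (Nat.card_eq_one_iff_unique.1 (G.card_VT_eq_card_VP ▸ h)).1
      exact ⟨Subsingleton.elim, Subsingleton.elim⟩
    obtain ⟨T⟩ := (Nat.card_eq_one_iff_unique.1 hn).2
    refine bound_of_parallelAt _ (fun G T P => IsEmpty G.R ∧ Nat.card G.VT = 1) (fun _ _ _ h => h.1)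
      (fun _ _ _ _ _ _ _ _ h => h) ?_ G T (G.pairing (T, 0)).1 ⟨inferInstance, hn⟩
    rintro G T P ⟨hR, hn⟩ hpar
    obtain ⟨hT, hP⟩ := huniq G hn
    have := numFaces_le_of_parallelAt (fun t => hT t T) (fun p => hP p P) hpar
    exact ⟨by omega, fun _ => isMelonic_of_parallel (fun t => hT t T) (fun p => hP p P) hpar⟩
  | succ n ih =>
    obtain ⟨T, P, f, hf, hc⟩ := hG.exists_removable (by omega)
    -- All these conditions depend only on which half-edges are paired, so alignment preserves them
    -- definitionally.
    refine bound_of_parallelAt _ (fun G T P => IsEmpty G.R ∧ G.IsConnected ∧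
      Nat.card G.VT = n + 1 + 1 ∧ (∃ f, (G.pairing (T, f)).1 = P) ∧
      (G.skeleton.induce {Sum.inl (Sum.inl T), Sum.inl (Sum.inr P)}ᶜ).Connected) (fun _ _ _ h => h.1)
      (fun _ _ _ _ _ _ _ _ h => h) ?_ G T P ⟨inferInstance, hG, hn, ⟨f, hf⟩, hc⟩
    rintro G T P ⟨hR, hG, hn, ⟨f, hf⟩, hc⟩ hpar
    have hleg : ∀ T P, ∃ i, (G.pairing (T, i)).1 ≠ P := by
      intro T P
      by_contra hcon
      push Not at hcon
      have : Subsingleton G.VT := ⟨fun t t' =>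
        (hG.eq_of_forall_pairing hcon t).trans (hG.eq_of_forall_pairing hcon t').symm⟩
      have := Finite.card_le_one_iff_subsingleton.2 this
      omega
    have hcard : ∀ {T P} {θ : Equiv.Perm (Fin (D + 1))} (hθ : G.RespectsEdges T P θ),
        Nat.card (contract hθ).VT = n + 1 := fun hθ => by
      have := card_VT_contract hθ
      omega
    have hθ := hpar.respectsEdges hf
    obtain ⟨b1, b2⟩ := ih (contract hθ) (isConnected_contract hθ hc) (hcard hθ)
    have hle := numFaces_le_contract hθ hpar hf rfl (hleg T P)
    have hmul : (n + 1 + 1) * D.choose 2 = (n + 1) * D.choose 2 + D.choose 2 := by ring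
    refine ⟨by omega, fun hN => ?_⟩
    -- Attaining the bound forces equality in `hle` and in `b1`, so the contraction is melonic by
    -- induction.
    obtain ⟨t, p, a, ψ, hmel⟩ := exists_isMelonAt hθ hpar hf rfl (by omega) hD (hleg T P) (b2 (by omega))
    have ha : (G.pairing (t, a)).1 ≠ p := by
      intro ha
      obtain ⟨i, hi⟩ := hleg t p
      by_cases hia : i = a
      · exact hi (hia ▸ ha)
      · exact hi (hmel i hia).1
    obtain ⟨c, hca⟩ : ∃ c, c ≠ a := by
      have : Nontrivial (Fin (D + 1)) := Fin.nontrivial_iff_two_le.2 (by omega)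
      exact exists_ne a
    -- Contracting the melon loses at most C(D,2) faces, so that contraction also attains its bound
    -- and is melonic by induction.
    have hle' := numFaces_le_contract (hmel.respectsEdges ha) (hmel.parallelAt ha) (hmel c hca).1
      (hmel c hca).2 ⟨a, ha⟩
    exact hmel.isMelonic ha
      ((ih _ (hmel.isConnected_contract ha hG) (hcard _)).2 (by omega))

end UpperBound

/-! ### Single rings and the degree -/

section Ring

/-- A single ring has at most `D` faces, with equality only for the identity permutation. -/
lemma numFaces_le_of_ring {G : StrandedGraph D} (hT : IsEmpty G.VT) (hP : IsEmpty G.VP) (r : G.R)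
    (hr : ∀ r', r' = r) : G.numFaces ≤ D ∧ (D ≤ G.numFaces → G.IsMelonic) := by
  let g : Fin D → G.Face := fun k => Quot.mk _ (Sum.inr (r, k))
  have hg : Function.Surjective g := by
    intro q
    obtain ⟨⟨⟨t, x⟩, -⟩ | ⟨r', k⟩, rfl⟩ := Quot.exists_rep q
    · exact hT.elim t
    · obtain rfl := hr r'
      exact ⟨k, rfl⟩
  have hle := Nat.card_le_card_of_surjective g hg
  rw [Nat.card_fin] at hle
  refine ⟨hle, fun h => ?_⟩
  have hinj : Function.Injective g :=
    ((Nat.bijective_iff_surjective_and_card g).2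
      ⟨hg, (Nat.card_fin D).trans (le_antisymm h hle)⟩).1
  have h1 : G.ringPerm r = 1 := by
    ext1 k
    exact (hinj (Quot.sound (.ring r k))).symm
  refine .ring G ⟨Equiv.equivOfIsEmpty G.VT Empty, Equiv.equivOfIsEmpty G.VP Empty, ⟨fun _ => (), fun _ => r,
    fun r' => (hr r').symm, fun _ => rfl⟩, fun _ => 1, fun _ => 1, fun _ => 1, fun t => hT.elim t,
    fun t => hT.elim t, fun r' k => ?_⟩
  obtain rfl := hr r'
  rw [h1]
  rfl

end Ring

/-- A connected graph has at most `D + n D (D - 1) / 2` faces, with equality only for melonic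
graphs, if it has `n` vertices of each type. -/
theorem IsConnected.numFaces_le_and_isMelonic (hD : 3 ≤ D) {G : StrandedGraph D}
    (hG : G.IsConnected) : G.numFaces ≤ D + Nat.card G.VT * D.choose 2 ∧
      (D + Nat.card G.VT * D.choose 2 ≤ G.numFaces → G.IsMelonic) := by
  rcases hG.ring_or with ⟨hT, hP, r, hr⟩ | ⟨hR, hT⟩
  · rw [Nat.card_of_isEmpty, zero_mul, add_zero]
    exact numFaces_le_of_ring hT hP r hr
  · obtain ⟨n, hn⟩ := Nat.exists_eq_succ_of_ne_zero (Nat.card_pos (α := G.VT)).ne'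
    rw [hn]
    exact StrandedGraph.numFaces_le_and_isMelonic hD n G hG hn

/-- The numbers of `T`- and `P`-vertices agree, so D(D − 1)/4 per vertex amounts to C(D,2) per pair.
-/
lemma degree_eq (G : StrandedGraph D) :
    G.degree = ((D + Nat.card G.VT * D.choose 2 : ℕ) : ℚ) - G.numFaces := by
  rw [degree, numVertices, ← card_VT_eq_card_VP]
  push_cast
  rw [Nat.cast_choose_two]
  ring

end StrandedGraph

theorem mainTheorem2 (D : ℕ) (hD : 3 ≤ D) (G : StrandedGraph D) (hG : G.IsConnected) :
    G.degree = 0 ↔ G.IsMelonic := by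
  obtain ⟨h1, h2⟩ := hG.numFaces_le_and_isMelonic hD
  rw [G.degree_eq, sub_eq_zero, Nat.cast_inj]
  exact ⟨fun h => h2 h.le, fun h => le_antisymm h.le_numFaces h1⟩
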